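/- **Setting.** Let $\mathfrak h\ge 0$, $\beta>0$, and let $(h_i)_{i\ge 1}$ be i.i.d. random variables with law $\frac12\delta_{\mathfrak h}+\frac12\delta_{-\mathfrak h}$ (so $h_i=\pm\mathfrak h$ with probability $\frac12$ each). For $N\in\mathbb N$ and $\sigma\in\{-1,+1\}^N$ let $$H_N(\sigma)=-\frac1{2N}\sum_{i,j=1}^N\sigma_i\sigma_j-\sum_{i=1}^N h_i\sigma_i,\qquad \mu_N(\sigma)=\frac{e^{-\beta H_N(\sigma)}}{\sum_{\sigma'}e^{-\beta H_N(\sigma')}},$$ and let $\mu_{N,k}$ be the marginal distribution of the first $k$ spins under $\mu_N$. Let $H(\mu|\nu)$ denote relative entropy. Put $$G(y)=-\frac{y^2}2+\mathbb E\log\cosh(\sqrt\beta\,y+\beta h_1),\qquad \varrho^{(k)}[y](\sigma)=\prod_{i=1}^k\frac{e^{\sigma_i(\sqrt\beta\,y+\beta h_i)}}{2\cosh(\sqrt\beta\,y+\beta h_i)}\quad(\sigma\in\{-1,+1\}^k).$$ A global maximum point $y$ of $G$ is called non-degenerate if $G'(y)=0$ and $G''(y)<0$. For $0\le\mathfrak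 h<\frac12$ let $f(\mathfrak h)$ be the critical inverse temperature, i.e. the infimum of all $\beta>0$ for which $0$ is not a global maximum point of $G$. Let $\mathfrak h_c=\frac23\operatorname{arcosh}\sqrt{3/2}$. **Statement.** The function $f$ is strictly increasing on $[0,\frac12)$, $f(0)=1$ and $f(x)\to\infty$ as $x\uparrow\frac12$. Moreover: 1. Suppose that $\mathfrak h\ge\frac12$, or that $\mathfrak h<\frac12$ and $\beta<f(\mathfrak h)$, or that $\beta=f(\mathfrak h)$ and $\mathfrak h\le\mathfrak h_c$. Then $0$ is the unique global maximum point of $G$ (a non-degenerate one if $\mathfrak h<\frac12$ and $\beta<f(\mathfrak h)$), and with $\varrho_0^{(k)}=\varrho^{(k)}[0]$, for every fixed $k$ and almost every realization of $(h_i)$, $$H(\mu_{N,k}|\varrho_0^{(k)})\to0\qquad(N\to\infty).$$ 2. Suppose that $\mathfrak h<\frac12$ and $\beta>f(\mathfrak h)$. Then $G$ has exactly two global maximum points $y_1>0$ and $y_{-1}=-y_1$, both non-degenerate. If moreover $\mathfrak h>0$, then, with $\varrho_j^{(k)}=\varrho^{(k)}[y_j]$ for $j\in\{-1,1\}$, for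 every fixed $k$ there are random indices $J_N=J_N^{(k)}(h_1,\dots,h_N)\in\{-1,1\}$ such that, in probability as $N\to\infty$, $$\bigl|\mu_{N,k}(\sigma)-\varrho^{(k)}_{J_N}(\sigma)\bigr|\to0\ \text{ for all }\sigma\in\{-1,+1\}^k,\qquad\text{and}\qquad H(\mu_{N,k}|\varrho^{(k)}_{J_N})\to0.$$ 3. Suppose that $\mathfrak h_c<\mathfrak h<\frac12$ and $\beta=f(\mathfrak h)$. Then $G$ has exactly three global maximum points $y_{-1}=-y_1$, $y_0=0$ and $y_1>0$, all non-degenerate, and for every fixed $k$ there are random indices $J_N=J_N^{(k)}(h_1,\dots,h_N)\in\{-1,0,1\}$ such that, with $\varrho_j^{(k)}=\varrho^{(k)}[y_j]$, both convergences of part 2 hold in probability as $N\to\infty$. -/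

import Mathlib

open MeasureTheory ProbabilityTheory Filter Topology Set
open scoped ENNReal

noncomputable section

namespace RandomFieldCurieWeiss

/-! Spins are elements of `ℤˣ = {-1, +1}`; a realization of the external field is a sequence
`x : ℕ → ℝ`, the field at the `i`-th site being `x i` (sites are numbered from `0`). -/

/-- The Hamiltonian `H_N(σ) = -(1/2N) ∑_{i,j} σ_i σ_j - ∑_i x_i σ_i`. -/
def hamiltonian (x : ℕ → ℝ) (N : ℕ) (σ : Fin N → ℤˣ) : ℝ :=
  -(1 / (2 * (N : ℝ))) * ∑ i, ∑ j, ((σ i : ℤ) : ℝ) * ((σ j : ℤ) : ℝ)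
    - ∑ i : Fin N, x i * ((σ i : ℤ) : ℝ)

/-- The partition function `Z_N = ∑_σ exp(-β H_N(σ))`. -/
def partitionFunction (β : ℝ) (x : ℕ → ℝ) (N : ℕ) : ℝ :=
  ∑ σ : Fin N → ℤˣ, Real.exp (-β * hamiltonian x N σ)

/-- The measure on the finite set `{-1,+1}^n` with the given point weights. -/
def measureOfWeights {n : ℕ} (w : (Fin n → ℤˣ) → ℝ) : Measure (Fin n → ℤˣ) :=
  ∑ σ : Fin n → ℤˣ, ENNReal.ofReal (w σ) • Measure.dirac σ

/-- The Gibbs measure `μ_N(σ) = exp(-β H_N(σ)) / Z_N` on `{-1,+1}^N`. -/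
def gibbsMeasure (β : ℝ) (x : ℕ → ℝ) (N : ℕ) : Measure (Fin N → ℤˣ) :=
  measureOfWeights fun σ => Real.exp (-β * hamiltonian x N σ) / partitionFunction β x N

/-- The first `k` coordinates of a configuration of `N` spins. Only `k ≤ N` is meaningful;
missing coordinates are set to `+1`. -/
def firstSpins (N k : ℕ) (σ : Fin N → ℤˣ) : Fin k → ℤˣ :=
  fun i => if hi : (i : ℕ) < N then σ ⟨i, hi⟩ else 1

/-- The marginal distribution `μ_{N,k}` of the first `k` spins under `μ_N`. -/
def gibbsMarginal (β : ℝ) (x : ℕ → ℝ) (N k : ℕ) : Measure (Fin k → ℤˣ) :=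
  (gibbsMeasure β x N).map (firstSpins N k)

/-- The product measure on `{-1,+1}^k` with weights
`∏_{i<k} exp(σ_i (√β y + β x_i)) / (2 cosh(√β y + β x_i))`. -/
def productMeasure (β y : ℝ) (x : ℕ → ℝ) (k : ℕ) : Measure (Fin k → ℤˣ) :=
  measureOfWeights fun σ => ∏ i : Fin k,
    Real.exp (((σ i : ℤ) : ℝ) * (√β * y + β * x i)) / (2 * Real.cosh (√β * y + β * x i))

/-- The dichotomous law: the values `𝔥` and `-𝔥` with probability `1/2` each. -/
def dichotomousLaw (𝔥 : ℝ) : Measure ℝ :=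
  (2⁻¹ : ℝ≥0∞) • Measure.dirac 𝔥 + (2⁻¹ : ℝ≥0∞) • Measure.dirac (-𝔥)

/-- `G(y) = -y²/2 + E[log cosh(√β y + β h)]` for a dichotomous field `h = ±𝔥`. -/
def G (β 𝔥 y : ℝ) : ℝ :=
  -(y ^ 2 / 2) + ∫ t, Real.log (Real.cosh (√β * y + β * t)) ∂(dichotomousLaw 𝔥)

/-- The set of global maximum points of `G`. -/
def maximizers (β 𝔥 : ℝ) : Set ℝ := {y | ∀ z, G β 𝔥 z ≤ G β 𝔥 y}

/-- `y` is a non-degenerate global maximum point of `G`. -/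
def IsNondegenerateMax (β 𝔥 y : ℝ) : Prop :=
  y ∈ maximizers β 𝔥 ∧ deriv (G β 𝔥) y = 0 ∧ deriv (deriv (G β 𝔥)) y < 0

/-- The critical inverse temperature `f(𝔥)`: the infimum of the inverse temperatures at which
`0` is not a global maximum point of `G`. (Used for `0 ≤ 𝔥 < 1/2` only.) -/
def criticalBeta (𝔥 : ℝ) : ℝ := sInf {β : ℝ | 0 < β ∧ 0 ∉ maximizers β 𝔥}

/-- For the random field `h`, and with `y_j = j * y₁` for `j ∈ S ⊆ {-1, 0, 1}`: there is a random
index `J = J_N(h_1, …, h_N) ∈ S` such that the marginals `μ_{N,k}` approach the product measures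
with parameter `y_J`, pointwise and in relative entropy, in probability as `N → ∞`. -/
def ConvergesToSelectedProduct {Ω : Type*} [MeasurableSpace Ω] (P : Measure Ω) (h : ℕ → Ω → ℝ)
    (β y₁ : ℝ) (S : Set ℤ) (k : ℕ) : Prop :=
  ∃ J : (N : ℕ) → (Fin N → ℝ) → ℤ,
    (∀ N, Measurable (J N)) ∧ (∀ N x, J N x ∈ S) ∧
    (∀ σ : Fin k → ℤˣ,
      TendstoInMeasure P
        (fun N ω => |(gibbsMarginal β (fun i => h i ω) N k).real {σ} -
          (productMeasure β ((J N fun i => h i ω : ℤ) * y₁) (fun i => h i ω) k).real {σ}|)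
        atTop (fun _ => 0)) ∧
    (∀ ε : ℝ≥0∞, 0 < ε →
      Tendsto
        (fun N => P {ω | ε ≤ InformationTheory.klDiv (gibbsMarginal β (fun i => h i ω) N k)
          (productMeasure β ((J N fun i => h i ω : ℤ) * y₁) (fun i => h i ω) k)})
        atTop (𝓝 0))

end RandomFieldCurieWeiss

end

noncomputable section

namespace RandomFieldCurieWeiss

/-! ### Elementary inequalities for hyperbolic functions -/

/-! Maximum points of G. With a = β𝔥 and A = cosh² a, the addition formulas give G(y) - G(0) =
(`excess A (√β y)` - y²) / 2, where `excess A t` = log(1 + sinh² t / A). Hence 0 is a global maximum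
point iff β · `maxRatio A` ≤ 1, where `maxRatio A` is the supremum of `excess A t` / t². For 𝔥 > 0,
multiplication by 𝔥 turns this into `criticalField a` ≤ 𝔥 with `criticalField a` = a · `maxRatio
(cosh² a)`. The critical line is thus described by one function of a, and its properties follow once
`criticalField` is known to increase strictly from 0 to the limit 1/2.

Strict increase is the hard analytic point. If A ≤ 3/2, the supremum is the limit 1/A at t → 0 and a
/ cosh² a is increasing there. If A > 3/2, the supremum is attained at some t > 0, and an envelope
argument reduces the claim to 2a tanh a < t coth t at that t. The opposite inequality would
contradict the critical point equation, by `log_lt_of_mul_cosh_le`; that lemma is reduced to an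
inequality in t alone, which is then checked with explicit constants.

The third derivative of the excess changes sign at most once on t > 0, so `excess' A t` / t first
rises and then falls. Therefore there is at most one positive maximum point, and it is
non-degenerate. The threshold A = 3/2 decides whether 0 coexists with ±y₁ on the critical line;
there cosh² a = 3/2 and 𝔥 = a / A = (2/3) arcosh √(3/2).

Gibbs measures. Linearizing the quadratic interaction by a Gaussian integral (Hubbard-Stratonovich)
shows that the marginal of the first k spins is a mixture over y of product measures, with density
proportional to exp(N G(y) + (W/2) `tilt(y)`), where W is the sum of the signs of the fields. By the
law of large numbers W = o(N) almost surely, so the mixture concentrates near the maximum points of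
G; this settles the case of a unique one.

With several maximum points, W decides. By the central limit theorem |W| exceeds any constant with
probability tending to 1. For W > 0 the neighbourhood of -y₁ loses a factor exponential in W against
that of y₁, because `tilt` is odd and positive on the right. The neighbourhood of 0 loses as well,
because `tilt` vanishes at 0 while G is quadratically controlled there. So the selected index is the
sign of the field sum. On a finite space with point masses bounded below, pointwise closeness yields
closeness in relative entropy. -/

lemma le_of_hasDerivAt_nonneg {f f' : ℝ → ℝ} {a b : ℝ} (hab : a ≤ b)
    (hf : ∀ x, a ≤ x → x ≤ b → HasDerivAt f (f' x) x) (h : ∀ x, a < x → x < b → 0 ≤ f' x) :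
    f a ≤ f b := by
  have : MonotoneOn f (Icc a b) := by
    apply monotoneOn_of_deriv_nonneg (convex_Icc a b)
    · exact fun x hx => (hf x hx.1 hx.2).continuousAt.continuousWithinAt
    · intro x hx
      rw [interior_Icc] at hx
      exact (hf x hx.1.le hx.2.le).differentiableAt.differentiableWithinAt
    · intro x hx
      rw [interior_Icc] at hx
      rw [(hf x hx.1.le hx.2.le).deriv]
      exact h x hx.1 hx.2
  exact this (left_mem_Icc.2 hab) (right_mem_Icc.2 hab) hab

lemma lt_of_hasDerivAt_pos {f f' : ℝ → ℝ} {a b : ℝ} (hab : a < b)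
    (hf : ∀ x, a ≤ x → x ≤ b → HasDerivAt f (f' x) x) (h : ∀ x, a < x → x < b → 0 < f' x) :
    f a < f b := by
  have : StrictMonoOn f (Icc a b) := by
    apply strictMonoOn_of_deriv_pos (convex_Icc a b)
    · exact fun x hx => (hf x hx.1 hx.2).continuousAt.continuousWithinAt
    · intro x hx
      rw [interior_Icc] at hx
      rw [(hf x hx.1.le hx.2.le).deriv]
      exact h x hx.1 hx.2
  exact this (left_mem_Icc.2 hab.le) (right_mem_Icc.2 hab.le) hab

lemma sinh_le_mul_cosh {t : ℝ} (ht : 0 ≤ t) : Real.sinh t ≤ t * Real.cosh t := by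
  have := le_of_hasDerivAt_nonneg (f := fun x => x * Real.cosh x - Real.sinh x)
    (f' := fun x => x * Real.sinh x) ht
    (fun x _ _ => (((hasDerivAt_id x).mul (Real.hasDerivAt_cosh x)).sub
      (Real.hasDerivAt_sinh x)).congr_deriv (by simp))
    (fun x hx _ => mul_nonneg hx.le (Real.sinh_nonneg_iff.2 hx.le))
  simp at this
  linarith

lemma three_mul_sinh_le {t : ℝ} (ht : 0 ≤ t) : 3 * Real.sinh t ≤ t * (2 + Real.cosh t) := by
  have h1 : ∀ x : ℝ, 0 ≤ x → 0 ≤ 2 - 2 * Real.cosh x + x * Real.sinh x := by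
    intro x hx
    have := le_of_hasDerivAt_nonneg (f := fun x => 2 - 2 * Real.cosh x + x * Real.sinh x)
      (f' := fun x => x * Real.cosh x - Real.sinh x) hx
      (fun x _ _ => ((((Real.hasDerivAt_cosh x).const_mul 2).const_sub 2).add
        ((hasDerivAt_id x).mul (Real.hasDerivAt_sinh x))).congr_deriv (by simp; ring))
      (fun x hx _ => sub_nonneg.2 (sinh_le_mul_cosh hx.le))
    simpa using this
  have := le_of_hasDerivAt_nonneg (f := fun x => x * (2 + Real.cosh x) - 3 * Real.sinh x)
    (f' := fun x => 2 - 2 * Real.cosh x + x * Real.sinh x) ht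
    (fun x _ _ => (((hasDerivAt_id x).mul ((Real.hasDerivAt_cosh x).const_add 2)).sub
      ((Real.hasDerivAt_sinh x).const_mul 3)).congr_deriv (by simp; ring))
    (fun x hx _ => h1 x hx.le)
  simp at this
  linarith

/-- The quotient (15 + 6t²) / (15 + t²) is the Padé approximant of t coth t in t², exact through
order t⁴; two differentiations reduce the bound to sinh t ≤ t cosh t. -/
lemma sinh_mul_le_mul_cosh {t : ℝ} (ht : 0 ≤ t) :
    Real.sinh t * (15 + 6 * t ^ 2) ≤ t * Real.cosh t * (15 + t ^ 2) := by
  have h1 : ∀ x : ℝ, 0 ≤ x →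
      0 ≤ -3 * (x * Real.cosh x) + 3 * Real.sinh x + x ^ 2 * Real.sinh x := by
    intro x hx
    have := le_of_hasDerivAt_nonneg
      (f := fun x => -3 * (x * Real.cosh x) + 3 * Real.sinh x + x ^ 2 * Real.sinh x)
      (f' := fun x => x * (x * Real.cosh x - Real.sinh x)) hx
      (fun x _ _ => (((((hasDerivAt_id x).mul (Real.hasDerivAt_cosh x)).const_mul (-3)).add
        ((Real.hasDerivAt_sinh x).const_mul 3)).add
        ((hasDerivAt_pow 2 x).mul (Real.hasDerivAt_sinh x))).congr_deriv (by simp; ring))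
      (fun x hx _ => mul_nonneg hx.le (sub_nonneg.2 (sinh_le_mul_cosh hx.le)))
    simpa using this
  have := le_of_hasDerivAt_nonneg
    (f := fun x => x * Real.cosh x * (15 + x ^ 2) - Real.sinh x * (15 + 6 * x ^ 2))
    (f' := fun x => x * (-3 * (x * Real.cosh x) + 3 * Real.sinh x + x ^ 2 * Real.sinh x)) ht
    (fun x _ _ => ((((hasDerivAt_id x).mul (Real.hasDerivAt_cosh x)).mul
      ((hasDerivAt_pow 2 x).const_add 15)).sub ((Real.hasDerivAt_sinh x).mul
      (((hasDerivAt_pow 2 x).const_mul 6).const_add 15))).congr_deriv (by simp; ring))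
    (fun x hx _ => mul_nonneg hx.le (h1 x hx.le))
  simp at this
  linarith

/-- A Padé approximant exact through order x³; the difference has a derivative of constant sign. -/
lemma log_one_add_le_pade {x : ℝ} (hx : 0 ≤ x) :
    Real.log (1 + x) ≤ x * (6 + x) / (6 + 4 * x) := by
  have := le_of_hasDerivAt_nonneg
    (f := fun x => x * (6 + x) / (6 + 4 * x) - Real.log (1 + x))
    (f' := fun x => 4 * x ^ 3 / ((6 + 4 * x) ^ 2 * (1 + x))) hx
    (fun x h0 _ => by
      have h1 : 6 + 4 * x ≠ 0 := by positivity
      have h2 : 1 + x ≠ 0 := by positivity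
      refine ((((hasDerivAt_id x).mul ((hasDerivAt_id x).const_add 6)).div
        (((hasDerivAt_id x).const_mul 4).const_add 6) h1).sub
        (((hasDerivAt_id x).const_add 1).log h2)).congr_deriv ?_
      simp
      field_simp
      ring)
    (fun x hx _ => by positivity)
  simp at this
  linarith

/-! ### The one-variable inequality for t² ≤ 2. -/

lemma cosh_le_of_sq_le_two {t : ℝ} (ht : t ^ 2 ≤ 2) :
    2 * (Real.cosh t - 1) ≤ t ^ 2 * (1 + t ^ 2 / 12 + t ^ 4 / 340) := by
  -- Halving brings the argument into |z| ≤ 1, the range of `Real.exp_bound`.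
  obtain ⟨z, rfl⟩ : ∃ z, t = 2 * z := ⟨t / 2, by ring⟩
  have hz2 : z ^ 2 ≤ 1 / 2 := by nlinarith
  have hz1 : |z| ≤ 1 := by
    rw [← sq_le_one_iff_abs_le_one]; linarith
  have e1 := abs_le.1 (Real.exp_bound hz1 (n := 6) (by norm_num))
  have e2 := abs_le.1 (Real.exp_bound (x := -z) (by rwa [abs_neg]) (n := 6) (by norm_num))
  simp only [Finset.sum_range_succ, Finset.sum_range_zero, Nat.factorial, abs_neg] at e1 e2
  have h6 : |z| ^ 6 = z ^ 6 := by rw [← abs_pow, abs_of_nonneg (by positivity)]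
  rw [h6] at e1 e2
  -- The remainder in `Real.exp_bound` with n = 6 is 7 z⁶ / (6 · 6!), slightly below z⁶ / 617.
  have hc : Real.cosh z ≤ 1 + z ^ 2 / 2 + z ^ 4 / 24 + z ^ 6 / 617 := by
    rw [Real.cosh_eq]
    have := e1.2
    have := e2.2
    have : 0 ≤ z ^ 6 := by positivity
    norm_num at *
    nlinarith
  have hc1 := Real.one_le_cosh z
  have hd : Real.cosh (2 * z) - 1 = 2 * (Real.cosh z - 1) * (Real.cosh z + 1) := by
    rw [Real.cosh_two_mul, Real.sinh_sq]; ring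
  rw [hd]
  have hv : 0 ≤ z ^ 2 := by positivity
  have e4 : z ^ 4 = (z ^ 2) ^ 2 := by ring
  have e6 : z ^ 6 = (z ^ 2) ^ 3 := by ring
  have e4' : (2 * z) ^ 4 = 16 * (z ^ 2) ^ 2 := by ring
  have e2' : (2 * z) ^ 2 = 4 * z ^ 2 := by ring
  rw [e4, e6] at hc
  rw [e4', e2']
  generalize z ^ 2 = v at *
  have hP : Real.cosh z - 1 ≤ v * (1 / 2 + v / 24 + v ^ 2 / 617) := by nlinarith
  have hQ : Real.cosh z + 1 ≤ 2 + v / 2 + v ^ 2 / 24 + v ^ 3 / 617 := by nlinarith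
  calc 2 * (2 * (Real.cosh z - 1) * (Real.cosh z + 1))
      = 4 * ((Real.cosh z - 1) * (Real.cosh z + 1)) := by ring
    _ ≤ 4 * ((v * (1 / 2 + v / 24 + v ^ 2 / 617)) * (2 + v / 2 + v ^ 2 / 24 + v ^ 3 / 617)) := by
        gcongr
    _ ≤ _ := by
        have h3 : v ^ 3 ≤ v ^ 2 / 2 := by nlinarith [sq_nonneg v]
        have h4 : v ^ 4 ≤ v ^ 2 / 4 := by nlinarith [sq_nonneg v]
        have h5 : v ^ 5 ≤ v ^ 2 / 8 := by nlinarith [sq_nonneg v]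
        have : 4 * ((1 / 2 + v / 24 + v ^ 2 / 617) * (2 + v / 2 + v ^ 2 / 24 + v ^ 3 / 617))
          ≤ 4 * (1 + 4 * v / 12 + 16 * v ^ 2 / 340) := by
          nlinarith
        nlinarith

lemma exp_neg_half_le : Real.exp (-(1 / 2)) ≤ 0.60655 := by
  have h1 : Real.exp (-(1 / 2)) ^ 2 = (Real.exp 1)⁻¹ := by
    rw [← Real.exp_nat_mul, ← Real.exp_neg]; norm_num
  have h2 : (Real.exp 1)⁻¹ ≤ (2.7182818283)⁻¹ :=
    inv_anti₀ (by norm_num) Real.exp_one_gt_d9.le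
  refine abs_le_of_sq_le_sq' ?_ (by norm_num) |>.2
  rw [h1]
  exact h2.trans (by norm_num)

/-- Every transcendental factor is replaced by a rational bound in t². The constant 0.607 reflects X
/ t² → e^(-1/2) ≈ 0.6065 as t → 0, since t / (t + sinh t) → 1/2. -/
lemma log_bound_of_sq_le_two {t : ℝ} (ht : 0 < t) (ht2 : t ^ 2 ≤ 2) {X : ℝ}
    (hX : X = 2 * (Real.cosh t - 1) * Real.exp (-(t / (t + Real.sinh t)))) :
    (1 + X) * Real.log (1 + X) * Real.sinh t < t * Real.cosh t * X := by
  have hs : 0 < Real.sinh t := Real.sinh_pos_iff.2 ht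
  have hc1 : 1 < Real.cosh t := Real.one_lt_cosh.2 ht.ne'
  have hv : 0 < t ^ 2 := by positivity
  have hX0 : 0 < X := by
    rw [hX]; have := Real.exp_pos (-(t / (t + Real.sinh t))); have : 0 < Real.cosh t - 1 := by linarith
    positivity
  have hC := cosh_le_of_sq_le_two ht2
  have e4 : t ^ 4 = (t ^ 2) ^ 2 := by ring
  have hw : 1 / 2 - t ^ 2 / 24 ≤ t / (t + Real.sinh t) := by
    rw [le_div_iff₀ (by positivity)]
    have h3 := three_mul_sinh_le ht.le
    have : Real.cosh t ≤ 1 + t ^ 2 * (1 + t ^ 2 / 12 + t ^ 4 / 340) / 2 := by linarith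
    have h5 : Real.sinh t ≤ t * (1 + t ^ 2 * (1 + t ^ 2 / 12 + t ^ 4 / 340) / 6) := by
      have := mul_le_mul_of_nonneg_left this ht.le
      linarith
    have h6 : (1 / 2 - t ^ 2 / 24) * (1 + (1 + t ^ 2 * (1 + t ^ 2 / 12 + t ^ 4 / 340) / 6)) ≤ 1 := by
      rw [e4]
      generalize t ^ 2 = v at *
      nlinarith [pow_pos hv 2, pow_pos hv 3, pow_pos hv 4]
    have h7 : 0 ≤ 1 / 2 - t ^ 2 / 24 := by linarith
    calc (1 / 2 - t ^ 2 / 24) * (t + Real.sinh t)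
        ≤ (1 / 2 - t ^ 2 / 24) * (t + t * (1 + t ^ 2 * (1 + t ^ 2 / 12 + t ^ 4 / 340) / 6)) := by
          gcongr
      _ = t * ((1 / 2 - t ^ 2 / 24) *
            (1 + (1 + t ^ 2 * (1 + t ^ 2 / 12 + t ^ 4 / 340) / 6))) := by ring
      _ ≤ t := by nlinarith
  have hE : Real.exp (-(t / (t + Real.sinh t))) ≤ 0.6066 * (1 + t ^ 2 / 24 + t ^ 4 / 768) := by
    calc Real.exp (-(t / (t + Real.sinh t))) ≤ Real.exp (-(1 / 2) + t ^ 2 / 24) :=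
          Real.exp_le_exp.2 (by linarith)
      _ = Real.exp (-(1 / 2)) * Real.exp (t ^ 2 / 24) := Real.exp_add _ _
      _ ≤ _ := by
        gcongr
        · exact exp_neg_half_le.trans (by norm_num)
        · have := Real.exp_bound' (x := t ^ 2 / 24) (by positivity) (by linarith) (n := 2) (by norm_num)
          simp only [Finset.sum_range_succ, Finset.sum_range_zero, Nat.factorial] at this
          norm_num at this
          linarith
  have hXY : X ≤ t ^ 2 * (0.607 + 0.086 * t ^ 2) := by
    rw [hX]
    calc 2 * (Real.cosh t - 1) * Real.exp (-(t / (t + Real.sinh t)))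
        ≤ (t ^ 2 * (1 + t ^ 2 / 12 + t ^ 4 / 340)) * (0.6066 * (1 + t ^ 2 / 24 + t ^ 4 / 768)) := by
          gcongr
      _ ≤ _ := by
        have : (1 + t ^ 2 / 12 + t ^ 4 / 340) * (0.6066 * (1 + t ^ 2 / 24 + t ^ 4 / 768))
            ≤ 0.607 + 0.086 * t ^ 2 := by
          rw [e4]
          generalize t ^ 2 = v at *
          have h3 : v ^ 2 ≤ 2 * v := by nlinarith
          have h4 : v ^ 3 ≤ 2 * v ^ 2 := by nlinarith
          have h5 : v ^ 4 ≤ 2 * v ^ 3 := by nlinarith [pow_pos hv 3]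
          nlinarith
        nlinarith
  have hp := sinh_mul_le_mul_cosh ht.le
  have hL := log_one_add_le_pade hX0.le
  -- With v = t² this expands to X (45 - 17v + X (15 + v)) < 30v. As 45 - 17v > 0 for v ≤ 2, X may
  -- be replaced by its upper bound `hXY`.
  have hD : (1 + X) * (6 + X) * (15 + t ^ 2) < (6 + 4 * X) * (15 + 6 * t ^ 2) := by
    clear hL hX hE hC hp hw e4
    generalize t ^ 2 = v at *
    have hY : X * (45 - 17 * v + v * (0.607 + 0.086 * v) * (15 + v)) ≤
        v * (0.607 + 0.086 * v) * (45 - 17 * v + v * (0.607 + 0.086 * v) * (15 + v)) := by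
      apply mul_le_mul_of_nonneg_right hXY
      have : 0 ≤ v * (0.607 + 0.086 * v) * (15 + v) := by positivity
      linarith
    have hY2 : X * X * (15 + v) ≤ X * (v * (0.607 + 0.086 * v)) * (15 + v) := by gcongr
    have hY3 : (0.607 + 0.086 * v) * (45 - 17 * v + v * (0.607 + 0.086 * v) * (15 + v)) < 30 := by
      nlinarith [pow_pos hv 2, pow_pos hv 3, pow_pos hv 4, mul_pos hv hv, mul_nonneg hv.le (sub_nonneg.2 ht2), mul_nonneg (sq_nonneg v) (sub_nonneg.2 ht2)]
    nlinarith
  have h64 : 0 < 6 + 4 * X := by positivity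
  have h15 : 0 < 15 + t ^ 2 := by positivity
  calc (1 + X) * Real.log (1 + X) * Real.sinh t
      ≤ (1 + X) * (X * (6 + X) / (6 + 4 * X)) * Real.sinh t := by gcongr
    _ = X * Real.sinh t * ((1 + X) * (6 + X) * (15 + t ^ 2)) / ((6 + 4 * X) * (15 + t ^ 2)) := by
        field_simp
    _ < X * Real.sinh t * ((6 + 4 * X) * (15 + 6 * t ^ 2)) / ((6 + 4 * X) * (15 + t ^ 2)) := by
        gcongr
    _ = X * (Real.sinh t * (15 + 6 * t ^ 2)) / (15 + t ^ 2) := by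
        field_simp
    _ ≤ X * (t * Real.cosh t * (15 + t ^ 2)) / (15 + t ^ 2) := by gcongr
    _ = _ := by field_simp

/-! ### The one-variable inequality for large t. -/

set_option maxHeartbeats 1000000 in
lemma poly_bound {q w : ℝ} (hq : 0 < q) (hq1 : q ≤ 0.2466) (hw : 0 < w)
    (hc : w * (1 - q ^ 2) ≤ (1 - w) * (0.4464 + q)) :
    w * (1 - q) * ((1 + q) * (1 + w + 0.6 * w ^ 2) - 2 * q * (1 - q)) <
      2 * (1 - w) * ((1 - q * (1 - q - w - 0.6 * w ^ 2)) *
        (w + q * (1 - q - w - 0.6 * w ^ 2))) := by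
  -- A linear majorant in q of the bound w ≤ (0.4464 + q) / (1.4464 + q - q²), which is what `hc`
  -- says.
  obtain ⟨W, hW⟩ : ∃ W, W = 0.309 + 0.47 * q := ⟨_, rfl⟩
  have hwW : w ≤ W := by
    have h1 : w * (1.4464 + q - q ^ 2) ≤ W * (1.4464 + q - q ^ 2) := by
      rw [hW]
      nlinarith [mul_pos hq hq, mul_pos (mul_pos hq hq) hq, sq_nonneg (q - 0.05)]
    exact le_of_mul_le_mul_right h1 (by nlinarith)
  have hW0 : 0 < W := hw.trans_le hwW
  -- The coefficients of 1, w and w² in the right side minus the left side; `g` is the w²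
  -- coefficient after the negative cubic and quartic terms have been estimated with w ≤ W.
  obtain ⟨f₀, hf₀⟩ : ∃ f, f = 2 * q - 4 * q ^ 2 + 4 * q ^ 3 - 2 * q ^ 4 := ⟨_, rfl⟩
  obtain ⟨f₁, hf₁⟩ : ∃ f, f = 1 - 4 * q + 7 * q ^ 2 - 6 * q ^ 3 + 2 * q ^ 4 := ⟨_, rfl⟩
  obtain ⟨f₂, hf₂⟩ : ∃ f, f = -3 + 4.8 * q - 4.6 * q ^ 2 + 1.6 * q ^ 3 := ⟨_, rfl⟩
  obtain ⟨g, hg⟩ : ∃ g, g = f₂ - (0.6 - 0.4 * q + 2.2 * q ^ 2) * W - 1.2 * q * W ^ 2 := ⟨_, rfl⟩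
  have hq2 : 0 < q ^ 2 := by positivity
  have hq3 : 0 < q ^ 3 := by positivity
  have hq2' : q ^ 2 ≤ 0.2466 * q := by nlinarith
  have hq3' : q ^ 3 ≤ 0.2466 * q ^ 2 := by nlinarith
  have hq4' : q ^ 4 ≤ 0.2466 * q ^ 3 := by nlinarith
  have hf₀pos : 0 < f₀ := by rw [hf₀]; nlinarith
  have hgneg : g ≤ 0 := by
    have : 0 ≤ (0.6 - 0.4 * q + 2.2 * q ^ 2) * W := mul_nonneg (by nlinarith) hW0.le
    have : 0 ≤ 1.2 * q * W ^ 2 := by positivity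
    rw [hg, hf₂]
    nlinarith
  have hend : 0 < f₀ + W * (f₁ + g * W) := by
    have he : f₀ + W * (f₁ + g * W) = 0.0048548226 + q * (0.7410133799668 - 3.625186066824 * q
        + 4.88454683712 * q ^ 2 - 5.3163685336 * q ^ 3 + 1.006473228 * q ^ 4) := by
      rw [hg, hf₀, hf₁, hf₂, hW]
      ring
    have : 0 < 0.7410133799668 - 3.625186066824 * q + 4.88454683712 * q ^ 2
        - 5.3163685336 * q ^ 3 + 1.006473228 * q ^ 4 := by
      linarith [pow_pos hq 4, show q ^ 2 ≥ 2 * 0.2466 * q - 0.2466 ^ 2 by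
        linarith [sq_nonneg (q - 0.2466), sub_sq q 0.2466]]
    rw [he]
    positivity
  -- An affine function of w that is positive at both ends of [0, W].
  have hlin : 0 < f₀ + w * (f₁ + g * W) := by
    have : 0 < W * (f₀ + w * (f₁ + g * W)) := by
      have h1 : 0 ≤ (W - w) * f₀ := mul_nonneg (by linarith) hf₀pos.le
      have h2 : 0 < w * (f₀ + W * (f₁ + g * W)) := mul_pos hw hend
      nlinarith
    exact (mul_pos_iff_of_pos_left hW0).1 this
  have hquad : 0 < f₀ + w * (f₁ + g * w) := by
    have : w * (g * W) ≤ w * (g * w) :=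
      mul_le_mul_of_nonneg_left (mul_le_mul_of_nonpos_left hwW hgneg) hw.le
    nlinarith
  have hcub : (0.6 - 0.4 * q + 2.2 * q ^ 2) * w ^ 3 ≤ (0.6 - 0.4 * q + 2.2 * q ^ 2) * W * w ^ 2 := by
    have h1 : w ^ 3 ≤ W * w ^ 2 := by nlinarith [sq_nonneg w]
    have := mul_le_mul_of_nonneg_left h1 (a := 0.6 - 0.4 * q + 2.2 * q ^ 2) (by nlinarith)
    linarith
  have hquart : 1.2 * q * w ^ 4 ≤ 1.2 * q * W ^ 2 * w ^ 2 := by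
    have h1 : w ^ 4 ≤ W ^ 2 * w ^ 2 := by
      have : w ^ 2 ≤ W ^ 2 := by gcongr
      nlinarith [sq_nonneg w]
    have := mul_le_mul_of_nonneg_left h1 (a := 1.2 * q) (by positivity)
    linarith
  have r1 : 0 < q ^ 3 * w ^ 3 := by positivity
  have r2 : 0 < q ^ 2 * w ^ 4 := by positivity
  have r3 : 0 < q ^ 2 * w ^ 5 := by positivity
  have hexp : w * g * w = w ^ 2 * f₂ - (0.6 - 0.4 * q + 2.2 * q ^ 2) * W * w ^ 2
      - 1.2 * q * W ^ 2 * w ^ 2 := by rw [hg]; ring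
  have : 0 < f₀ + w * f₁ + w ^ 2 * f₂ - (0.6 - 0.4 * q + 2.2 * q ^ 2) * w ^ 3
      - 1.2 * q * w ^ 4 + 2.4 * (q ^ 3 * w ^ 3) + 1.68 * (q ^ 2 * w ^ 4)
      + 0.72 * (q ^ 2 * w ^ 5) := by linarith
  rw [hf₀, hf₁, hf₂] at this
  linarith

lemma exp_le_quadratic {w : ℝ} (hw : 0 ≤ w) (hw1 : w ≤ 1 / 2) :
    Real.exp w ≤ 1 + w + 0.6 * w ^ 2 := by
  have := Real.exp_bound' hw (by linarith) (n := 4) (by norm_num)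
  simp only [Finset.sum_range_succ, Finset.sum_range_zero, Nat.factorial] at this
  norm_num at this
  have h3 : w ^ 3 ≤ w ^ 2 / 2 := by nlinarith [sq_nonneg w]
  have h4 : w ^ 4 ≤ w ^ 2 / 4 := by nlinarith [sq_nonneg w]
  nlinarith [sq_nonneg w]

lemma exp_neg_three_halves_le : Real.exp (-(3 / 2)) ≤ 0.2232 := by
  have h1 : Real.exp (-(3 / 2)) = Real.exp (-(1 / 2)) ^ 3 := by
    rw [← Real.exp_nat_mul]; congr 1; norm_num
  rw [h1]
  calc Real.exp (-(1 / 2)) ^ 3 ≤ 0.60655 ^ 3 := by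
        gcongr
        exact exp_neg_half_le
    _ ≤ _ := by norm_num

/-- Here q = e^(-t) and E = e^w. Multiplying by 2q(1 - w) allows `hwt` to eliminate t, leaving a
polynomial inequality in q and w once E has been bounded by a quadratic. -/
lemma algebraic_bound {q w E t u : ℝ} (hq0 : 0 < q) (hq1 : q ≤ 0.2466) (hw0 : 0 < w)
    (hw1 : w < 1 / 2) (hE0 : 1 ≤ E) (hE1 : E ≤ 1 + w + 0.6 * w ^ 2)
    (htq : t * q ≤ 0.2232 + q / 2) (hwt : 2 * q * t * (1 - w) = w * (1 - q ^ 2))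
    (hu : u = (1 - q) ^ 2 + q * E) :
    u * (u - 1 + t - w) * (1 + q) < t * (1 + q ^ 2) * (1 - q) := by
  have hpoly := poly_bound hq0 hq1 hw0 (by
    have := mul_le_mul_of_nonneg_left htq (show 0 ≤ 2 * (1 - w) by linarith)
    linarith)
  have hu1 : 1 - q ≤ u := by
    have := mul_le_mul_of_nonneg_left hE0 hq0.le
    rw [hu]
    linarith [sq_nonneg q, sub_sq 1 q]
  have hkey : w * (1 - q) * ((1 + q) * E - 2 * q * (1 - q)) <
      2 * (1 - w) * (u * (w + 1 - u)) := by
    have h1 : w * (1 - q) * ((1 + q) * E - 2 * q * (1 - q)) ≤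
        w * (1 - q) * ((1 + q) * (1 + w + 0.6 * w ^ 2) - 2 * q * (1 - q)) := by
      have : 0 ≤ 1 - q := by linarith
      gcongr
    obtain ⟨v, hv⟩ : ∃ v, v = 1 - q * (1 - q - w - 0.6 * w ^ 2) := ⟨_, rfl⟩
    have huv : u ≤ v := by
      have := mul_le_mul_of_nonneg_left hE1 hq0.le
      rw [hu, hv]
      linarith
    have huv1 : 1 + w ≤ u + v := by linarith
    have h2 : v * (w + 1 - v) ≤ u * (w + 1 - u) := by
      linarith [mul_nonneg (sub_nonneg.2 huv) (sub_nonneg.2 huv1)]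
    have h3 : 2 * (1 - w) * (v * (w + 1 - v)) ≤ 2 * (1 - w) * (u * (w + 1 - u)) :=
      mul_le_mul_of_nonneg_left h2 (by linarith)
    have h4 : w + q * (1 - q - w - 0.6 * w ^ 2) = w + 1 - v := by rw [hv]; ring
    rw [h4, ← hv] at hpoly
    linarith
  have hu0 : 0 < u := by linarith
  have hmain : u * (u - 1 + t - w) * (1 + q) < t * (1 + q ^ 2) * (1 - q) := by
    have h1 : 0 < 2 * (1 - w) := by linarith
    have h2 : (2 * (1 - w) * q) * (u * (u - 1 + t - w) * (1 + q)) <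
        (2 * (1 - w) * q) * (t * (1 + q ^ 2) * (1 - q)) := by
      have h3 := mul_lt_mul_of_pos_left hkey (show 0 < q * (1 + q) by positivity)
      have h4 : (2 * (1 - w) * q) * (t * (1 + q ^ 2) * (1 - q)) -
          (2 * (1 - w) * q) * (u * (u - 1 + t - w) * (1 + q)) =
          q * (1 + q) * (2 * (1 - w) * (u * (w + 1 - u)))
          - 2 * q * t * (1 - w) * (u * (1 + q) - (1 + q ^ 2) * (1 - q)) := by ring
      have h5 : u * (1 + q) - (1 + q ^ 2) * (1 - q) = q * ((1 + q) * E - 2 * q * (1 - q)) := by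
        rw [hu]; ring
      rw [hwt, h5] at h4
      linarith
    have : 0 < 1 - w := by linarith
    exact lt_of_mul_lt_mul_left h2 (by positivity)
  exact hmain

/-- With q = e^(-t) and w = t / (t + sinh t), one has 1 + X = u / (q e^w) with u = (1 - q)² + q e^w.
Thus log(1 + X) = t - w + log u, and the estimate log u ≤ u - 1 is enough. The range starts at 1.41
< √2, so it overlaps with t² ≤ 2. -/
lemma log_bound_of_large {t : ℝ} (ht : 1.41 ≤ t) {X : ℝ}
    (hX : X = 2 * (Real.cosh t - 1) * Real.exp (-(t / (t + Real.sinh t)))) :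
    (1 + X) * Real.log (1 + X) * Real.sinh t < t * Real.cosh t * X := by
  have ht0 : 0 < t := by linarith
  have hs : t < Real.sinh t := Real.self_lt_sinh_iff.2 ht0
  obtain ⟨w, hw⟩ : ∃ w, w = t / (t + Real.sinh t) := ⟨_, rfl⟩
  obtain ⟨q, hq⟩ : ∃ q, q = Real.exp (-t) := ⟨_, rfl⟩
  obtain ⟨E, hE⟩ : ∃ E, E = Real.exp w := ⟨_, rfl⟩
  have hq0 : 0 < q := hq ▸ Real.exp_pos _
  have hw0 : 0 < w := by rw [hw]; exact div_pos ht0 (by linarith)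
  have hw1 : w < 1 / 2 := by rw [hw, div_lt_iff₀ (by linarith)]; linarith
  have hE0 : 1 < E := hE ▸ Real.one_lt_exp_iff.2 hw0
  have hE1 : E ≤ 1 + w + 0.6 * w ^ 2 := hE ▸ exp_le_quadratic hw0.le hw1.le
  -- The tangent line of exp at 0 gives t - 1/2 ≤ e^(t - 3/2); multiplying by q = e^(-t) leaves the
  -- constant e^(-3/2).
  have htq : t * q ≤ 0.2232 + q / 2 := by
    have h1 : t - 1 / 2 ≤ Real.exp (t - 3 / 2) := by linarith [Real.add_one_le_exp (t - 3 / 2)]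
    have h2 : Real.exp (t - 3 / 2) * q = Real.exp (-(3 / 2)) := by
      rw [hq, ← Real.exp_add]; ring_nf
    have := mul_le_mul_of_nonneg_right h1 hq0.le
    rw [h2] at this
    linarith [exp_neg_three_halves_le]
  have hq1 : q ≤ 0.2466 := by
    have h2 : q ≤ Real.exp (-(3 / 2)) * Real.exp 0.09 := by
      rw [hq, ← Real.exp_add]; exact Real.exp_le_exp.2 (by linarith)
    have h3 : Real.exp 0.09 ≤ 1.1 := by
      have := exp_le_quadratic (w := 0.09) (by norm_num) (by norm_num)
      norm_num at this ⊢
      linarith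
    calc q ≤ Real.exp (-(3 / 2)) * Real.exp 0.09 := h2
      _ ≤ 0.2232 * 1.1 := by
        gcongr
        exact exp_neg_three_halves_le
      _ ≤ 0.2466 := by norm_num
  have hsinh : Real.sinh t = (1 - q ^ 2) / (2 * q) := by
    rw [Real.sinh_eq, hq, Real.exp_neg]
    have := Real.exp_pos t
    field_simp
  have hcosh : Real.cosh t = (1 + q ^ 2) / (2 * q) := by
    rw [Real.cosh_eq, hq, Real.exp_neg]
    have := Real.exp_pos t
    field_simp
  have hwt : 2 * q * t * (1 - w) = w * (1 - q ^ 2) := by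
    have h1 : w * (t + Real.sinh t) = t := by rw [hw]; field_simp
    rw [hsinh] at h1
    field_simp at h1
    linarith
  have hX' : X = (1 - q) ^ 2 / (q * E) := by
    rw [hX, hcosh, ← hw, Real.exp_neg, ← hE]
    field_simp
    ring
  obtain ⟨u, hu⟩ : ∃ u, u = (1 - q) ^ 2 + q * E := ⟨_, rfl⟩
  have hu0 : 0 < u := by rw [hu]; positivity
  have hX1 : 1 + X = u / (q * E) := by rw [hX', hu]; field_simp; ring
  have hlog : Real.log (1 + X) ≤ u - 1 + t - w := by
    rw [hX1, Real.log_div hu0.ne' (by positivity), Real.log_mul hq0.ne' (by positivity), hq, hE,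
      Real.log_exp, Real.log_exp]
    linarith [Real.log_le_sub_one_of_pos hu0]
  have hmain := algebraic_bound hq0 hq1 hw0 hw1 hE0.le hE1 htq hwt hu
  have hq1' : 0 < 1 - q := by linarith
  have h1q : 0 < 1 - q ^ 2 := by nlinarith
  rw [hX1] at hlog ⊢
  rw [hX', hsinh, hcosh]
  calc u / (q * E) * Real.log (u / (q * E)) * ((1 - q ^ 2) / (2 * q))
      ≤ u / (q * E) * (u - 1 + t - w) * ((1 - q ^ 2) / (2 * q)) := by gcongr
    _ = (u * (u - 1 + t - w) * (1 + q)) * (1 - q) / (2 * q * (q * E)) := by field_simp; ring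
    _ < (t * (1 + q ^ 2) * (1 - q)) * (1 - q) / (2 * q * (q * E)) := by gcongr
    _ = _ := by field_simp

/-! ### Elimination of the field variable a. -/

lemma mul_sinh_mul_cosh_le {τ z : ℝ} (hτ : 0 < τ) (hz : τ ≤ z) :
    z * (Real.sinh τ * Real.cosh τ) ≤ τ * (Real.sinh z * Real.cosh z) := by
  have := le_of_hasDerivAt_nonneg (f := fun z => τ * Real.sinh (2 * z) - z * Real.sinh (2 * τ))
    (f' := fun z => τ * (Real.cosh (2 * z) * 2) - Real.sinh (2 * τ)) hz
    (fun x _ _ => ((((Real.hasDerivAt_sinh (2 * x)).comp x ((hasDerivAt_id x).const_mul 2)).const_mul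
      τ).sub ((hasDerivAt_id x).mul_const _)).congr_deriv (by simp))
    (fun x hx _ => by
      have h1 : Real.cosh (2 * τ) ≤ Real.cosh (2 * x) := by
        rw [Real.cosh_le_cosh, abs_of_pos (by linarith), abs_of_pos (by linarith)]; linarith
      have h2 := sinh_le_mul_cosh (t := 2 * τ) (by linarith)
      nlinarith)
  simp only [Real.sinh_two_mul] at this
  linarith

/-- Put τ = t/2 and ρ = t / sinh t. The function log cosh z - z tanh z / (1 + ρ) increases on z ≥ τ,
because sinh z cosh z / z does. So a lower bound on a tanh a - τ tanh τ becomes one on log cosh a -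
log cosh τ. -/
lemma cosh_sq_lower_bound {a t : ℝ} (ha : 0 < a) (ht : 0 < t)
    (h : t * Real.cosh t * Real.cosh a ≤ 2 * a * Real.sinh a * Real.sinh t) :
    Real.cosh (t / 2) ^ 2 * Real.exp (t / (t + Real.sinh t)) ≤ Real.cosh a ^ 2 := by
  obtain ⟨τ, rfl⟩ : ∃ τ, t = 2 * τ := ⟨t / 2, by ring⟩
  have hτ : 0 < τ := by linarith
  have hs : 0 < Real.sinh τ := Real.sinh_pos_iff.2 hτ
  have hc : 0 < Real.cosh τ := Real.cosh_pos τ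
  have hsa : 0 < Real.sinh a := Real.sinh_pos_iff.2 ha
  have hca : 0 < Real.cosh a := Real.cosh_pos a
  rw [Real.cosh_two_mul, Real.sinh_two_mul] at h
  have hcs : Real.cosh τ ^ 2 - Real.sinh τ ^ 2 = 1 := Real.cosh_sq_sub_sinh_sq τ
  have haτ : τ < a := by
    by_contra hcon
    push Not at hcon
    have h1 : Real.sinh a * Real.cosh τ ≤ Real.cosh a * Real.sinh τ := by
      have : 0 ≤ Real.sinh (τ - a) := Real.sinh_nonneg_iff.2 (by linarith)
      rw [Real.sinh_sub] at this
      linarith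
    have h2 : a * (Real.sinh a * Real.cosh τ) ≤ τ * (Real.cosh a * Real.sinh τ) := by gcongr
    have h3 : Real.sinh τ * (a * (Real.sinh a * Real.cosh τ)) ≤
      Real.sinh τ * (τ * (Real.cosh a * Real.sinh τ)) := by gcongr
    have h4 : 0 < τ * Real.cosh a := by positivity
    nlinarith
  obtain ⟨ρ, hρ⟩ : ∃ ρ, ρ = τ / (Real.sinh τ * Real.cosh τ) := ⟨_, rfl⟩
  have hρ0 : 0 < ρ := by rw [hρ]; positivity
  have hmono := le_of_hasDerivAt_nonneg
    (f := fun z => Real.log (Real.cosh z) - (1 + ρ)⁻¹ * (z * Real.sinh z / Real.cosh z))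
    (f' := fun z => (ρ * (Real.sinh z * Real.cosh z) - z) / ((1 + ρ) * Real.cosh z ^ 2)) haτ.le
    (fun x h0 _ => by
      have hx := Real.cosh_pos x
      refine (((Real.hasDerivAt_cosh x).log hx.ne').sub ((((hasDerivAt_id x).mul
        (Real.hasDerivAt_sinh x)).div (Real.hasDerivAt_cosh x) hx.ne').const_mul _)).congr_deriv ?_
      have := Real.cosh_sq x
      simp only [id, Pi.mul_apply]
      field_simp
      linear_combination -x * this)
    (fun x hx _ => by
      have := mul_sinh_mul_cosh_le hτ hx.le
      apply div_nonneg _ (by positivity)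
      rw [hρ, div_mul_eq_mul_div, sub_nonneg, le_div_iff₀ (by positivity)]
      exact this)
  -- The hypothesis says a tanh a ≥ τ coth 2τ = τ (tanh τ + coth τ) / 2, and τ (coth τ - tanh τ) =
  -- ρ.
  have hdiff : ρ / 2 ≤ a * Real.sinh a / Real.cosh a - τ * Real.sinh τ / Real.cosh τ := by
    rw [hρ, le_sub_iff_add_le, le_div_iff₀ hca]
    have : (τ / (Real.sinh τ * Real.cosh τ) / 2 + τ * Real.sinh τ / Real.cosh τ) * Real.cosh a =
      τ * Real.cosh a * (1 + 2 * Real.sinh τ ^ 2) / (2 * (Real.sinh τ * Real.cosh τ)) := by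
      field_simp
    rw [this, div_le_iff₀ (by positivity)]
    rw [Real.cosh_sq τ] at h
    linarith
  have hw : 2 * τ / (2 * τ + Real.sinh (2 * τ)) = ρ / (1 + ρ) := by
    rw [Real.sinh_two_mul, hρ]
    field_simp
    ring
  have hlog : 2 * Real.log (Real.cosh τ) + ρ / (1 + ρ) ≤ 2 * Real.log (Real.cosh a) := by
    have h1 := mul_le_mul_of_nonneg_left hdiff (show 0 ≤ (1 + ρ)⁻¹ by positivity)
    have h2 : ρ / (1 + ρ) = 2 * ((1 + ρ)⁻¹ * (ρ / 2)) := by field_simp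
    rw [h2]
    linarith
  have h2 : 2 * τ / 2 = τ := by ring
  rw [hw, h2]
  have e1 : Real.cosh τ ^ 2 = Real.exp (2 * Real.log (Real.cosh τ)) := by
    rw [two_mul, Real.exp_add, Real.exp_log hc]; ring
  have e2 : Real.cosh a ^ 2 = Real.exp (2 * Real.log (Real.cosh a)) := by
    rw [two_mul, Real.exp_add, Real.exp_log hca]; ring
  rw [e1, e2, ← Real.exp_add]
  exact Real.exp_le_exp.2 hlog

/-- If `t coth t ≤ 2 a tanh a`, then `t ↦ log (1 + sinh² t / cosh² a) / t²` is increasing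
at `t`. -/
lemma log_lt_of_mul_cosh_le {a t : ℝ} (ha : 0 < a) (ht : 0 < t)
    (h : t * Real.cosh t * Real.cosh a ≤ 2 * a * Real.sinh a * Real.sinh t) :
    Real.log (1 + Real.sinh t ^ 2 / Real.cosh a ^ 2) <
      t * (Real.sinh t * Real.cosh t) / (Real.cosh a ^ 2 + Real.sinh t ^ 2) := by
  have hs : 0 < Real.sinh t := Real.sinh_pos_iff.2 ht
  have hca : 0 < Real.cosh a := Real.cosh_pos a
  -- With x = sinh² t / cosh² a the claim is (1 + x) log(1 + x) / x < t coth t. The left side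
  -- increases in x by convexity of u log u, so x may be replaced by the upper bound X, which no
  -- longer involves a.
  obtain ⟨X, hX⟩ : ∃ X, X = 2 * (Real.cosh t - 1) * Real.exp (-(t / (t + Real.sinh t))) := ⟨_, rfl⟩
  obtain ⟨x, hx⟩ : ∃ x, x = Real.sinh t ^ 2 / Real.cosh a ^ 2 := ⟨_, rfl⟩
  have hx0 : 0 < x := by rw [hx]; positivity
  have hxX : x ≤ X := by
    have h1 := cosh_sq_lower_bound ha ht h
    have h2 : Real.sinh t ^ 2 = 4 * Real.sinh (t / 2) ^ 2 * Real.cosh (t / 2) ^ 2 := by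
      conv_lhs => rw [show t = 2 * (t / 2) by ring, Real.sinh_two_mul]
      ring
    have h3 : Real.cosh t - 1 = 2 * Real.sinh (t / 2) ^ 2 := by
      conv_lhs => rw [show t = 2 * (t / 2) by ring, Real.cosh_two_mul, Real.cosh_sq]
      ring
    rw [hx, hX, h2, h3, Real.exp_neg, div_le_iff₀ (by positivity)]
    have := Real.exp_pos (t / (t + Real.sinh t))
    calc 4 * Real.sinh (t / 2) ^ 2 * Real.cosh (t / 2) ^ 2
        = 4 * Real.sinh (t / 2) ^ 2 * (Real.exp (t / (t + Real.sinh t)))⁻¹ *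
          (Real.cosh (t / 2) ^ 2 * Real.exp (t / (t + Real.sinh t))) := by field_simp
      _ ≤ 4 * Real.sinh (t / 2) ^ 2 * (Real.exp (t / (t + Real.sinh t)))⁻¹ * Real.cosh a ^ 2 := by
          gcongr
      _ = _ := by ring
  have hXb : (1 + X) * Real.log (1 + X) * Real.sinh t < t * Real.cosh t * X := by
    by_cases h2 : t ^ 2 ≤ 2
    · exact log_bound_of_sq_le_two ht h2 hX
    · exact log_bound_of_large (by nlinarith) hX
  have hX0 : 0 < X := hx0.trans_le hxX
  have hxb : (1 + x) * Real.log (1 + x) * Real.sinh t < t * Real.cosh t * x := by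
    have hconv := Real.convexOn_mul_log.2 (show (1 : ℝ) ∈ Ici 0 by simp)
      (show 1 + X ∈ Ici 0 by simp; linarith) (sub_nonneg.2 ((div_le_one hX0).2 hxX)) 
      (show 0 ≤ x / X by positivity) (by ring)
    simp only [smul_eq_mul, Real.log_one, mul_one, mul_zero, zero_add] at hconv
    have e : 1 - x / X + x / X * (1 + X) = 1 + x := by field_simp; ring
    rw [e] at hconv
    calc (1 + x) * Real.log (1 + x) * Real.sinh t
        ≤ x / X * ((1 + X) * Real.log (1 + X)) * Real.sinh t := by gcongr
      _ = x / X * ((1 + X) * Real.log (1 + X) * Real.sinh t) := by ring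
      _ < x / X * (t * Real.cosh t * X) := by gcongr
      _ = _ := by field_simp
  have e : Real.cosh a ^ 2 + Real.sinh t ^ 2 = Real.sinh t ^ 2 * (1 + x) / x := by
    rw [hx]; field_simp
  rw [← hx, e, lt_div_iff₀ (by positivity)]
  have := mul_lt_mul_of_pos_left hxb (show 0 < Real.sinh t / x by positivity)
  calc Real.log (1 + x) * (Real.sinh t ^ 2 * (1 + x) / x)
      = Real.sinh t / x * ((1 + x) * Real.log (1 + x) * Real.sinh t) := by ring
    _ < Real.sinh t / x * (t * Real.cosh t * x) := this
    _ = _ := by field_simp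

/-! ### The excess function and its derivatives -/

/-- Up to a factor `1 / 2`, the entropic part of `G y - G 0`, in the variables
`A = cosh² (β 𝔥)` and `t = √β y`. -/
def excess (A t : ℝ) : ℝ := Real.log (1 + Real.sinh t ^ 2 / A)

/-- The first derivative of `excess A`. -/
def excess' (A t : ℝ) : ℝ := 2 * (Real.sinh t * Real.cosh t) / (A + Real.sinh t ^ 2)

/-- The second derivative of `excess A`. -/
def excess'' (A t : ℝ) : ℝ := 2 * (A + (2 * A - 1) * Real.sinh t ^ 2) / (A + Real.sinh t ^ 2) ^ 2

lemma hasDerivAt_excess {A : ℝ} (hA : 0 < A) (t : ℝ) :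
    HasDerivAt (excess A) (excess' A t) t := by
  have h1 : 0 < 1 + Real.sinh t ^ 2 / A := by positivity
  refine (((((Real.hasDerivAt_sinh t).pow 2).div_const A).const_add 1).log h1.ne').congr_deriv ?_
  unfold excess'
  simp
  field_simp

lemma hasDerivAt_excess' {A : ℝ} (hA : 0 < A) (t : ℝ) :
    HasDerivAt (excess' A) (excess'' A t) t := by
  have h1 : 0 < A + Real.sinh t ^ 2 := by positivity
  refine ((((Real.hasDerivAt_sinh t).mul (Real.hasDerivAt_cosh t)).const_mul 2).div
    (((Real.hasDerivAt_sinh t).pow 2).const_add A) h1.ne').congr_deriv ?_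
  unfold excess''
  have := Real.cosh_sq t
  simp
  congr 1
  linear_combination (2 * A - 2 * Real.sinh t ^ 2) * this

lemma hasDerivAt_excess'' {A : ℝ} (hA : 0 < A) (t : ℝ) :
    HasDerivAt (excess'' A) (4 * (Real.sinh t * Real.cosh t) *
      (A * (2 * A - 3) - (2 * A - 1) * Real.sinh t ^ 2) / (A + Real.sinh t ^ 2) ^ 3) t := by
  have h1 : 0 < A + Real.sinh t ^ 2 := by positivity
  refine ((((((Real.hasDerivAt_sinh t).pow 2).const_mul (2 * A - 1)).const_add A).const_mul 2).div
    ((((Real.hasDerivAt_sinh t).pow 2).const_add A).pow 2) (pow_pos h1 2).ne').congr_deriv ?_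
  simp
  field_simp
  ring

lemma excess_zero (A : ℝ) : excess A 0 = 0 := by simp [excess]

lemma excess'_zero (A : ℝ) : excess' A 0 = 0 := by simp [excess']

lemma excess''_zero {A : ℝ} (hA : 0 < A) : excess'' A 0 = 2 / A := by
  simp [excess'']; field_simp

lemma excess_neg (A t : ℝ) : excess A (-t) = excess A t := by simp [excess]

lemma continuous_excess {A : ℝ} (hA : 0 < A) : Continuous (excess A) :=
  continuous_iff_continuousAt.2 fun t => (hasDerivAt_excess hA t).continuousAt

/-- `t ^ 2` times the derivative of `excess' A t / t`. -/
def slopeNum (A t : ℝ) : ℝ := t * excess'' A t - excess' A t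

lemma hasDerivAt_slopeNum {A : ℝ} (hA : 0 < A) (t : ℝ) :
    HasDerivAt (slopeNum A) (t * (4 * (Real.sinh t * Real.cosh t) *
      (A * (2 * A - 3) - (2 * A - 1) * Real.sinh t ^ 2) / (A + Real.sinh t ^ 2) ^ 3)) t :=
  (((hasDerivAt_id t).mul (hasDerivAt_excess'' hA t)).sub (hasDerivAt_excess' hA t)).congr_deriv
    (by simp)

lemma slopeNum_zero (A : ℝ) : slopeNum A 0 = 0 := by simp [slopeNum, excess'_zero]

/-- `slopeNum A` vanishes at 0, and its derivative has the sign of A(2A - 3) - (2A - 1) sinh² t,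
which decreases in t. It therefore rises before the zero of this expression and falls after it. -/
lemma slopeNum_pos_of_sinh_sq_le {A t : ℝ} (hA : 1 ≤ A) (ht : 0 < t)
    (h : (2 * A - 1) * Real.sinh t ^ 2 ≤ A * (2 * A - 3)) : 0 < slopeNum A t := by
  rw [← slopeNum_zero A]
  refine lt_of_hasDerivAt_pos ht (fun x _ _ => hasDerivAt_slopeNum (by linarith) x) ?_
  intro x hx hxt
  have h0 := Real.sinh_pos_iff.2 hx
  have h1 := Real.cosh_pos x
  have h2 : Real.sinh x ^ 2 < Real.sinh t ^ 2 := by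
    have := Real.sinh_lt_sinh.2 hxt
    gcongr
  have h3 : 0 < A * (2 * A - 3) - (2 * A - 1) * Real.sinh x ^ 2 := by nlinarith
  positivity

lemma slopeNum_lt_of_lt {A s t : ℝ} (hA : 1 ≤ A) (hs : 0 ≤ s) (hst : s < t)
    (h : A * (2 * A - 3) ≤ (2 * A - 1) * Real.sinh s ^ 2) : slopeNum A t < slopeNum A s := by
  have := lt_of_hasDerivAt_pos hst
    (fun x _ _ => (hasDerivAt_slopeNum (A := A) (by linarith) x).neg) (by
    intro x hx hxt
    have hx0 : 0 < x := hs.trans_lt hx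
    have h0 := Real.sinh_pos_iff.2 hx0
    have h1 := Real.cosh_pos x
    have h2 : Real.sinh s ^ 2 < Real.sinh x ^ 2 := by
      have := Real.sinh_lt_sinh.2 hx
      have := Real.sinh_nonneg_iff.2 hs
      gcongr
    have h3 : 0 < -(A * (2 * A - 3) - (2 * A - 1) * Real.sinh x ^ 2) := by nlinarith
    have h4 : 0 < x * (4 * (Real.sinh x * Real.cosh x) *
      -(A * (2 * A - 3) - (2 * A - 1) * Real.sinh x ^ 2) / (A + Real.sinh x ^ 2) ^ 3) := by
      positivity
    rw [mul_neg, neg_div, mul_neg] at h4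
    exact h4)
  simpa using this

/-- `slopeNum A` changes sign at most once on the positive half-line. -/
lemma slopeNum_pos_of_lt {A s t : ℝ} (hA : 1 ≤ A) (hs : 0 < s) (hst : s < t)
    (h : 0 ≤ slopeNum A t) : 0 < slopeNum A s := by
  rcases le_total ((2 * A - 1) * Real.sinh s ^ 2) (A * (2 * A - 3)) with h1 | h1
  · exact slopeNum_pos_of_sinh_sq_le hA hs h1
  · exact h.trans_lt (slopeNum_lt_of_lt hA hs.le hst h1)

lemma hasDerivAt_excess'_div {A t : ℝ} (hA : 0 < A) (ht : 0 < t) :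
    HasDerivAt (fun t => excess' A t / t) (slopeNum A t / t ^ 2) t := by
  refine ((hasDerivAt_excess' hA t).div (hasDerivAt_id t) ht.ne').congr_deriv ?_
  simp only [id, slopeNum]
  ring

/-! ### The largest ratio of the excess to `t²` -/

/-- The supremum of `excess A t / t ^ 2` over `t > 0`. -/
def maxRatio (A : ℝ) : ℝ := sSup ((fun t => excess A t / t ^ 2) '' Ioi 0)

lemma excess_le_sq {A : ℝ} (hA : 1 ≤ A) (t : ℝ) : excess A t ≤ t ^ 2 := by
  rw [excess, Real.log_le_iff_le_exp (by positivity)]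
  calc 1 + Real.sinh t ^ 2 / A ≤ 1 + Real.sinh t ^ 2 := by
        gcongr
        exact div_le_self (by positivity) hA
    _ = Real.cosh t ^ 2 := by rw [Real.cosh_sq]; ring
    _ ≤ Real.exp (t ^ 2 / 2) ^ 2 := by
        gcongr
        exact Real.cosh_le_exp_half_sq t
    _ = Real.exp (t ^ 2) := by rw [← Real.exp_nat_mul]; congr 1; push_cast; ring

lemma excess_le_two_mul {A t : ℝ} (hA : 1 ≤ A) (ht : 0 ≤ t) : excess A t ≤ 2 * t := by
  rw [excess, Real.log_le_iff_le_exp (by positivity)]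
  calc 1 + Real.sinh t ^ 2 / A ≤ 1 + Real.sinh t ^ 2 := by
        gcongr
        exact div_le_self (by positivity) hA
    _ = Real.cosh t ^ 2 := by rw [Real.cosh_sq]; ring
    _ ≤ Real.exp t ^ 2 := by
        gcongr
        rw [Real.cosh_eq]
        have : Real.exp (-t) ≤ Real.exp t := Real.exp_le_exp.2 (by linarith)
        linarith
    _ = Real.exp (2 * t) := by rw [← Real.exp_nat_mul]; norm_cast

lemma excess_le_sinh_sq_div {A : ℝ} (hA : 0 < A) (t : ℝ) : excess A t ≤ Real.sinh t ^ 2 / A := by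
  have := Real.log_le_sub_one_of_pos (show 0 < 1 + Real.sinh t ^ 2 / A by positivity)
  simpa [excess] using this

lemma sq_div_le_excess {A t : ℝ} (hA : 0 < A) (ht : 0 ≤ t) :
    t ^ 2 / (A + Real.sinh t ^ 2) ≤ excess A t := by
  have h := Real.one_sub_inv_le_log_of_pos (show 0 < 1 + Real.sinh t ^ 2 / A by positivity)
  have h1 : t ≤ Real.sinh t := Real.self_le_sinh_iff.2 ht
  calc t ^ 2 / (A + Real.sinh t ^ 2) ≤ Real.sinh t ^ 2 / (A + Real.sinh t ^ 2) := by gcongr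
    _ = 1 - (1 + Real.sinh t ^ 2 / A)⁻¹ := by field_simp; ring
    _ ≤ _ := h

lemma bddAbove_ratio {A : ℝ} (hA : 1 ≤ A) :
    BddAbove ((fun t => excess A t / t ^ 2) '' Ioi 0) := by
  refine ⟨1, ?_⟩
  rintro _ ⟨t, ht, rfl⟩
  have ht : 0 < t := ht
  simp only
  rw [div_le_one (by positivity)]
  exact excess_le_sq hA t

lemma excess_le_maxRatio {A : ℝ} (hA : 1 ≤ A) (t : ℝ) : excess A t ≤ maxRatio A * t ^ 2 := by
  have key : ∀ t, 0 < t → excess A t ≤ maxRatio A * t ^ 2 := by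
    intro t ht
    rw [← div_le_iff₀ (by positivity)]
    exact le_csSup (bddAbove_ratio hA) ⟨t, ht, rfl⟩
  rcases lt_trichotomy t 0 with h | rfl | h
  · rw [← excess_neg, ← neg_sq]; exact key _ (by linarith)
  · simp [excess_zero]
  · exact key t h

lemma maxRatio_le {A m : ℝ} (h : ∀ t, 0 < t → excess A t ≤ m * t ^ 2) : maxRatio A ≤ m := by
  apply csSup_le ⟨_, mem_image_of_mem _ (show (1 : ℝ) ∈ Ioi 0 by simp)⟩
  rintro _ ⟨t, ht, rfl⟩
  have ht : 0 < t := ht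
  simp only
  rw [div_le_iff₀ (by positivity)]
  exact h t ht

lemma maxRatio_le_one {A : ℝ} (hA : 1 ≤ A) : maxRatio A ≤ 1 :=
  maxRatio_le fun t _ => by rw [one_mul]; exact excess_le_sq hA t

/-- The value 1/A is the limit of the ratio as t → 0. -/
lemma one_div_le_maxRatio {A : ℝ} (hA : 1 ≤ A) : 1 / A ≤ maxRatio A := by
  have h1 : Tendsto (fun t : ℝ => 1 / (A + Real.sinh t ^ 2)) (𝓝[>] 0) (𝓝 (1 / A)) := by
    have : Continuous fun t : ℝ => 1 / (A + Real.sinh t ^ 2) := by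
      apply Continuous.div (by fun_prop) (by fun_prop)
      intro t; positivity
    have := (this.tendsto 0).mono_left (nhdsWithin_le_nhds (s := Ioi 0))
    simpa using this
  refine le_of_tendsto h1 ?_
  filter_upwards [self_mem_nhdsWithin] with t ht
  have ht : 0 < t := ht
  have h2 := (sq_div_le_excess (by linarith) ht.le).trans (excess_le_maxRatio hA t)
  have : 0 < t ^ 2 := by positivity
  rw [div_eq_mul_one_div, mul_comm] at h2
  exact le_of_mul_le_mul_right h2 this

/-- Comparison of `excess A t` with `t ^ 2 / A` from the sign of `slopeNum`. -/
lemma excess_lt_sq_div {A t : ℝ} (hA : 1 ≤ A) (hA2 : A ≤ 3 / 2) (ht : 0 < t) :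
    excess A t < t ^ 2 / A := by
  have hA0 : 0 < A := by linarith
  -- Clearing denominators, this is A(2A - 3) < sinh² x, automatic for A ≤ 3/2. Two integrations
  -- from 0 follow.
  have h2 : ∀ x, 0 < x → excess'' A x < 2 / A := by
    intro x hx
    rw [excess'', div_lt_div_iff₀ (by positivity) hA0]
    have := Real.sinh_pos_iff.2 hx
    have : 0 < Real.sinh x ^ 2 := by positivity
    nlinarith [mul_pos this this, mul_nonneg (mul_nonneg hA0.le
      (show 0 ≤ 3 - 2 * A by linarith)) this.le]
  have h1 : ∀ x, 0 < x → excess' A x < 2 / A * x := by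
    intro x hx
    have := lt_of_hasDerivAt_pos hx (f := fun x => 2 / A * x - excess' A x)
      (fun y _ _ => ((hasDerivAt_id y).const_mul (2 / A)).sub (hasDerivAt_excess' hA0 y))
      (fun y hy _ => by have := h2 y hy; simpa using this)
    simpa [excess'_zero] using this
  have := lt_of_hasDerivAt_pos ht (f := fun x => x ^ 2 / A - excess A x)
      (fun y _ _ => ((hasDerivAt_pow 2 y).div_const A).sub (hasDerivAt_excess hA0 y))
      (fun y hy _ => by
        have := h1 y hy
        have e : (2 : ℕ) * y ^ (2 - 1) / A = 2 / A * y := by norm_num; ring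
        rw [e]; linarith)
  simpa [excess_zero] using this

lemma maxRatio_of_le {A : ℝ} (hA : 1 ≤ A) (hA2 : A ≤ 3 / 2) : maxRatio A = 1 / A :=
  le_antisymm (maxRatio_le fun t ht => by
    have := excess_lt_sq_div hA hA2 ht
    rw [one_div, inv_mul_eq_div]; exact this.le) (one_div_le_maxRatio hA)

/-- For A > 3/2 the second derivative exceeds its value 2/A at 0 as long as sinh² t < A(2A - 3), so
the excess lies above its quadratic approximation near 0. -/
lemma exists_sq_div_lt_excess {A : ℝ} (hA : 3 / 2 < A) : ∃ t, 0 < t ∧ t ^ 2 / A < excess A t := by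
  have hA0 : 0 < A := by linarith
  have hev : ∀ᶠ t in 𝓝[>] (0 : ℝ), Real.sinh t ^ 2 < (2 * A - 3) * A := by
    have : Tendsto (fun t : ℝ => Real.sinh t ^ 2) (𝓝[>] 0) (𝓝 0) := by
      have h : Continuous fun t : ℝ => Real.sinh t ^ 2 := by fun_prop
      have := (h.tendsto 0).mono_left (nhdsWithin_le_nhds (s := Ioi 0))
      simpa using this
    exact this.eventually_lt_const (mul_pos (by linarith) hA0)
  obtain ⟨T, hT, hT0⟩ := (hev.and self_mem_nhdsWithin).exists
  have hT0 : 0 < T := hT0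
  have h2 : ∀ x, 0 < x → x < T → 2 / A < excess'' A x := by
    intro x hx hxT
    rw [excess'', div_lt_div_iff₀ hA0 (by positivity)]
    have h0 := Real.sinh_pos_iff.2 hx
    have h1 : Real.sinh x ^ 2 < Real.sinh T ^ 2 := by
      have := Real.sinh_lt_sinh.2 hxT
      gcongr
    have : 0 < Real.sinh x ^ 2 := by positivity
    nlinarith [mul_pos this this]
  have h1 : ∀ x, 0 < x → x < T → 2 / A * x < excess' A x := by
    intro x hx hxT
    have := lt_of_hasDerivAt_pos hx (f := fun x => excess' A x - 2 / A * x)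
      (fun y _ _ => (hasDerivAt_excess' hA0 y).sub ((hasDerivAt_id y).const_mul (2 / A)))
      (fun y hy hyx => by have := h2 y hy (hyx.trans hxT); simpa using this)
    simpa [excess'_zero] using this
  have := lt_of_hasDerivAt_pos hT0 (f := fun x => excess A x - x ^ 2 / A)
      (fun y _ _ => (hasDerivAt_excess hA0 y).sub ((hasDerivAt_pow 2 y).div_const A))
      (fun y hy hyT => by
        have := h1 y hy hyT
        have e : (2 : ℕ) * y ^ (2 - 1) / A = 2 / A * y := by norm_num; ring
        rw [e]; linarith)
  exact ⟨T, hT0, by simpa [excess_zero] using this⟩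

lemma one_div_lt_maxRatio {A : ℝ} (hA : 3 / 2 < A) : 1 / A < maxRatio A := by
  obtain ⟨t, ht, h⟩ := exists_sq_div_lt_excess hA
  have h2 := h.trans_le (excess_le_maxRatio (by linarith) t)
  have : 0 < t ^ 2 := by positivity
  rw [div_eq_mul_one_div, mul_comm] at h2
  exact lt_of_mul_lt_mul_right h2 this.le

/-- The ratio is at most cosh² t / A near 0 and at most 2/t at infinity. Both fall below a level m
strictly between 1/A and the supremum, so compactness applies to the remaining interval. -/
lemma exists_excess_eq_maxRatio {A : ℝ} (hA : 3 / 2 < A) :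
    ∃ t, 0 < t ∧ excess A t = maxRatio A * t ^ 2 := by
  have hA0 : 0 < A := by linarith
  obtain ⟨m, hm1, hm2⟩ := exists_between (one_div_lt_maxRatio hA)
  have hm0 : 0 < m := lt_trans (by positivity) hm1
  have hev : ∀ᶠ t in 𝓝[>] (0 : ℝ), Real.cosh t ^ 2 < m * A := by
    have : Tendsto (fun t : ℝ => Real.cosh t ^ 2) (𝓝[>] 0) (𝓝 1) := by
      have h : Continuous fun t : ℝ => Real.cosh t ^ 2 := by fun_prop
      have := (h.tendsto 0).mono_left (nhdsWithin_le_nhds (s := Ioi 0))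
      simpa using this
    exact this.eventually_lt_const (by rwa [div_lt_iff₀ hA0] at hm1)
  obtain ⟨ε, hε, hε0⟩ := (hev.and self_mem_nhdsWithin).exists
  have hε0 : 0 < ε := hε0
  have hsmall : ∀ t, 0 < t → t ≤ ε → excess A t / t ^ 2 < m := by
    intro t ht htε
    rw [div_lt_iff₀ (by positivity)]
    have h1 : Real.cosh t ≤ Real.cosh ε := by
      rw [Real.cosh_le_cosh, abs_of_pos ht, abs_of_pos hε0]; exact htε
    calc excess A t ≤ Real.sinh t ^ 2 / A := excess_le_sinh_sq_div hA0 t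
      _ ≤ (t * Real.cosh t) ^ 2 / A := by
        have := Real.sinh_nonneg_iff.2 ht.le
        gcongr
        exact sinh_le_mul_cosh ht.le
      _ ≤ (t * Real.cosh ε) ^ 2 / A := by
        have := Real.cosh_pos t
        gcongr
      _ < m * t ^ 2 := by
        rw [div_lt_iff₀ hA0, mul_pow]
        have : 0 < t ^ 2 := by positivity
        nlinarith
  have hlarge : ∀ t, 2 / m < t → excess A t / t ^ 2 < m := by
    intro t ht
    have ht0 : 0 < t := lt_trans (by positivity) ht
    rw [div_lt_iff₀ (by positivity)]
    rw [div_lt_iff₀ hm0] at ht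
    have := excess_le_two_mul (A := A) (by linarith) ht0.le
    nlinarith
  obtain ⟨t₁, ht₁, h₁⟩ : ∃ t, 0 < t ∧ m < excess A t / t ^ 2 := by
    obtain ⟨_, ⟨t, ht, rfl⟩, h⟩ := exists_lt_of_lt_csSup
      (⟨_, mem_image_of_mem _ (show (1 : ℝ) ∈ Ioi 0 by simp)⟩) hm2
    exact ⟨t, ht, h⟩
  have hmem : t₁ ∈ Icc ε (2 / m) := by
    constructor
    · by_contra h; push Not at h; exact (hsmall t₁ ht₁ h.le).not_gt h₁
    · by_contra h; push Not at h; exact (hlarge t₁ h).not_gt h₁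
  obtain ⟨t, ht, hmax⟩ := isCompact_Icc.exists_isMaxOn ⟨t₁, hmem⟩
    (f := fun t => excess A t / t ^ 2) (by
      apply ContinuousOn.div (continuous_excess hA0).continuousOn (by fun_prop)
      intro x hx
      have : 0 < x := hε0.trans_le hx.1
      positivity)
  have ht0 : 0 < t := hε0.trans_le ht.1
  refine ⟨t, ht0, le_antisymm (excess_le_maxRatio (by linarith) t) ?_⟩
  rw [← le_div_iff₀ (by positivity)]
  apply maxRatio_le
  intro s hs
  rw [← div_le_iff₀ (by positivity)]
  have hmt : m < excess A t / t ^ 2 := h₁.trans_le (hmax hmem)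
  by_cases h1 : s ≤ ε
  · exact (hsmall s hs h1).le.trans hmt.le
  by_cases h2 : 2 / m < s
  · exact (hlarge s h2).le.trans hmt.le
  push Not at h1 h2
  exact hmax ⟨h1.le, h2⟩

lemma excess_lt_of_lt {A B t : ℝ} (hA : 0 < A) (hAB : A < B) (ht : 0 < t) :
    excess B t < excess A t := by
  have := Real.sinh_pos_iff.2 ht
  apply Real.log_lt_log (by have : 0 < B := hA.trans hAB; positivity)
  gcongr

/-- Concavity of log between 1 and 1 + sinh² t / A. This reverse comparison makes `maxRatio`
Lipschitz. -/
lemma mul_excess_le {A B : ℝ} (hA : 0 < A) (hAB : A ≤ B) (t : ℝ) :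
    A / B * excess A t ≤ excess B t := by
  have hB : 0 < B := hA.trans_le hAB
  have := strictConcaveOn_log_Ioi.concaveOn.2 (show (1 : ℝ) ∈ Ioi 0 by simp)
    (show 1 + Real.sinh t ^ 2 / A ∈ Ioi 0 by simp; positivity)
    (sub_nonneg.2 ((div_le_one hB).2 hAB)) (show 0 ≤ A / B by positivity) (by ring)
  simp only [smul_eq_mul, Real.log_one, mul_zero, zero_add, mul_one] at this
  have e : 1 - A / B + A / B * (1 + Real.sinh t ^ 2 / A) = 1 + Real.sinh t ^ 2 / B := by
    field_simp; ring
  rw [e] at this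
  exact this

/-- A pointwise strict inequality need not survive a supremum; it does here because the supremum for
B is either attained or equal to 1/B. -/
lemma maxRatio_lt {A B : ℝ} (hA : 1 ≤ A) (hAB : A < B) : maxRatio B < maxRatio A := by
  rcases le_or_gt B (3 / 2) with h | h
  · rw [maxRatio_of_le (hA.trans hAB.le) h]
    refine lt_of_lt_of_le ?_ (one_div_le_maxRatio hA)
    exact one_div_lt_one_div_of_lt (by linarith) hAB
  · obtain ⟨t, ht, e⟩ := exists_excess_eq_maxRatio h
    have h1 := (excess_lt_of_lt (by linarith) hAB ht).trans_le (excess_le_maxRatio hA t)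
    rw [e] at h1
    exact lt_of_mul_lt_mul_right h1 (by positivity)

lemma maxRatio_sub_le {A B : ℝ} (hA : 1 ≤ A) (hAB : A ≤ B) :
    maxRatio A - maxRatio B ≤ B - A := by
  have hB : 0 < B := by linarith
  have h1 : A / B * maxRatio A ≤ maxRatio B := by
    rw [← le_div_iff₀' (by positivity)]
    apply maxRatio_le
    intro t ht
    have := (mul_excess_le (by linarith) hAB t).trans (excess_le_maxRatio (hA.trans hAB) t)
    rw [div_mul_eq_mul_div, le_div_iff₀ (by positivity)]
    linarith
  have h2 := maxRatio_le_one hA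
  have h3 : (1 - A / B) * maxRatio A ≤ (1 - A / B) * 1 := by
    have : 0 ≤ 1 - A / B := sub_nonneg.2 ((div_le_one hB).2 hAB)
    gcongr
  have h4 : 1 - A / B ≤ B - A := by
    rw [show 1 - A / B = (B - A) / B by field_simp]
    exact div_le_self (by linarith) (by linarith)
  linarith

lemma continuousOn_maxRatio : ContinuousOn maxRatio (Ici 1) := by
  have : LipschitzOnWith 1 maxRatio (Ici 1) := by
    refine LipschitzOnWith.of_dist_le_mul fun x hx y hy => ?_
    simp only [NNReal.coe_one, one_mul, Real.dist_eq]
    rcases lt_trichotomy x y with h | rfl | h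
    · rw [abs_of_nonneg (sub_nonneg.2 (maxRatio_lt hx h).le), abs_of_neg (by linarith)]
      linarith [maxRatio_sub_le hx h.le]
    · simp
    · rw [abs_of_nonpos (sub_nonpos.2 (maxRatio_lt hy h).le), abs_of_pos (by linarith)]
      linarith [maxRatio_sub_le hy h.le]
  exact this.continuousOn

/-! ### The critical field as a function of `a = β 𝔥` -/

/-- The field strength `𝔥` for which the inverse temperature `a / 𝔥` is critical. -/
def criticalField (a : ℝ) : ℝ := a * maxRatio (Real.cosh a ^ 2)

lemma one_le_cosh_sq (a : ℝ) : 1 ≤ Real.cosh a ^ 2 := one_le_pow₀ (Real.one_le_cosh a)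

lemma cosh_sq_lt_cosh_sq {a b : ℝ} (ha : 0 ≤ a) (hab : a < b) :
    Real.cosh a ^ 2 < Real.cosh b ^ 2 := by
  have : Real.cosh a < Real.cosh b := by
    rw [Real.cosh_lt_cosh, abs_of_nonneg ha, abs_of_pos (ha.trans_lt hab)]; exact hab
  have := Real.cosh_pos a
  gcongr

lemma continuous_maxRatio_cosh_sq : Continuous fun a => maxRatio (Real.cosh a ^ 2) :=
  continuousOn_maxRatio.comp_continuous (by fun_prop) one_le_cosh_sq

lemma continuous_criticalField : Continuous criticalField :=
  continuous_id.mul continuous_maxRatio_cosh_sq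

lemma eventually_lt_of_hasDerivAt_pos {f : ℝ → ℝ} {f' c : ℝ} (hf : HasDerivAt f f' c)
    (h : 0 < f') : ∀ᶠ x in 𝓝[>] c, f c < f x := by
  have h1 := (hasDerivAt_iff_tendsto_slope.1 hf).mono_left
    (nhdsWithin_mono c (fun x (hx : c < x) => hx.ne'))
  filter_upwards [h1.eventually_const_lt h, self_mem_nhdsWithin] with x hx hcx
  have hcx : c < x := hcx
  rw [slope_def_field, lt_div_iff₀ (by linarith)] at hx
  linarith

lemma mul_sinh_lt_of_cosh_sq_le {c : ℝ} (hc : 0 ≤ c) (h : Real.cosh c ^ 2 ≤ 3 / 2) :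
    2 * c * Real.sinh c < Real.cosh c := by
  have h1 := sinh_le_mul_cosh hc
  have h2 : c ≤ Real.sinh c := Real.self_le_sinh_iff.2 hc
  have h3 := Real.cosh_sq c
  have h4 : c ^ 2 < 1 / 2 := by
    have hc4 : 1 + c ^ 2 / 2 ≤ Real.cosh c := by
      have e : Real.cosh c = 1 + 2 * Real.sinh (c / 2) ^ 2 := by
        conv_lhs => rw [show c = 2 * (c / 2) by ring, Real.cosh_two_mul, Real.cosh_sq]
        ring
      have : c / 2 ≤ Real.sinh (c / 2) := Real.self_le_sinh_iff.2 (by linarith)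
      rw [e]
      nlinarith
    nlinarith [sq_nonneg c]
  have h5 : c * Real.sinh c ≤ c * (c * Real.cosh c) := by gcongr
  nlinarith [Real.cosh_pos c]

/-- Envelope argument: `criticalField` is bounded below by a differentiable function that agrees
with it at c and has positive derivative there. This avoids differentiating `maxRatio`, but yields
increase only to the right of c. -/
lemma eventually_criticalField_lt {c : ℝ} (hc : 0 ≤ c) :
    ∀ᶠ x in 𝓝[>] c, criticalField c < criticalField x := by
  have hC := Real.cosh_pos c
  rcases le_or_gt (Real.cosh c ^ 2) (3 / 2) with h | h
  · have hd : HasDerivAt (fun z => z / Real.cosh z ^ 2)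
        ((Real.cosh c - 2 * c * Real.sinh c) / Real.cosh c ^ 3) c := by
      refine ((hasDerivAt_id c).div ((Real.hasDerivAt_cosh c).pow 2) (pow_pos hC 2).ne').congr_deriv ?_
      simp
      field_simp
    have := eventually_lt_of_hasDerivAt_pos hd
      (div_pos (sub_pos.2 (mul_sinh_lt_of_cosh_sq_le hc h)) (by positivity))
    filter_upwards [this, self_mem_nhdsWithin] with x hx hcx
    have hx0 : 0 < x := hc.trans_lt hcx
    have e : criticalField c = c / Real.cosh c ^ 2 := by
      rw [criticalField, maxRatio_of_le (one_le_cosh_sq c) h, mul_one_div]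
    rw [e]
    refine hx.trans_le ?_
    rw [criticalField, div_eq_mul_one_div]
    gcongr
    exact one_div_le_maxRatio (one_le_cosh_sq x)
  · have hc0 : 0 < c := by
      rcases hc.eq_or_lt with rfl | h0
      · norm_num at h
      · exact h0
    obtain ⟨t, ht, e⟩ := exists_excess_eq_maxRatio h
    have hs := Real.sinh_pos_iff.2 ht
    have hsc := Real.sinh_pos_iff.2 hc0
    -- the critical point equation
    have hcrit : 2 * excess (Real.cosh c ^ 2) t = t * excess' (Real.cosh c ^ 2) t := by
      have hmax : IsLocalMax (fun s => excess (Real.cosh c ^ 2) s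
          - maxRatio (Real.cosh c ^ 2) * s ^ 2) t := by
        refine Eventually.of_forall fun s => ?_
        simp only [e, sub_self]
        exact sub_nonpos.2 (excess_le_maxRatio (one_le_cosh_sq c) s)
      have hd := hmax.hasDerivAt_eq_zero ((hasDerivAt_excess (by positivity) t).sub
        ((hasDerivAt_pow 2 t).const_mul _))
      rw [e]
      norm_num at hd
      linear_combination (-t) * hd
    -- Otherwise `log_lt_of_mul_cosh_le` would contradict the critical point equation.
    have hineq : 2 * c * Real.sinh c * Real.sinh t < t * Real.cosh t * Real.cosh c := by
      by_contra hcon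
      push Not at hcon
      have := log_lt_of_mul_cosh_le hc0 ht hcon
      rw [excess'] at hcrit
      rw [excess] at hcrit
      have e2 : t * (2 * (Real.sinh t * Real.cosh t) / (Real.cosh c ^ 2 + Real.sinh t ^ 2)) =
        2 * (t * (Real.sinh t * Real.cosh t) / (Real.cosh c ^ 2 + Real.sinh t ^ 2)) := by ring
      linarith
    -- For the fixed maximizer t, this function lies below t² · `criticalField z`, with equality at
    -- z = c.
    have hd : HasDerivAt (fun z => z * excess (Real.cosh z ^ 2) t)
        (excess (Real.cosh c ^ 2) t - 2 * c * Real.sinh c * Real.sinh t ^ 2 /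
          (Real.cosh c * (Real.cosh c ^ 2 + Real.sinh t ^ 2))) c := by
      have h1 : 0 < 1 + Real.sinh t ^ 2 / Real.cosh c ^ 2 := by positivity
      refine ((hasDerivAt_id c).mul ((((hasDerivAt_const c (Real.sinh t ^ 2)).div
        ((Real.hasDerivAt_cosh c).pow 2) (pow_pos hC 2).ne').const_add 1).log h1.ne')).congr_deriv ?_
      simp [excess]
      field_simp
      ring
    have hpos : 0 < excess (Real.cosh c ^ 2) t - 2 * c * Real.sinh c * Real.sinh t ^ 2 /
          (Real.cosh c * (Real.cosh c ^ 2 + Real.sinh t ^ 2)) := by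
      have e3 : excess (Real.cosh c ^ 2) t = t * (Real.sinh t * Real.cosh t) * Real.cosh c /
          (Real.cosh c * (Real.cosh c ^ 2 + Real.sinh t ^ 2)) := by
        rw [excess'] at hcrit
        field_simp at hcrit ⊢
        linarith
      rw [e3, ← sub_div]
      apply div_pos _ (by positivity)
      nlinarith
    filter_upwards [eventually_lt_of_hasDerivAt_pos hd hpos, self_mem_nhdsWithin] with x hx hcx
    have hx0 : 0 < x := hc.trans_lt hcx
    have ht2 : 0 < t ^ 2 := by positivity
    have h1 := mul_le_mul_of_nonneg_left (excess_le_maxRatio (one_le_cosh_sq x) t) hx0.le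
    rw [e] at hx
    refine lt_of_mul_lt_mul_right (a := t ^ 2) ?_ ht2.le
    rw [criticalField, criticalField, mul_assoc, mul_assoc]
    exact hx.trans_le h1

/-- A continuous function that increases strictly to the right of every point of [a, b) can attain
its maximum over [a, b] only at b. -/
lemma strictMonoOn_criticalField : StrictMonoOn criticalField (Ici 0) := by
  intro a ha b hb hab
  obtain ⟨c, hc, hmax⟩ := isCompact_Icc.exists_isMaxOn (nonempty_Icc.2 hab.le)
    continuous_criticalField.continuousOn
  have ha : 0 ≤ a := ha
  have key : ∀ c ∈ Ico a b, ∃ x ∈ Icc a b, criticalField c < criticalField x := by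
    intro c hc
    have hev : ∀ᶠ x in 𝓝[>] c, x ∈ Ioo c b := Ioo_mem_nhdsGT hc.2
    obtain ⟨x, hx1, hx2⟩ := ((eventually_criticalField_lt (ha.trans hc.1)).and hev).exists
    exact ⟨x, ⟨hc.1.trans hx2.1.le, hx2.2.le⟩, hx1⟩
  obtain ⟨x, hx, hax⟩ := key a ⟨le_rfl, hab⟩
  have hcb : c = b := by
    by_contra hne
    obtain ⟨z, hz, hcz⟩ := key c ⟨hc.1, lt_of_le_of_ne hc.2 hne⟩
    exact (hmax hz).not_gt hcz
  exact hax.trans_le (hcb ▸ hmax hx)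

/-- The test point t = 2a maximizes the zero temperature profile 2a(t - a) / t², whose maximum is
1/2. -/
lemma log_two_div_le_criticalField {a : ℝ} (ha : 1 ≤ a) :
    1 / 2 - Real.log 2 / (4 * a) ≤ criticalField a := by
  have ha0 : 0 < a := by linarith
  have h1 := excess_le_maxRatio (one_le_cosh_sq a) (2 * a)
  have h2 : 2 * a - Real.log 2 ≤ excess (Real.cosh a ^ 2) (2 * a) := by
    rw [excess, Real.le_log_iff_exp_le (by positivity), Real.exp_sub, Real.exp_log (by norm_num)]
    have e : 1 + Real.sinh (2 * a) ^ 2 / Real.cosh a ^ 2 =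
        Real.exp (2 * a) + Real.exp (-(2 * a)) - 1 := by
      have := Real.cosh_pos a
      rw [Real.sinh_two_mul]
      have h3 : (2 * Real.sinh a * Real.cosh a) ^ 2 / Real.cosh a ^ 2 = 4 * Real.sinh a ^ 2 := by
        field_simp; norm_num
      have h4 : Real.exp (2 * a) + Real.exp (-(2 * a)) = 2 * Real.cosh (2 * a) := by
        rw [Real.cosh_eq]; ring
      rw [h3, h4, Real.cosh_two_mul, Real.cosh_sq]
      ring
    rw [e]
    have := Real.add_one_le_exp (2 * a)
    have := Real.exp_pos (-(2 * a))
    linarith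
  have h3 : 2 * a - Real.log 2 ≤ criticalField a * (4 * a) := by
    rw [criticalField]; linarith
  rw [← div_le_iff₀ (by positivity)] at h3
  refine le_trans (le_of_eq ?_) h3
  field_simp
  ring

/-- For t ≥ a/2 the bound cosh x ≤ e^|x| gives the zero temperature profile up to 2 log 2, and (t -
2a)² ≥ 0 produces the 1/2. For t < a/2 the growth of cosh makes the ratio O(1/a²). -/
lemma criticalField_le {a : ℝ} (ha : 0 < a) : criticalField a ≤ 1 / 2 + 8 / a := by
  have hC := Real.cosh_pos a
  rw [criticalField, ← le_div_iff₀' ha]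
  apply maxRatio_le
  intro t ht
  rw [div_mul_eq_mul_div, le_div_iff₀ ha]
  rcases le_or_gt (a / 2) t with h | h
  · -- the zero temperature bound
    have hV : excess (Real.cosh a ^ 2) t ≤ (t + a) + |t - a| - 2 * a + 2 * Real.log 2 := by
      rw [excess, Real.log_le_iff_le_exp (by positivity)]
      have e1 : 1 + Real.sinh t ^ 2 / Real.cosh a ^ 2 =
          Real.cosh (t + a) * Real.cosh (t - a) / Real.cosh a ^ 2 := by
        rw [Real.cosh_add, Real.cosh_sub]
        field_simp
        have := Real.cosh_sq t
        have := Real.cosh_sq a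
        nlinarith
      have e2 : ∀ x : ℝ, Real.cosh x ≤ Real.exp |x| := by
        intro x
        rw [Real.cosh_eq]
        have := Real.exp_le_exp.2 (le_abs_self x)
        have := Real.exp_le_exp.2 (neg_le_abs x)
        linarith
      have e3 : Real.exp a / 2 ≤ Real.cosh a := by
        rw [Real.cosh_eq]; have := Real.exp_pos (-a); linarith
      rw [e1, div_le_iff₀ (by positivity)]
      calc Real.cosh (t + a) * Real.cosh (t - a) ≤ Real.exp |t + a| * Real.exp |t - a| := by
            have := Real.cosh_pos (t - a)
            gcongr <;> exact e2 _
        _ = Real.exp ((t + a) + |t - a| - 2 * a + 2 * Real.log 2) * (Real.exp a / 2) ^ 2 := by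
          rw [abs_of_pos (show 0 < t + a by linarith), Real.exp_add (_ - _),
            show 2 * Real.log 2 = Real.log 2 + Real.log 2 by ring, Real.exp_add (Real.log 2),
            Real.exp_log (by norm_num), Real.exp_sub, Real.exp_add,
            show 2 * a = a + a by ring, Real.exp_add a a]
          have := Real.exp_pos a
          field_simp
          rw [← Real.exp_add, ← Real.exp_add]
        _ ≤ _ := by gcongr
    have hlog : Real.log 2 < 0.7 := by linarith [Real.log_two_lt_d9]
    have h1 : excess (Real.cosh a ^ 2) t * a ≤
      ((t + a) + |t - a| - 2 * a + 2 * Real.log 2) * a := by gcongr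
    have h2 : 4 * t ^ 2 ≥ a ^ 2 := by nlinarith
    have h3 : 2 * a ≤ 8 / a * t ^ 2 := by
      rw [div_mul_eq_mul_div, le_div_iff₀ ha]; nlinarith
    rcases abs_cases (t - a) with ⟨he, _⟩ | ⟨he, _⟩
    · rw [he] at h1
      nlinarith [sq_nonneg (t - 2 * a)]
    · rw [he] at h1
      nlinarith
  · have h1 : excess (Real.cosh a ^ 2) t ≤ t ^ 2 / Real.cosh (a / 2) ^ 2 := by
      have hc1 : Real.cosh t ≤ Real.cosh (a / 2) := by
        rw [Real.cosh_le_cosh, abs_of_pos ht, abs_of_pos (by linarith)]; exact h.le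
      have hc2 : Real.cosh (a / 2) ^ 2 ≤ Real.cosh a := by
        have e : Real.cosh a = Real.cosh (a / 2) ^ 2 + Real.sinh (a / 2) ^ 2 := by
          conv_lhs => rw [show a = 2 * (a / 2) by ring, Real.cosh_two_mul]
        rw [e]
        linarith [sq_nonneg (Real.sinh (a / 2))]
      have hc3 := Real.cosh_pos (a / 2)
      have hs0 := Real.sinh_nonneg_iff.2 ht.le
      calc excess (Real.cosh a ^ 2) t ≤ Real.sinh t ^ 2 / Real.cosh a ^ 2 :=
            excess_le_sinh_sq_div (by positivity) t
        _ ≤ (t * Real.cosh (a / 2)) ^ 2 / (Real.cosh (a / 2) ^ 2) ^ 2 := by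
          gcongr
          exact (sinh_le_mul_cosh ht.le).trans (by gcongr)
        _ = _ := by field_simp
    have h2 : a ^ 2 / 4 ≤ Real.cosh (a / 2) ^ 2 := by
      have : a / 2 ≤ Real.sinh (a / 2) := Real.self_le_sinh_iff.2 (by linarith)
      rw [Real.cosh_sq]
      nlinarith
    have h3 : t ^ 2 / Real.cosh (a / 2) ^ 2 ≤ t ^ 2 / (a ^ 2 / 4) := by gcongr
    have h4 : excess (Real.cosh a ^ 2) t * a ≤ t ^ 2 / (a ^ 2 / 4) * a := by
      gcongr
      exact h1.trans h3
    have h5 : t ^ 2 / (a ^ 2 / 4) * a = 4 / a * t ^ 2 := by field_simp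
    have h6 : 4 / a * t ^ 2 ≤ (1 / 2 + 8 / a) * t ^ 2 := by
      have h8 : 4 / a ≤ 8 / a := by gcongr; norm_num
      gcongr
      linarith
    linarith

/-- A strictly increasing function whose upper bound tends to 1/2 never reaches 1/2. This is why no
transition occurs for 𝔥 ≥ 1/2. -/
lemma criticalField_lt_half {a : ℝ} (ha : 0 ≤ a) : criticalField a < 1 / 2 := by
  by_contra hcon
  push Not at hcon
  have h1 : 1 / 2 < criticalField (a + 1) := hcon.trans_lt
    (strictMonoOn_criticalField ha (show 0 ≤ a + 1 by linarith) (by linarith))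
  have h2 : Tendsto (fun b : ℝ => 1 / 2 + 8 / b) atTop (𝓝 (1 / 2 + 0)) :=
    (tendsto_const_nhds.div_atTop tendsto_id).const_add _
  rw [add_zero] at h2
  obtain ⟨b, hb, hab⟩ := ((h2.eventually_lt_const h1).and (eventually_gt_atTop (a + 1))).exists
  have h3 := strictMonoOn_criticalField (show 0 ≤ a + 1 by linarith)
    (show 0 ≤ b by linarith) hab
  linarith [criticalField_le (a := b) (by linarith)]

lemma exists_lt_criticalField {x : ℝ} (hx : x < 1 / 2) : ∃ a, 0 < a ∧ x < criticalField a := by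
  have h2 : Tendsto (fun b : ℝ => 1 / 2 - Real.log 2 / (4 * b)) atTop (𝓝 (1 / 2 - 0)) :=
    (tendsto_const_nhds.div_atTop (tendsto_id.const_mul_atTop (by norm_num))).const_sub _
  rw [sub_zero] at h2
  obtain ⟨b, hb, hb1⟩ := ((h2.eventually_const_lt hx).and (eventually_ge_atTop 1)).exists
  exact ⟨b, by linarith, hb.trans_le (log_two_div_le_criticalField hb1)⟩

/-! ### The global maximum points of `G` -/

lemma integral_dichotomousLaw (f : ℝ → ℝ) (𝔥 : ℝ) :
    ∫ t, f t ∂(dichotomousLaw 𝔥) = (f 𝔥 + f (-𝔥)) / 2 := by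
  have hi : ∀ c, Integrable f ((2⁻¹ : ℝ≥0∞) • Measure.dirac c) := fun c =>
    (integrable_dirac (by simp)).smul_measure (by simp)
  rw [dichotomousLaw, integral_add_measure (hi _) (hi _), integral_smul_measure,
    integral_smul_measure, integral_dirac, integral_dirac]
  simp
  ring

lemma G_eq (β 𝔥 y : ℝ) : G β 𝔥 y = -(y ^ 2 / 2) +
    (Real.log (Real.cosh (√β * y + β * 𝔥)) + Real.log (Real.cosh (√β * y - β * 𝔥))) / 2 := by
  rw [G, integral_dichotomousLaw]
  simp [sub_eq_add_neg]

lemma cosh_add_mul_cosh_sub (u a : ℝ) :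
    Real.cosh (u + a) * Real.cosh (u - a) = Real.cosh a ^ 2 + Real.sinh u ^ 2 := by
  rw [Real.cosh_add, Real.cosh_sub]
  have := Real.cosh_sq u
  have := Real.cosh_sq a
  nlinarith

lemma G_eq_excess (β 𝔥 y : ℝ) : G β 𝔥 y = Real.log (Real.cosh (β * 𝔥)) +
    (excess (Real.cosh (β * 𝔥) ^ 2) (√β * y) - y ^ 2) / 2 := by
  have h1 := Real.cosh_pos (√β * y + β * 𝔥)
  have h2 := Real.cosh_pos (√β * y - β * 𝔥)
  have h3 := Real.cosh_pos (β * 𝔥)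
  rw [G_eq, ← Real.log_mul h1.ne' h2.ne', cosh_add_mul_cosh_sub, excess]
  have e : Real.cosh (β * 𝔥) ^ 2 + Real.sinh (√β * y) ^ 2 =
    Real.cosh (β * 𝔥) ^ 2 * (1 + Real.sinh (√β * y) ^ 2 / Real.cosh (β * 𝔥) ^ 2) := by
    field_simp
  rw [e, Real.log_mul (by positivity) (by positivity), Real.log_pow]
  push_cast
  ring

lemma G_neg (β 𝔥 y : ℝ) : G β 𝔥 (-y) = G β 𝔥 y := by
  rw [G_eq_excess, G_eq_excess, mul_neg, excess_neg, neg_sq]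

lemma hasDerivAt_G (β 𝔥 y : ℝ) : HasDerivAt (G β 𝔥)
    ((√β * excess' (Real.cosh (β * 𝔥) ^ 2) (√β * y) - 2 * y) / 2) y := by
  have h3 := Real.cosh_pos (β * 𝔥)
  have : G β 𝔥 = fun y => Real.log (Real.cosh (β * 𝔥)) +
    (excess (Real.cosh (β * 𝔥) ^ 2) (√β * y) - y ^ 2) / 2 := funext (G_eq_excess β 𝔥)
  rw [this]
  have hA : 0 < Real.cosh (β * 𝔥) ^ 2 := by positivity
  exact (((((hasDerivAt_excess hA (√β * y)).comp y ((hasDerivAt_id y).const_mul (√β))).sub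
    (hasDerivAt_pow 2 y)).div_const 2).const_add _).congr_deriv (by simp; ring)

lemma continuous_G (β 𝔥 : ℝ) : Continuous (G β 𝔥) :=
  continuous_iff_continuousAt.2 fun y => (hasDerivAt_G β 𝔥 y).continuousAt

lemma deriv_deriv_G {β : ℝ} (hβ : 0 ≤ β) (𝔥 y : ℝ) : deriv (deriv (G β 𝔥)) y =
    (β * excess'' (Real.cosh (β * 𝔥) ^ 2) (√β * y) - 2) / 2 := by
  have h3 := Real.cosh_pos (β * 𝔥)
  have hA : 0 < Real.cosh (β * 𝔥) ^ 2 := by positivity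
  have : deriv (G β 𝔥) = fun y =>
    (√β * excess' (Real.cosh (β * 𝔥) ^ 2) (√β * y) - 2 * y) / 2 :=
    funext fun y => (hasDerivAt_G β 𝔥 y).deriv
  rw [this]
  refine HasDerivAt.deriv ?_
  refine ((((((hasDerivAt_excess' hA (√β * y)).comp y ((hasDerivAt_id y).const_mul (√β))).const_mul
    (√β)).sub ((hasDerivAt_id y).const_mul 2)).div_const 2)).congr_deriv ?_
  have := Real.mul_self_sqrt hβ
  simp only [mul_one]
  linear_combination (excess'' (Real.cosh (β * 𝔥) ^ 2) (√β * y) / 2) * this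

lemma mem_maximizers_iff {β 𝔥 y : ℝ} : y ∈ maximizers β 𝔥 ↔
    ∀ z, excess (Real.cosh (β * 𝔥) ^ 2) (√β * z) - z ^ 2 ≤
      excess (Real.cosh (β * 𝔥) ^ 2) (√β * y) - y ^ 2 := by
  rw [maximizers, mem_ofPred_eq]
  refine forall_congr' fun z => ?_
  rw [G_eq_excess, G_eq_excess]
  constructor <;> intro h <;> linarith

lemma neg_mem_maximizers {β 𝔥 y : ℝ} (hy : y ∈ maximizers β 𝔥) : -y ∈ maximizers β 𝔥 := by
  intro z; rw [G_neg]; exact hy z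

lemma sq_sqrt_mul {β : ℝ} (hβ : 0 ≤ β) (y : ℝ) : (√β * y) ^ 2 = β * y ^ 2 := by
  rw [mul_pow, Real.sq_sqrt hβ]

lemma excess_sqrt_le {β : ℝ} (hβ : 0 < β) (𝔥 z : ℝ) :
    excess (Real.cosh (β * 𝔥) ^ 2) (√β * z) ≤ β * maxRatio (Real.cosh (β * 𝔥) ^ 2) * z ^ 2 := by
  have := excess_le_maxRatio (one_le_cosh_sq (β * 𝔥)) (√β * z)
  rw [sq_sqrt_mul hβ.le] at this
  linarith

lemma zero_mem_maximizers_iff {β 𝔥 : ℝ} (hβ : 0 < β) :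
    0 ∈ maximizers β 𝔥 ↔ β * maxRatio (Real.cosh (β * 𝔥) ^ 2) ≤ 1 := by
  rw [mem_maximizers_iff]
  simp only [mul_zero, excess_zero, ne_eq, OfNat.ofNat_ne_zero, not_false_eq_true, zero_pow,
    sub_zero, tsub_le_iff_right, zero_add]
  constructor
  · intro h
    rw [← le_div_iff₀' hβ]
    refine maxRatio_le fun t ht => ?_
    have hs : 0 < √β := Real.sqrt_pos.2 hβ
    have h1 := h (t / √β)
    rw [mul_div_cancel₀ _ hs.ne', div_pow, Real.sq_sqrt hβ.le] at h1
    rw [div_mul_eq_mul_div, one_mul]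
    exact h1
  · intro h z
    refine (excess_sqrt_le hβ 𝔥 z).trans ?_
    nlinarith [sq_nonneg z]

lemma exists_mem_maximizers {β : ℝ} (hβ : 0 < β) (𝔥 : ℝ) : ∃ y, y ∈ maximizers β 𝔥 := by
  have hs : 0 < √β := Real.sqrt_pos.2 hβ
  obtain ⟨y, -, hy⟩ := (isCompact_Icc (a := -(2 * √β)) (b := 2 * √β)).exists_isMaxOn
    (nonempty_Icc.2 (by linarith)) (continuous_G β 𝔥).continuousOn
  have key : ∀ z, 0 ≤ z → G β 𝔥 z ≤ G β 𝔥 y := by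
    intro z hz
    by_cases h : z ≤ 2 * √β
    · exact hy (show z ∈ Icc _ _ from ⟨by linarith, h⟩)
    · push Not at h
      refine le_trans ?_ (hy (show 0 ∈ Icc _ _ from ⟨by linarith, by linarith⟩))
      rw [G_eq_excess, G_eq_excess, mul_zero, excess_zero]
      have := excess_le_two_mul (one_le_cosh_sq (β * 𝔥)) (show 0 ≤ √β * z by positivity)
      nlinarith
  refine ⟨y, fun z => ?_⟩
  rcases le_total 0 z with h | h
  · exact key z h
  · rw [← G_neg]; exact key _ (by linarith)

lemma excess'_eq_of_mem_maximizers {β 𝔥 y : ℝ} (hy : y ∈ maximizers β 𝔥) :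
    √β * excess' (Real.cosh (β * 𝔥) ^ 2) (√β * y) = 2 * y := by
  have hmax : IsLocalMax (G β 𝔥) y := Eventually.of_forall hy
  have := hmax.hasDerivAt_eq_zero (hasDerivAt_G β 𝔥 y)
  linarith

/-- Otherwise `excess' A s` / s would increase up to t = √β y, where it equals 2/β by criticality.
Integration would give `excess A t` < t² / β = y², that is, G(y) < G(0). -/
lemma slopeNum_neg_of_mem_maximizers {β 𝔥 y : ℝ} (hβ : 0 < β) (hy0 : 0 < y)
    (hy : y ∈ maximizers β 𝔥) : slopeNum (Real.cosh (β * 𝔥) ^ 2) (√β * y) < 0 := by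
  have hs : 0 < √β := Real.sqrt_pos.2 hβ
  have hA := one_le_cosh_sq (β * 𝔥)
  have hA0 : 0 < Real.cosh (β * 𝔥) ^ 2 := by linarith
  have hcrit := excess'_eq_of_mem_maximizers hy
  rw [mem_maximizers_iff] at hy
  have hy1 := hy 0
  have hsq := sq_sqrt_mul hβ.le y
  have hss := Real.mul_self_sqrt hβ.le
  generalize Real.cosh (β * 𝔥) ^ 2 = A at *
  by_contra hcon
  push Not at hcon
  obtain ⟨t, ht⟩ : ∃ t, t = √β * y := ⟨_, rfl⟩
  rw [← ht] at hcon hcrit hy1 hsq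
  have ht0 : 0 < t := by rw [ht]; positivity
  have hratio : excess' A t / t = 2 / β := by
    rw [div_eq_div_iff ht0.ne' hβ.ne']
    linear_combination √β * hcrit - excess' A t * hss - 2 * ht
  have hlt : ∀ s, 0 < s → s < t → excess' A s < 2 / β * s := by
    intro s hs0 hst
    have := lt_of_hasDerivAt_pos hst
      (fun x hx _ => hasDerivAt_excess'_div hA0 (hs0.trans_le hx))
      (fun x hx hxt => by
        have hx0 := hs0.trans hx
        have := slopeNum_pos_of_lt hA hx0 hxt hcon
        positivity)
    rw [hratio, div_lt_iff₀ hs0] at this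
    exact this
  have := lt_of_hasDerivAt_pos ht0 (f := fun x => x ^ 2 / β - excess A x)
    (fun x _ _ => ((hasDerivAt_pow 2 x).div_const β).sub (hasDerivAt_excess hA0 x))
    (fun x hx hxt => by
      have := hlt x hx hxt
      have e : (2 : ℕ) * x ^ (2 - 1) / β = 2 / β * x := by norm_num; ring
      rw [e]; linarith)
  simp only [excess_zero, hsq] at this
  rw [mul_div_cancel_left₀ _ hβ.ne'] at this
  simp only [mul_zero, excess_zero] at hy1
  norm_num at this hy1
  linarith

/-- At every positive maximum point `excess' A t` / t equals 2/β, yet this quotient decreases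
strictly beyond the first one. -/
lemma eq_of_mem_maximizers {β 𝔥 y z : ℝ} (hβ : 0 < β) (hy0 : 0 < y) (hz0 : 0 < z)
    (hy : y ∈ maximizers β 𝔥) (hz : z ∈ maximizers β 𝔥) : y = z := by
  wlog hyz : y < z generalizing y z
  · rcases (not_lt.1 hyz).eq_or_lt with h | h
    · exact h.symm
    · exact (this hz0 hy0 hz hy h).symm
  exfalso
  have hs : 0 < √β := Real.sqrt_pos.2 hβ
  have hA := one_le_cosh_sq (β * 𝔥)
  have hA0 : 0 < Real.cosh (β * 𝔥) ^ 2 := by linarith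
  have hneg := slopeNum_neg_of_mem_maximizers hβ hy0 hy
  have h1 := excess'_eq_of_mem_maximizers hy
  have h2 := excess'_eq_of_mem_maximizers hz
  have hlt := lt_of_hasDerivAt_pos (mul_lt_mul_of_pos_left hyz hs)
    (fun x hx _ => (hasDerivAt_excess'_div hA0 ((mul_pos hs hy0).trans_le hx)).neg)
    (fun x hx _ => by
      have hx0 := (mul_pos hs hy0).trans hx
      have : slopeNum (Real.cosh (β * 𝔥) ^ 2) x < 0 := by
        by_contra hcon
        push Not at hcon
        exact (slopeNum_pos_of_lt hA (mul_pos hs hy0) hx hcon).not_gt hneg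
      rw [← neg_div]
      have : 0 < -slopeNum (Real.cosh (β * 𝔥) ^ 2) x := by linarith
      positivity)
  have e : ∀ v, 0 < v → √β * excess' (Real.cosh (β * 𝔥) ^ 2) (√β * v) = 2 * v →
      excess' (Real.cosh (β * 𝔥) ^ 2) (√β * v) / (√β * v) = 2 / β := by
    intro v hv hv2
    rw [div_eq_div_iff (by positivity) hβ.ne']
    have := Real.mul_self_sqrt hβ.le
    linear_combination √β * hv2 - excess' (Real.cosh (β * 𝔥) ^ 2) (√β * v) * this
  simp only [Pi.neg_apply] at hlt
  rw [e y hy0 h1, e z hz0 h2] at hlt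
  exact lt_irrefl _ hlt

/-- Once G'(y) = 0 is used, negativity of `slopeNum` is exactly G''(y) < 0. -/
lemma isNondegenerateMax_of_pos {β 𝔥 y : ℝ} (hβ : 0 < β) (hy0 : 0 < y)
    (hy : y ∈ maximizers β 𝔥) : IsNondegenerateMax β 𝔥 y := by
  have hs : 0 < √β := Real.sqrt_pos.2 hβ
  refine ⟨hy, IsLocalMax.deriv_eq_zero (Eventually.of_forall hy), ?_⟩
  rw [deriv_deriv_G hβ.le]
  have h1 := excess'_eq_of_mem_maximizers hy
  have h2 := slopeNum_neg_of_mem_maximizers hβ hy0 hy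
  rw [slopeNum] at h2
  have h3 : β * excess'' (Real.cosh (β * 𝔥) ^ 2) (√β * y) < 2 := by
    have := mul_lt_mul_of_pos_left h2 hs
    have h4 := Real.mul_self_sqrt hβ.le
    have h5 : y * (β * excess'' (Real.cosh (β * 𝔥) ^ 2) (√β * y)) < y * 2 := by
      have e : y * (β * excess'' (Real.cosh (β * 𝔥) ^ 2) (√β * y)) =
          √β * (√β * y * excess'' (Real.cosh (β * 𝔥) ^ 2) (√β * y)) := by
        linear_combination (-(y * excess'' (Real.cosh (β * 𝔥) ^ 2) (√β * y))) * h4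
      linarith
    exact lt_of_mul_lt_mul_left h5 hy0.le
  linarith

lemma excess''_neg (A t : ℝ) : excess'' A (-t) = excess'' A t := by simp [excess'']

lemma IsNondegenerateMax.neg {β 𝔥 y : ℝ} (hβ : 0 < β) (h : IsNondegenerateMax β 𝔥 y) :
    IsNondegenerateMax β 𝔥 (-y) := by
  have hm := neg_mem_maximizers h.1
  refine ⟨hm, IsLocalMax.deriv_eq_zero (Eventually.of_forall hm), ?_⟩
  have := h.2.2
  rw [deriv_deriv_G hβ.le] at this ⊢
  rwa [mul_neg, excess''_neg]

lemma isNondegenerateMax_zero {β 𝔥 : ℝ} (hβ : 0 < β) (h0 : 0 ∈ maximizers β 𝔥)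
    (h : β < Real.cosh (β * 𝔥) ^ 2) : IsNondegenerateMax β 𝔥 0 := by
  refine ⟨h0, IsLocalMax.deriv_eq_zero (Eventually.of_forall h0), ?_⟩
  have hA0 : 0 < Real.cosh (β * 𝔥) ^ 2 := hβ.trans h
  rw [deriv_deriv_G hβ.le, mul_zero, excess''_zero hA0]
  have : β * (2 / Real.cosh (β * 𝔥) ^ 2) < 2 := by
    rw [mul_div_assoc', div_lt_iff₀ hA0]; linarith
  linarith

lemma lt_cosh_sq_of_mul_maxRatio_eq {β 𝔥 : ℝ} (hβ : 0 < β)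
    (h : β * maxRatio (Real.cosh (β * 𝔥) ^ 2) = 1) (h2 : 3 / 2 < Real.cosh (β * 𝔥) ^ 2) :
    β < Real.cosh (β * 𝔥) ^ 2 := by
  have h3 := mul_lt_mul_of_pos_left (one_div_lt_maxRatio h2) hβ
  rw [h, mul_one_div, div_lt_one (by linarith)] at h3
  exact h3

lemma isNondegenerateMax_zero_of_mul_maxRatio_lt {β 𝔥 : ℝ} (hβ : 0 < β)
    (h : β * maxRatio (Real.cosh (β * 𝔥) ^ 2) < 1) : IsNondegenerateMax β 𝔥 0 := by
  refine isNondegenerateMax_zero hβ ((zero_mem_maximizers_iff hβ).2 h.le) ?_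
  have hA := one_le_cosh_sq (β * 𝔥)
  have h3 := (mul_le_mul_of_nonneg_left (one_div_le_maxRatio hA) hβ.le).trans_lt h
  rwa [mul_one_div, div_lt_one (by linarith)] at h3

lemma maximizers_eq_singleton_of_forall {β 𝔥 : ℝ}
    (h : ∀ z, 0 < z → excess (Real.cosh (β * 𝔥) ^ 2) (√β * z) < z ^ 2) :
    maximizers β 𝔥 = {0} := by
  have h' : ∀ z, z ≠ 0 → excess (Real.cosh (β * 𝔥) ^ 2) (√β * z) < z ^ 2 := by
    intro z hz
    rcases lt_or_gt_of_ne hz with hz | hz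
    · have := h (-z) (by linarith)
      rwa [mul_neg, excess_neg, neg_sq] at this
    · exact h z hz
  ext y
  rw [mem_singleton_iff, mem_maximizers_iff]
  constructor
  · intro hy
    by_contra hne
    have h1 := hy 0
    have h2 := h' y hne
    simp only [mul_zero, excess_zero] at h1
    norm_num at h1
    linarith
  · rintro rfl z
    simp only [mul_zero, excess_zero]
    by_cases hz : z = 0
    · simp [hz, excess_zero]
    · have := h' z hz
      norm_num
      linarith

lemma maximizers_of_lt {β 𝔥 : ℝ} (hβ : 0 < β)
    (h : β * maxRatio (Real.cosh (β * 𝔥) ^ 2) < 1) : maximizers β 𝔥 = {0} := by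
  refine maximizers_eq_singleton_of_forall fun z hz => ?_
  have := excess_sqrt_le hβ 𝔥 z
  have : 0 < z ^ 2 := by positivity
  nlinarith

lemma maximizers_of_eq_of_le {β 𝔥 : ℝ} (hβ : 0 < β)
    (h : β * maxRatio (Real.cosh (β * 𝔥) ^ 2) = 1) (h2 : Real.cosh (β * 𝔥) ^ 2 ≤ 3 / 2) :
    maximizers β 𝔥 = {0} := by
  refine maximizers_eq_singleton_of_forall fun z hz => ?_
  have hA := one_le_cosh_sq (β * 𝔥)
  generalize Real.cosh (β * 𝔥) ^ 2 = A at *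
  rw [maxRatio_of_le hA h2, mul_one_div, div_eq_one_iff_eq (by linarith)] at h
  subst h
  have h3 := excess_lt_sq_div hA h2 (mul_pos (Real.sqrt_pos.2 hβ) hz)
  rwa [sq_sqrt_mul hβ.le, mul_div_right_comm, div_self hβ.ne', one_mul] at h3

lemma maximizers_of_gt {β 𝔥 : ℝ} (hβ : 0 < β)
    (h : 1 < β * maxRatio (Real.cosh (β * 𝔥) ^ 2)) :
    ∃ y, 0 < y ∧ maximizers β 𝔥 = {-y, y} := by
  have h0 : 0 ∉ maximizers β 𝔥 := by rw [zero_mem_maximizers_iff hβ]; exact not_le.2 h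
  obtain ⟨y, hy⟩ := exists_mem_maximizers hβ 𝔥
  wlog hpos : 0 < y generalizing y
  · refine this (-y) (neg_mem_maximizers hy) ?_
    rcases (not_lt.1 hpos).eq_or_lt with h | h
    · exact absurd (h ▸ hy) h0
    · linarith
  refine ⟨y, hpos, ?_⟩
  ext z
  simp only [mem_insert_iff, mem_singleton_iff]
  constructor
  · intro hz
    rcases lt_trichotomy z 0 with hz0 | rfl | hz0
    · left
      have := eq_of_mem_maximizers hβ hpos (by linarith) hy (neg_mem_maximizers hz)
      linarith
    · exact absurd hz h0
    · right; exact (eq_of_mem_maximizers hβ hpos hz0 hy hz).symm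
  · rintro (rfl | rfl)
    · exact neg_mem_maximizers hy
    · exact hy

lemma maximizers_of_eq_of_gt {β 𝔥 : ℝ} (hβ : 0 < β)
    (h : β * maxRatio (Real.cosh (β * 𝔥) ^ 2) = 1) (h2 : 3 / 2 < Real.cosh (β * 𝔥) ^ 2) :
    ∃ y, 0 < y ∧ maximizers β 𝔥 = {-y, 0, y} := by
  have hs : 0 < √β := Real.sqrt_pos.2 hβ
  have h0 : 0 ∈ maximizers β 𝔥 := by rw [zero_mem_maximizers_iff hβ]; exact h.le
  obtain ⟨t, ht, e⟩ := exists_excess_eq_maxRatio h2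
  have hpos : 0 < t / √β := by positivity
  have hy : t / √β ∈ maximizers β 𝔥 := by
    rw [mem_maximizers_iff] at h0 ⊢
    intro z
    refine (h0 z).trans (le_of_eq ?_)
    rw [mul_zero, excess_zero, mul_div_cancel₀ _ hs.ne', e, div_pow, Real.sq_sqrt hβ.le]
    have : maxRatio (Real.cosh (β * 𝔥) ^ 2) = 1 / β := by field_simp; linarith
    rw [this]
    ring
  refine ⟨t / √β, hpos, ?_⟩
  generalize t / √β = y at *
  ext z
  simp only [mem_insert_iff, mem_singleton_iff]
  constructor
  · intro hz
    rcases lt_trichotomy z 0 with hz0 | rfl | hz0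
    · left
      have := eq_of_mem_maximizers hβ hpos (by linarith) hy (neg_mem_maximizers hz)
      linarith
    · simp
    · right; right; exact (eq_of_mem_maximizers hβ hpos hz0 hy hz).symm
  · rintro (rfl | rfl | rfl)
    · exact neg_mem_maximizers hy
    · exact h0
    · exact hy

/-! ### The critical line -/

/-- The critical inverse temperature of the field strength `𝔥`, characterized by `maxRatio`. -/
lemma criticalBeta_spec {𝔥 : ℝ} (h0 : 0 ≤ 𝔥) (h1 : 𝔥 < 1 / 2) :
    0 < criticalBeta 𝔥 ∧
    criticalBeta 𝔥 * maxRatio (Real.cosh (criticalBeta 𝔥 * 𝔥) ^ 2) = 1 ∧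
    (∀ β, 0 < β → β < criticalBeta 𝔥 → β * maxRatio (Real.cosh (β * 𝔥) ^ 2) < 1) ∧
    (∀ β, criticalBeta 𝔥 < β → 1 < β * maxRatio (Real.cosh (β * 𝔥) ^ 2)) := by
  suffices h : ∃ b, 0 < b ∧ b * maxRatio (Real.cosh (b * 𝔥) ^ 2) = 1 ∧
      (∀ β, 0 < β → β < b → β * maxRatio (Real.cosh (β * 𝔥) ^ 2) < 1) ∧
      (∀ β, b < β → 1 < β * maxRatio (Real.cosh (β * 𝔥) ^ 2)) by
    obtain ⟨b, hb0, hb1, hb2, hb3⟩ := h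
    have hset : {β : ℝ | 0 < β ∧ 0 ∉ maximizers β 𝔥} = Ioi b := by
      ext β
      simp only [mem_ofPred_eq, mem_Ioi]
      constructor
      · rintro ⟨h1, h2⟩
        rw [zero_mem_maximizers_iff h1, not_le] at h2
        by_contra hcon
        rcases (not_lt.1 hcon).eq_or_lt with rfl | hlt
        · linarith
        · linarith [hb2 β h1 hlt]
      · intro h
        refine ⟨hb0.trans h, ?_⟩
        rw [zero_mem_maximizers_iff (hb0.trans h), not_le]
        exact hb3 β h
    have : criticalBeta 𝔥 = b := by rw [criticalBeta, hset, csInf_Ioi]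
    rw [this]
    exact ⟨hb0, hb1, hb2, hb3⟩
  rcases h0.eq_or_lt with rfl | h0
  · have : maxRatio (Real.cosh 0 ^ 2) = 1 := by
      rw [Real.cosh_zero, one_pow, maxRatio_of_le le_rfl (by norm_num)]; norm_num
    refine ⟨1, one_pos, ?_, ?_, ?_⟩
    · simp only [mul_zero, this, mul_one]
    · intro β _ h; simpa only [mul_zero, this, mul_one]
    · intro β h; simpa only [mul_zero, this, mul_one]
  -- For 𝔥 > 0 the condition compares `criticalField (β * 𝔥)` with 𝔥, so the critical β is a / 𝔥
  -- with `criticalField a` = 𝔥.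
  · obtain ⟨K, hK, hK1⟩ := exists_lt_criticalField h1
    obtain ⟨a, ha, hae⟩ := intermediate_value_Icc hK.le continuous_criticalField.continuousOn
      (show 𝔥 ∈ Icc (criticalField 0) (criticalField K) from
        ⟨by rw [criticalField, zero_mul]; exact h0.le, hK1.le⟩)
    have ha0 : 0 < a := by
      rcases ha.1.eq_or_lt with rfl | h
      · rw [criticalField, zero_mul] at hae; exact absurd hae h0.ne
      · exact h
    have key : ∀ β, β * maxRatio (Real.cosh (β * 𝔥) ^ 2) = criticalField (β * 𝔥) / 𝔥 := by
      intro β; rw [criticalField]; field_simp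
    refine ⟨a / 𝔥, by positivity, ?_, ?_, ?_⟩
    · rw [key, div_mul_cancel₀ _ h0.ne', hae, div_self h0.ne']
    · intro β hβ h
      rw [key, div_lt_one h0, ← hae]
      rw [lt_div_iff₀ h0, hae.symm] at h
      rw [hae] at h ⊢
      nth_rewrite 2 [← hae]
      exact strictMonoOn_criticalField (show 0 ≤ β * 𝔥 by positivity) ha0.le h
    · intro β h
      have hβ : 0 < β := lt_trans (by positivity) h
      rw [key, one_lt_div h0]
      rw [div_lt_iff₀ h0] at h
      nth_rewrite 1 [← hae]
      exact strictMonoOn_criticalField ha0.le (show 0 ≤ β * 𝔥 by positivity) h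

/-- At fixed β the quantity β · `maxRatio (cosh² (β𝔥))` decreases strictly in 𝔥, so it cannot be at
most 1 at the smaller field and equal to 1 at the larger one. -/
lemma strictMonoOn_criticalBeta : StrictMonoOn criticalBeta (Ico 0 (1 / 2)) := by
  intro h hh h' hh' hlt
  obtain ⟨b0, b1, b2, b3⟩ := criticalBeta_spec hh.1 hh.2
  obtain ⟨c0, c1, c2, c3⟩ := criticalBeta_spec hh'.1 hh'.2
  by_contra hcon
  push Not at hcon
  have h1 : criticalBeta h' * maxRatio (Real.cosh (criticalBeta h' * h) ^ 2) ≤ 1 := by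
    rcases hcon.eq_or_lt with e | e
    · rw [e]; exact b1.le
    · exact (b2 _ c0 e).le
  have h2 := maxRatio_lt (one_le_cosh_sq _) (cosh_sq_lt_cosh_sq (mul_nonneg c0.le hh.1)
    (mul_lt_mul_of_pos_left hlt c0))
  nlinarith

lemma criticalBeta_zero : criticalBeta 0 = 1 := by
  have := (criticalBeta_spec le_rfl (by norm_num)).2.1
  rwa [mul_zero, Real.cosh_zero, one_pow, maxRatio_of_le le_rfl (by norm_num), div_one,
    mul_one] at this

/-- For every K, `criticalField (K / 2)` < 1/2 says that K is subcritical at field 1/2; by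
continuity it remains so for fields near 1/2. -/
lemma tendsto_criticalBeta : Tendsto criticalBeta (𝓝[<] (1 / 2)) atTop := by
  rw [tendsto_atTop]
  intro K
  wlog hK : 0 < K generalizing K
  · filter_upwards [this 1 one_pos] with x hx
    linarith [not_lt.1 hK]
  have hcont : Continuous fun x => K * maxRatio (Real.cosh (K * x) ^ 2) :=
    continuous_const.mul (continuous_maxRatio_cosh_sq.comp (continuous_const.mul continuous_id))
  have hlt : K * maxRatio (Real.cosh (K * (1 / 2)) ^ 2) < 1 := by
    have := criticalField_lt_half (show 0 ≤ K * (1 / 2) by positivity)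
    rw [criticalField] at this
    linarith
  have hev := (hcont.continuousAt.eventually_lt_const hlt).filter_mono
    (nhdsWithin_le_nhds (s := Iio (1 / 2)))
  have hpos : ∀ᶠ x : ℝ in 𝓝[<] (1 / 2), x ∈ Ioo 0 (1 / 2) := Ioo_mem_nhdsLT (by norm_num)
  filter_upwards [hev, hpos] with x hx hx0
  obtain ⟨b0, b1, b2, b3⟩ := criticalBeta_spec hx0.1.le hx0.2
  by_contra hcon
  push Not at hcon
  linarith [b3 K hcon]

lemma mul_maxRatio_lt_one_of_half_le {β 𝔥 : ℝ} (hβ : 0 < β) (h : 1 / 2 ≤ 𝔥) :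
    β * maxRatio (Real.cosh (β * 𝔥) ^ 2) < 1 := by
  have := criticalField_lt_half (show 0 ≤ β * 𝔥 by positivity)
  rw [criticalField] at this
  have : 𝔥 * (β * maxRatio (Real.cosh (β * 𝔥) ^ 2)) < 𝔥 * 1 := by linarith
  exact lt_of_mul_lt_mul_left this (by linarith)

lemma two_thirds_arcosh_lt_half : 2 / 3 * Real.arcosh √(3 / 2) < 1 / 2 := by
  have : Real.arcosh √(3 / 2) < 3 / 4 := by
    rw [← Real.arcosh_cosh (show (0 : ℝ) ≤ 3 / 4 by norm_num),
      Real.arcosh_lt_arcosh (Real.sqrt_pos.2 (by norm_num)) (Real.cosh_pos _)]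
    have h1 : (1 : ℝ) + (3 / 4) ^ 2 / 2 ≤ Real.cosh (3 / 4) := by
      have e : Real.cosh (3 / 4) = 1 + 2 * Real.sinh (3 / 4 / 2) ^ 2 := by
        conv_lhs => rw [show (3 / 4 : ℝ) = 2 * (3 / 4 / 2) by norm_num, Real.cosh_two_mul,
          Real.cosh_sq]
        ring
      have : (3 / 4 / 2 : ℝ) ≤ Real.sinh (3 / 4 / 2) := Real.self_le_sinh_iff.2 (by norm_num)
      rw [e]
      nlinarith
    refine lt_of_lt_of_le ?_ h1
    rw [Real.sqrt_lt' (by norm_num)]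
    norm_num
  linarith

/-- On the critical line, the condition `𝔥 ≤ 2/3 arcosh √(3/2)` in terms of `cosh² (β 𝔥)`. -/
lemma cosh_sq_le_iff {β 𝔥 : ℝ} (hβ : 0 < β) (h𝔥 : 0 ≤ 𝔥)
    (h : β * maxRatio (Real.cosh (β * 𝔥) ^ 2) = 1) :
    Real.cosh (β * 𝔥) ^ 2 ≤ 3 / 2 ↔ 𝔥 ≤ 2 / 3 * Real.arcosh √(3 / 2) := by
  have h1 : (1 : ℝ) ≤ √(3 / 2) := Real.one_le_sqrt.2 (by norm_num)
  obtain ⟨c, hc⟩ : ∃ c, c = Real.arcosh √(3 / 2) := ⟨_, rfl⟩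
  have hc0 : 0 ≤ c := hc ▸ Real.arcosh_nonneg h1
  have hcc : Real.cosh c ^ 2 = 3 / 2 := by
    rw [hc, Real.cosh_arcosh h1, Real.sq_sqrt (by norm_num)]
  -- At cosh² c = 3/2 the supremum is still 1/A = 2/3, whence the factor in the critical field
  -- strength.
  have hfc : criticalField c = 2 / 3 * c := by
    rw [criticalField, hcc, maxRatio_of_le (by norm_num) le_rfl]; ring
  have hf𝔥 : criticalField (β * 𝔥) = 𝔥 := by rw [criticalField]; linear_combination 𝔥 * h
  have ha : 0 ≤ β * 𝔥 := by positivity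
  rw [← hc, ← hfc]
  nth_rewrite 2 [← hf𝔥]
  rw [strictMonoOn_criticalField.le_iff_le ha hc0, ← hcc]
  constructor
  · intro h; by_contra hcon; push Not at hcon
    exact (cosh_sq_lt_cosh_sq hc0 hcon).not_ge h
  · intro h
    rcases h.eq_or_lt with e | e
    · rw [e]
    · exact (cosh_sq_lt_cosh_sq ha e).le

/-! ### Measures on finite spin configurations -/

instance : MeasurableSingletonClass ℤˣ where
  measurableSet_singleton u := by
    refine ⟨{(u : ℤ)}, measurableSet_singleton _, ?_⟩
    ext v
    simp [Units.ext_iff]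

instance (n : ℕ) : DiscreteMeasurableSpace (Fin n → ℤˣ) :=
  MeasurableSingletonClass.toDiscreteMeasurableSpace

lemma measureOfWeights_apply {n : ℕ} (w : (Fin n → ℤˣ) → ℝ) (s : Set (Fin n → ℤˣ))
    [DecidablePred (· ∈ s)] :
    measureOfWeights w s = ∑ σ with σ ∈ s, ENNReal.ofReal (w σ) := by
  rw [measureOfWeights, Measure.finsetSum_apply, Finset.sum_filter]
  refine Finset.sum_congr rfl fun σ _ => ?_
  rw [Measure.smul_apply, Measure.dirac_apply' _ (MeasurableSet.of_discrete), smul_eq_mul]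
  by_cases h : σ ∈ s <;> simp [h]

lemma measureOfWeights_real {n : ℕ} {w : (Fin n → ℤˣ) → ℝ} (hw : ∀ σ, 0 ≤ w σ)
    (s : Set (Fin n → ℤˣ)) [DecidablePred (· ∈ s)] :
    (measureOfWeights w).real s = ∑ σ with σ ∈ s, w σ := by
  rw [Measure.real, measureOfWeights_apply, ENNReal.toReal_sum (by simp)]
  exact Finset.sum_congr rfl fun σ _ => ENNReal.toReal_ofReal (hw σ)

instance {n : ℕ} (w : (Fin n → ℤˣ) → ℝ) : IsFiniteMeasure (measureOfWeights w) := by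
  classical
  refine ⟨?_⟩
  rw [measureOfWeights_apply]
  exact ENNReal.sum_lt_top.2 (by simp)

lemma measureOfWeights_real_singleton {n : ℕ} {w : (Fin n → ℤˣ) → ℝ} (hw : ∀ σ, 0 ≤ w σ)
    (σ : Fin n → ℤˣ) : (measureOfWeights w).real {σ} = w σ := by
  classical
  rw [measureOfWeights_real hw]
  simp [Finset.sum_filter]

instance (β : ℝ) (x : ℕ → ℝ) (N : ℕ) : IsFiniteMeasure (gibbsMeasure β x N) := by
  unfold gibbsMeasure; infer_instance

instance (β : ℝ) (x : ℕ → ℝ) (N k : ℕ) : IsFiniteMeasure (gibbsMarginal β x N k) := by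
  unfold gibbsMarginal; infer_instance

instance (β y : ℝ) (x : ℕ → ℝ) (k : ℕ) : IsFiniteMeasure (productMeasure β y x k) := by
  unfold productMeasure; infer_instance

/-- On a finite space, the relative entropy is small if the point masses are close. -/
lemma klDiv_le_of_forall_abs_sub_le {α : Type*} [MeasurableSpace α] [Finite α]
    [MeasurableSingletonClass α] {μ ν : Measure α} [IsFiniteMeasure μ] [IsFiniteMeasure ν]
    {b ε : ℝ} (hb : 0 < b) (hν : ∀ a, b ≤ ν.real {a}) (h : ∀ a, |μ.real {a} - ν.real {a}| ≤ ε) :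
    InformationTheory.klDiv μ ν ≤ ENNReal.ofReal ((ε / b) ^ 2) * ν univ := by
  have hν0 : ∀ a, ν {a} ≠ 0 := fun a h0 => by
    have := hν a
    simp [Measure.real, h0] at this
    linarith
  have hac : μ ≪ ν := by
    intro s hs
    have : s = ∅ := by
      by_contra hne
      obtain ⟨a, ha⟩ := nonempty_iff_ne_empty.2 hne
      exact hν0 a (measure_mono_null (singleton_subset_iff.2 ha) hs)
    simp [this]
  have hd : ∀ a, (μ.rnDeriv ν a).toReal * ν.real {a} = μ.real {a} := by
    intro a
    have h1 := Measure.withDensity_rnDeriv_eq μ ν hac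
    have h2 : μ {a} = μ.rnDeriv ν a * ν {a} := by
      conv_lhs => rw [← h1, withDensity_apply _ (measurableSet_singleton a), lintegral_singleton]
    rw [Measure.real, Measure.real, h2, ENNReal.toReal_mul]
  -- Relative entropy is dominated by the chi-square distance, through log u ≤ u - 1.
  have hkl : ∀ u : ℝ, 0 ≤ u → InformationTheory.klFun u ≤ (u - 1) ^ 2 := by
    intro u hu
    rw [InformationTheory.klFun_apply]
    have : u * Real.log u ≤ u * (u - 1) := by
      rcases hu.eq_or_lt with rfl | hu0
      · simp
      · exact mul_le_mul_of_nonneg_left (Real.log_le_sub_one_of_pos hu0) hu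
    nlinarith
  rw [InformationTheory.klDiv_eq_lintegral_klFun_of_ac hac, ← lintegral_const]
  refine lintegral_mono fun a => ENNReal.ofReal_le_ofReal ?_
  refine (hkl _ ENNReal.toReal_nonneg).trans ?_
  have h1 : |(μ.rnDeriv ν a).toReal - 1| ≤ ε / b := by
    have h2 : 0 < ν.real {a} := hb.trans_le (hν a)
    have h3 : ((μ.rnDeriv ν a).toReal - 1) * ν.real {a} = μ.real {a} - ν.real {a} := by
      rw [sub_mul, hd, one_mul]
    have h4 : |(μ.rnDeriv ν a).toReal - 1| * ν.real {a} ≤ ε := by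
      have h5 := h a
      rwa [← h3, abs_mul, abs_of_pos h2] at h5
    rw [le_div_iff₀ hb]
    exact (mul_le_mul_of_nonneg_left (hν a) (abs_nonneg _)).trans h4
  rw [← sq_abs]
  gcongr

/-- The weights of `productMeasure`, as functions of the first `k` fields. -/
def prodWeight (β y : ℝ) {k : ℕ} (z : Fin k → ℝ) (σ : Fin k → ℤˣ) : ℝ :=
  ∏ i, Real.exp (((σ i : ℤ) : ℝ) * (√β * y + β * z i)) / (2 * Real.cosh (√β * y + β * z i))

lemma prodWeight_nonneg (β y : ℝ) {k : ℕ} (z : Fin k → ℝ) (σ : Fin k → ℤˣ) :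
    0 ≤ prodWeight β y z σ :=
  Finset.prod_nonneg fun i _ => by have := Real.cosh_pos (√β * y + β * z i); positivity

lemma productMeasure_real_singleton (β y : ℝ) (x : ℕ → ℝ) (k : ℕ) (σ : Fin k → ℤˣ) :
    (productMeasure β y x k).real {σ} = prodWeight β y (fun i : Fin k => x i) σ :=
  measureOfWeights_real_singleton (prodWeight_nonneg β y _) σ

lemma sum_exp_unit_mul (u : ℝ) :
    ∑ s : ℤˣ, Real.exp (((s : ℤ) : ℝ) * u) = 2 * Real.cosh u := by
  rw [show (Finset.univ : Finset ℤˣ) = {1, -1} from rfl,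
    Finset.sum_pair (by decide), Real.cosh_eq]
  simp
  ring

lemma sum_prod_exp {n : ℕ} (u : Fin n → ℝ) :
    ∑ σ : Fin n → ℤˣ, ∏ i, Real.exp (((σ i : ℤ) : ℝ) * u i) = ∏ i, (2 * Real.cosh (u i)) := by
  simp_rw [← sum_exp_unit_mul]
  exact (Fintype.prod_sum fun i (s : ℤˣ) => Real.exp (((s : ℤ) : ℝ) * u i)).symm

lemma sum_prodWeight (β y : ℝ) {k : ℕ} (z : Fin k → ℝ) : ∑ σ, prodWeight β y z σ = 1 := by
  simp only [prodWeight, Finset.prod_div_distrib]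
  rw [← Finset.sum_div, sum_prod_exp, div_self]
  exact Finset.prod_ne_zero_iff.2 fun i _ => by
    have := Real.cosh_pos (√β * y + β * z i); positivity

lemma prodWeight_le_one (β y : ℝ) {k : ℕ} (z : Fin k → ℝ) (σ : Fin k → ℤˣ) :
    prodWeight β y z σ ≤ 1 := by
  rw [← sum_prodWeight β y z]
  exact Finset.single_le_sum (fun σ _ => prodWeight_nonneg β y z σ) (Finset.mem_univ σ)

lemma productMeasure_univ (β y : ℝ) (x : ℕ → ℝ) (k : ℕ) : productMeasure β y x k univ = 1 := by
  classical
  have h : (productMeasure β y x k).real univ = 1 := by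
    change (measureOfWeights (prodWeight β y fun i : Fin k => x i)).real univ = 1
    rw [measureOfWeights_real (prodWeight_nonneg β y fun i : Fin k => x i)]
    simpa using sum_prodWeight β y (fun i : Fin k => x i)
  rw [Measure.real] at h
  rwa [ENNReal.toReal_eq_one_iff] at h

lemma continuous_prodWeight (β : ℝ) {k : ℕ} (z : Fin k → ℝ) (σ : Fin k → ℤˣ) :
    Continuous fun y => prodWeight β y z σ := by
  unfold prodWeight
  refine continuous_finsetProd _ fun i _ => Continuous.div (by fun_prop) (by fun_prop) fun y => ?_
  have := Real.cosh_pos (√β * y + β * z i)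
  positivity

/-- Only finitely many field patterns exist on k sites, so the lower bound is uniform in the
realization. -/
lemma exists_le_prodWeight (β y 𝔥 : ℝ) (k : ℕ) : ∃ b, 0 < b ∧ ∀ z : Fin k → ℝ,
    (∀ i, z i = 𝔥 ∨ z i = -𝔥) → ∀ σ, b ≤ prodWeight β y z σ := by
  have key : ∀ (s : Fin k → ℤˣ) (σ : Fin k → ℤˣ),
      0 < prodWeight β y (fun i => 𝔥 * ((s i : ℤ) : ℝ)) σ := fun s σ =>
    Finset.prod_pos fun i _ => by
      have := Real.cosh_pos (√β * y + β * (𝔥 * ((s i : ℤ) : ℝ))); positivity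
  obtain ⟨p, hp⟩ := Finite.exists_min fun p : (Fin k → ℤˣ) × (Fin k → ℤˣ) =>
    prodWeight β y (fun i => 𝔥 * ((p.1 i : ℤ) : ℝ)) p.2
  refine ⟨_, key p.1 p.2, fun z hz σ => ?_⟩
  have : ∀ i, ∃ s : ℤˣ, z i = 𝔥 * ((s : ℤ) : ℝ) := fun i => by
    rcases hz i with h | h
    · exact ⟨1, by simp [h]⟩
    · exact ⟨-1, by simp [h]⟩
  choose s hs using this
  rw [show z = fun i => 𝔥 * ((s i : ℤ) : ℝ) from funext hs]
  exact hp (s, σ)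

lemma eventually_abs_prodWeight_sub_le (β y₀ 𝔥 : ℝ) (k : ℕ) {ε : ℝ} (hε : 0 < ε) :
    ∀ᶠ y in 𝓝 y₀, ∀ z : Fin k → ℝ, (∀ i, z i = 𝔥 ∨ z i = -𝔥) → ∀ σ,
      |prodWeight β y z σ - prodWeight β y₀ z σ| ≤ ε := by
  have key : ∀ᶠ y in 𝓝 y₀, ∀ (s : Fin k → ℤˣ) (σ : Fin k → ℤˣ),
      |prodWeight β y (fun i => 𝔥 * ((s i : ℤ) : ℝ)) σ
        - prodWeight β y₀ (fun i => 𝔥 * ((s i : ℤ) : ℝ)) σ| < ε := by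
    rw [eventually_all]
    intro s
    rw [eventually_all]
    intro σ
    exact Metric.tendsto_nhds.1 ((continuous_prodWeight β _ σ).tendsto y₀) ε hε
  filter_upwards [key] with y hy z hz σ
  have : ∀ i, ∃ s : ℤˣ, z i = 𝔥 * ((s : ℤ) : ℝ) := fun i => by
    rcases hz i with h | h
    · exact ⟨1, by simp [h]⟩
    · exact ⟨-1, by simp [h]⟩
  choose s hs using this
  rw [show z = fun i => 𝔥 * ((s i : ℤ) : ℝ) from funext hs]
  exact (hy s σ).le

/-! ### The Hubbard-Stratonovich representation -/

/-- The coefficient of the fluctuation of the field in the finite volume version of `G`. -/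
def tilt (β 𝔥 y : ℝ) : ℝ :=
  Real.log (Real.cosh (√β * y + β * 𝔥)) - Real.log (Real.cosh (√β * y - β * 𝔥))

/-- The density of the Hubbard-Stratonovich measure for `N` spins, when `W` is the sum of the
signs of the fields. -/
def hsWeight (β 𝔥 : ℝ) (N : ℕ) (W y : ℝ) : ℝ := Real.exp (N * G β 𝔥 y + W / 2 * tilt β 𝔥 y)

lemma log_cosh_field {β 𝔥 x : ℝ} (hx : x = 𝔥 ∨ x = -𝔥) (y : ℝ) :
    Real.log (Real.cosh (√β * y + β * x)) =
      G β 𝔥 y + y ^ 2 / 2 + x / 𝔥 / 2 * tilt β 𝔥 y := by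
  rw [G_eq, tilt]
  -- At zero field x / 𝔥 is 0 by convention; this is harmless because `tilt` vanishes too.
  by_cases h0 : 𝔥 = 0
  · subst h0
    have : x = 0 := by simpa using hx
    subst this
    simp
  · rcases hx with rfl | rfl
    · rw [div_self h0]; ring
    · rw [neg_div, div_self h0, show √β * y + β * -𝔥 = √β * y - β * 𝔥 by ring]; ring

lemma hsWeight_eq {β 𝔥 : ℝ} {N : ℕ} {x : ℕ → ℝ} (hx : ∀ i, x i = 𝔥 ∨ x i = -𝔥) (y : ℝ) :
    hsWeight β 𝔥 N ((∑ i ∈ Finset.range N, x i) / 𝔥) y =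
      Real.exp (-(N / 2 * y ^ 2)) * ∏ i : Fin N, Real.cosh (√β * y + β * x i) := by
  have h1 : ∏ i : Fin N, Real.cosh (√β * y + β * x i) =
      Real.exp (∑ i : Fin N, Real.log (Real.cosh (√β * y + β * x i))) := by
    rw [Real.exp_sum]
    exact Finset.prod_congr rfl fun i _ => (Real.exp_log (Real.cosh_pos _)).symm
  rw [h1, ← Real.exp_add, hsWeight]
  congr 1
  simp_rw [fun i : Fin N => log_cosh_field (β := β) (hx i) y]
  rw [Finset.sum_add_distrib, ← Finset.sum_mul, ← Finset.sum_div, ← Finset.sum_div,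
    Fin.sum_univ_eq_sum_range fun i => x i]
  simp
  ring

lemma integrable_gaussian_linear {N : ℕ} (hN : 0 < N) (c : ℝ) :
    Integrable fun y : ℝ => Real.exp (-(N / 2 * y ^ 2)) * Real.exp (c * y) := by
  have hN' : (0 : ℝ) < N := by exact_mod_cast hN
  have h := ((integrable_exp_neg_mul_sq (show (0 : ℝ) < N / 2 by positivity)).comp_sub_right
    (c / N)).const_mul (Real.exp (c ^ 2 / (2 * N)))
  refine h.congr (Eventually.of_forall fun y => ?_)
  simp only
  rw [← Real.exp_add, ← Real.exp_add]
  congr 1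
  field_simp
  ring

lemma integral_gaussian_linear {N : ℕ} (hN : 0 < N) (c : ℝ) :
    ∫ y : ℝ, Real.exp (-(N / 2 * y ^ 2)) * Real.exp (c * y) =
      √(2 * Real.pi / N) * Real.exp (c ^ 2 / (2 * N)) := by
  have hN' : (0 : ℝ) < N := by exact_mod_cast hN
  have h1 : ∀ y : ℝ, Real.exp (-(N / 2 * y ^ 2)) * Real.exp (c * y) =
      Real.exp (c ^ 2 / (2 * N)) * Real.exp (-(N / 2 : ℝ) * (y - c / N) ^ 2) := by
    intro y
    rw [← Real.exp_add, ← Real.exp_add]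
    congr 1
    field_simp
    ring
  simp_rw [h1]
  rw [integral_const_mul, integral_sub_right_eq_self fun y => Real.exp (-(N / 2 : ℝ) * y ^ 2),
    integral_gaussian, mul_comm]
  congr 2
  field_simp

/-- The Gaussian integral linearizes exp(β (∑ σ_i)² / (2N)); given y, the spins are independent. -/
lemma exp_neg_hamiltonian {β : ℝ} (hβ : 0 ≤ β) (x : ℕ → ℝ) {N : ℕ} (hN : 0 < N)
    (σ : Fin N → ℤˣ) : √(2 * Real.pi / N) * Real.exp (-β * hamiltonian x N σ) =
      ∫ y, Real.exp (-(N / 2 * y ^ 2)) *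
        ∏ i : Fin N, Real.exp (((σ i : ℤ) : ℝ) * (√β * y + β * x i)) := by
  have h1 : ∀ y : ℝ, Real.exp (-(N / 2 * y ^ 2)) *
      ∏ i : Fin N, Real.exp (((σ i : ℤ) : ℝ) * (√β * y + β * x i)) =
      Real.exp (β * ∑ i : Fin N, x i * ((σ i : ℤ) : ℝ)) *
      (Real.exp (-(N / 2 * y ^ 2)) * Real.exp ((√β * ∑ i : Fin N, ((σ i : ℤ) : ℝ)) * y)) := by
    intro y
    rw [← Real.exp_sum, ← Real.exp_add, ← Real.exp_add, ← Real.exp_add]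
    congr 1
    have : ∑ i : Fin N, ((σ i : ℤ) : ℝ) * (√β * y + β * x i) =
        (√β * ∑ i : Fin N, ((σ i : ℤ) : ℝ)) * y + β * ∑ i : Fin N, x i * ((σ i : ℤ) : ℝ) := by
      rw [Finset.mul_sum, Finset.sum_mul, Finset.mul_sum, ← Finset.sum_add_distrib]
      exact Finset.sum_congr rfl fun i _ => by ring
    rw [this]
    ring
  simp_rw [h1]
  rw [integral_const_mul, integral_gaussian_linear hN, mul_pow, Real.sq_sqrt hβ]
  have h2 : -β * hamiltonian x N σ = β * ∑ i : Fin N, x i * ((σ i : ℤ) : ℝ) +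
      β * (∑ i : Fin N, ((σ i : ℤ) : ℝ)) ^ 2 / (2 * N) := by
    rw [hamiltonian, sq, Finset.sum_mul_sum]
    ring
  rw [h2, Real.exp_add]
  ring

lemma sum_exp_neg_hamiltonian {β : ℝ} (hβ : 0 ≤ β) (x : ℕ → ℝ) {N : ℕ} (hN : 0 < N)
    (T : Finset (Fin N → ℤˣ)) :
    √(2 * Real.pi / N) * ∑ σ ∈ T, Real.exp (-β * hamiltonian x N σ) =
      ∫ y, Real.exp (-(N / 2 * y ^ 2)) *
        ∑ σ ∈ T, ∏ i : Fin N, Real.exp (((σ i : ℤ) : ℝ) * (√β * y + β * x i)) := by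
  simp_rw [Finset.mul_sum]
  rw [integral_finsetSum]
  · exact Finset.sum_congr rfl fun σ _ => exp_neg_hamiltonian hβ x hN σ
  · intro σ _
    have h := (integrable_gaussian_linear hN (√β * ∑ i : Fin N, ((σ i : ℤ) : ℝ))).const_mul
      (Real.exp (β * ∑ i : Fin N, x i * ((σ i : ℤ) : ℝ)))
    refine h.congr (Eventually.of_forall fun y => ?_)
    simp only
    rw [← Real.exp_sum, ← Real.exp_add, ← Real.exp_add, ← Real.exp_add]
    congr 1
    have : ∑ i : Fin N, ((σ i : ℤ) : ℝ) * (√β * y + β * x i) =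
        (√β * ∑ i : Fin N, ((σ i : ℤ) : ℝ)) * y + β * ∑ i : Fin N, x i * ((σ i : ℤ) : ℝ) := by
      rw [Finset.mul_sum, Finset.sum_mul, Finset.mul_sum, ← Finset.sum_add_distrib]
      exact Finset.sum_congr rfl fun i _ => by ring
    rw [this]
    ring

lemma firstSpins_append {k m : ℕ} (σ : Fin k → ℤˣ) (τ : Fin m → ℤˣ) :
    firstSpins (k + m) k (Fin.append σ τ) = σ := by
  ext i
  have h : (i : ℕ) < k + m := by omega
  simp only [firstSpins, h, dif_pos]
  have : (⟨i, h⟩ : Fin (k + m)) = Fin.castAdd m i := rfl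
  rw [this, Fin.append_left]

/-- Each free spin contributes 2 cosh(u_i). Supplying the same factor for the k fixed spins exposes
the product weights against the full product. -/
lemma sum_filter_firstSpins {k m : ℕ} (σ : Fin k → ℤˣ) (u : Fin (k + m) → ℝ) :
    ∑ σ' : Fin (k + m) → ℤˣ with firstSpins (k + m) k σ' = σ,
      ∏ i, Real.exp (((σ' i : ℤ) : ℝ) * u i) =
    (∏ i : Fin k, Real.exp (((σ i : ℤ) : ℝ) * u (Fin.castAdd m i)) /
      (2 * Real.cosh (u (Fin.castAdd m i)))) * ∏ i, (2 * Real.cosh (u i)) := by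
  have h1 : ∑ σ' : Fin (k + m) → ℤˣ with firstSpins (k + m) k σ' = σ,
      ∏ i, Real.exp (((σ' i : ℤ) : ℝ) * u i) =
      ∑ τ : Fin m → ℤˣ, ∏ i, Real.exp ((((Fin.append σ τ i : ℤˣ) : ℤ) : ℝ) * u i) := by
    rw [Finset.sum_filter, ← (Fin.appendEquiv k m).sum_comp, Fintype.sum_prod_type]
    simp only [Fin.appendEquiv, Equiv.coe_fn_mk, firstSpins_append]
    rw [Finset.sum_comm]
    simp
  have hc : ∀ i, 2 * Real.cosh (u i) ≠ 0 := fun i => by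
    have := Real.cosh_pos (u i); positivity
  rw [h1]
  simp_rw [Fin.prod_univ_add, Fin.append_left, Fin.append_right]
  rw [← Finset.mul_sum, sum_prod_exp, ← mul_assoc, ← Finset.prod_mul_distrib]
  congr 1
  exact Finset.prod_congr rfl fun i _ => by rw [div_mul_cancel₀ _ (hc _)]

lemma partitionFunction_pos (β : ℝ) (x : ℕ → ℝ) (N : ℕ) : 0 < partitionFunction β x N :=
  Finset.sum_pos (fun _ _ => Real.exp_pos _) Finset.univ_nonempty

lemma measurable_firstSpins (N k : ℕ) : Measurable (firstSpins N k) := .of_discrete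

/-- The marginals of the Gibbs measure are mixtures of product measures. -/
lemma gibbsMarginal_real_mul_integral {β 𝔥 : ℝ} (hβ : 0 ≤ β) {x : ℕ → ℝ}
    (hx : ∀ i, x i = 𝔥 ∨ x i = -𝔥) {N k : ℕ} (hN : 0 < N) (hk : k ≤ N) (σ : Fin k → ℤˣ) :
    (gibbsMarginal β x N k).real {σ} *
        ∫ y, hsWeight β 𝔥 N ((∑ i ∈ Finset.range N, x i) / 𝔥) y =
      ∫ y, prodWeight β y (fun i : Fin k => x i) σ *
        hsWeight β 𝔥 N ((∑ i ∈ Finset.range N, x i) / 𝔥) y := by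
  have hN' : (0 : ℝ) < N := by exact_mod_cast hN
  obtain ⟨m, rfl⟩ := Nat.exists_eq_add_of_le hk
  have hc : 0 < √(2 * Real.pi / (k + m : ℕ)) := Real.sqrt_pos.2 (by positivity)
  have hZ := partitionFunction_pos β x (k + m)
  have hprod : ∀ y, ∏ i : Fin (k + m), (2 * Real.cosh (√β * y + β * x i)) =
      2 ^ (k + m) * ∏ i : Fin (k + m), Real.cosh (√β * y + β * x i) := fun y => by
    rw [Finset.prod_mul_distrib]; simp
  have h1 : (gibbsMarginal β x (k + m) k).real {σ} * partitionFunction β x (k + m) =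
      ∑ σ' : Fin (k + m) → ℤˣ with firstSpins (k + m) k σ' = σ,
        Real.exp (-β * hamiltonian x (k + m) σ') := by
    classical
    rw [gibbsMarginal, map_measureReal_apply (measurable_firstSpins _ _) .of_discrete,
      gibbsMeasure, measureOfWeights_real (fun σ => by positivity), Finset.sum_mul]
    refine Finset.sum_congr ?_ fun σ' _ => div_mul_cancel₀ _ hZ.ne'
    ext σ'
    simp
  have h2 := sum_exp_neg_hamiltonian hβ x hN Finset.univ
  have h3 := sum_exp_neg_hamiltonian hβ x hN
    (Finset.univ.filter fun σ' => firstSpins (k + m) k σ' = σ)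
  simp_rw [sum_filter_firstSpins, hprod] at h3
  simp_rw [sum_prod_exp, hprod] at h2
  rw [← h1] at h3
  have e2 : ∀ y : ℝ, Real.exp (-((k + m : ℕ) / 2 * y ^ 2)) *
      (2 ^ (k + m) * ∏ i : Fin (k + m), Real.cosh (√β * y + β * x i)) = 2 ^ (k + m) *
      hsWeight β 𝔥 (k + m) ((∑ i ∈ Finset.range (k + m), x i) / 𝔥) y := fun y => by
    rw [hsWeight_eq hx]; ring
  have e3 : ∀ y : ℝ, Real.exp (-((k + m : ℕ) / 2 * y ^ 2)) *
      ((∏ i : Fin k, Real.exp (((σ i : ℤ) : ℝ) * (√β * y + β * x (Fin.castAdd m i))) /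
      (2 * Real.cosh (√β * y + β * x (Fin.castAdd m i)))) *
      (2 ^ (k + m) * ∏ i : Fin (k + m), Real.cosh (√β * y + β * x i))) = 2 ^ (k + m) *
      (prodWeight β y (fun i : Fin k => x i) σ *
      hsWeight β 𝔥 (k + m) ((∑ i ∈ Finset.range (k + m), x i) / 𝔥) y) := fun y => by
    rw [hsWeight_eq hx, prodWeight]
    simp only [Fin.val_castAdd]
    ring
  rw [integral_congr_ae (Eventually.of_forall e2), integral_const_mul] at h2
  rw [integral_congr_ae (Eventually.of_forall e3), integral_const_mul] at h3
  have h4 : (2 : ℝ) ^ (k + m) ≠ 0 := by positivity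
  refine mul_left_cancel₀ h4 ?_
  rw [← h3, mul_left_comm, ← h2, partitionFunction]
  ring

/-! ### Concentration of the Hubbard-Stratonovich measure -/

/-- That is, cosh(v + d) ≤ e^|d| cosh v. -/
lemma log_cosh_sub_le (u v : ℝ) :
    Real.log (Real.cosh u) - Real.log (Real.cosh v) ≤ |u - v| := by
  rw [← Real.log_div (Real.cosh_pos u).ne' (Real.cosh_pos v).ne',
    Real.log_le_iff_le_exp (div_pos (Real.cosh_pos u) (Real.cosh_pos v)),
    div_le_iff₀ (Real.cosh_pos v)]
  obtain ⟨d, rfl⟩ : ∃ d, u = v + d := ⟨u - v, by ring⟩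
  rw [add_sub_cancel_left, Real.cosh_add, ← Real.cosh_add_sinh, Real.cosh_abs, ← Real.abs_sinh]
  have h1 : |Real.sinh v| ≤ Real.cosh v := by
    rw [Real.abs_sinh, ← Real.cosh_abs]; exact (Real.sinh_lt_cosh _).le
  have h2 : Real.sinh v * Real.sinh d ≤ Real.cosh v * |Real.sinh d| :=
    (le_abs_self _).trans (by rw [abs_mul]; gcongr)
  nlinarith

lemma abs_log_cosh_sub_le (u v : ℝ) :
    |Real.log (Real.cosh u) - Real.log (Real.cosh v)| ≤ |u - v| := by
  rw [abs_le']
  refine ⟨log_cosh_sub_le u v, ?_⟩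
  rw [neg_sub, abs_sub_comm]
  exact log_cosh_sub_le v u

lemma abs_tilt_le (β 𝔥 y : ℝ) : |tilt β 𝔥 y| ≤ 2 * |β * 𝔥| := by
  refine (abs_log_cosh_sub_le _ _).trans_eq ?_
  rw [show √β * y + β * 𝔥 - (√β * y - β * 𝔥) = 2 * (β * 𝔥) by ring, abs_mul, abs_two]

/-- The linear bound controls the influence of the field near the maximum point 0, where the uniform
bound is too weak. -/
lemma abs_tilt_le' (β 𝔥 y : ℝ) : |tilt β 𝔥 y| ≤ 2 * (√β * |y|) := by
  rw [tilt, ← Real.cosh_neg (√β * y - β * 𝔥)]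
  refine (abs_log_cosh_sub_le _ _).trans_eq ?_
  rw [show √β * y + β * 𝔥 - -(√β * y - β * 𝔥) = 2 * (√β * y) by ring, abs_mul, abs_mul, abs_two,
    abs_of_nonneg (Real.sqrt_nonneg β)]

lemma tilt_neg (β 𝔥 y : ℝ) : tilt β 𝔥 (-y) = -tilt β 𝔥 y := by
  rw [tilt, tilt, ← Real.cosh_neg (√β * -y + β * 𝔥), ← Real.cosh_neg (√β * -y - β * 𝔥), neg_sub]
  ring_nf

lemma tilt_pos {β 𝔥 y : ℝ} (hβ : 0 < β) (h𝔥 : 0 < 𝔥) (hy : 0 < y) : 0 < tilt β 𝔥 y := by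
  refine sub_pos.2 (Real.log_lt_log (Real.cosh_pos _) (Real.cosh_lt_cosh.2 ?_))
  have h1 : 0 < √β * y := by positivity
  have h2 : 0 < β * 𝔥 := by positivity
  rw [abs_of_pos (by positivity : 0 < √β * y + β * 𝔥), abs_lt]
  constructor <;> linarith

lemma continuous_log_cosh : Continuous fun u : ℝ => Real.log (Real.cosh u) :=
  Real.continuous_cosh.log fun u => (Real.cosh_pos u).ne'

lemma continuous_tilt (β 𝔥 : ℝ) : Continuous (tilt β 𝔥) :=
  (continuous_log_cosh.comp (by fun_prop : Continuous fun y => √β * y + β * 𝔥)).sub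
    (continuous_log_cosh.comp (by fun_prop : Continuous fun y => √β * y - β * 𝔥))

lemma G_le_sub_sq {β : ℝ} (hβ : 0 ≤ β) (𝔥 y : ℝ) :
    G β 𝔥 y ≤ Real.log (Real.cosh (β * 𝔥)) + β - y ^ 2 / 4 := by
  have h1 := log_cosh_sub_le (√β * y + β * 𝔥) (β * 𝔥)
  have h2 := log_cosh_sub_le (√β * y - β * 𝔥) (-(β * 𝔥))
  rw [add_sub_cancel_right, abs_mul, abs_of_nonneg (Real.sqrt_nonneg β)] at h1
  rw [show √β * y - β * 𝔥 - -(β * 𝔥) = √β * y by ring, abs_mul,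
    abs_of_nonneg (Real.sqrt_nonneg β), Real.cosh_neg] at h2
  rw [G_eq]
  nlinarith [sq_nonneg (√β - |y| / 2), Real.sq_sqrt hβ, sq_abs y]

lemma hsWeight_pos (β 𝔥 : ℝ) (N : ℕ) (W y : ℝ) : 0 < hsWeight β 𝔥 N W y := Real.exp_pos _

lemma hsWeight_neg (β 𝔥 : ℝ) (N : ℕ) (W y : ℝ) :
    hsWeight β 𝔥 N W (-y) = hsWeight β 𝔥 N (-W) y := by
  rw [hsWeight, hsWeight, G_neg, tilt_neg]
  congr 1
  ring

lemma continuous_hsWeight (β 𝔥 : ℝ) (N : ℕ) (W : ℝ) : Continuous (hsWeight β 𝔥 N W) :=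
  ((continuous_const.mul (continuous_G β 𝔥)).add
    (continuous_const.mul (continuous_tilt β 𝔥))).rexp

lemma abs_half_mul_tilt_le (β 𝔥 W y : ℝ) : |W / 2 * tilt β 𝔥 y| ≤ |W| * |β * 𝔥| := by
  rw [abs_mul, abs_div, abs_two]
  nlinarith [abs_tilt_le β 𝔥 y, abs_nonneg W]

lemma integrable_hsWeight {β : ℝ} (hβ : 0 ≤ β) (𝔥 : ℝ) {N : ℕ} (hN : 0 < N) (W : ℝ) :
    Integrable (hsWeight β 𝔥 N W) := by
  have hN' : (0 : ℝ) < N := by exact_mod_cast hN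
  have h := (integrable_exp_neg_mul_sq (show (0 : ℝ) < N / 4 by positivity)).const_mul
    (Real.exp (|W| * |β * 𝔥| + N * (Real.log (Real.cosh (β * 𝔥)) + β)))
  refine h.mono' (continuous_hsWeight β 𝔥 N W).aestronglyMeasurable
    (Eventually.of_forall fun y => ?_)
  rw [Real.norm_of_nonneg (hsWeight_pos β 𝔥 N W y).le, hsWeight, ← Real.exp_add, Real.exp_le_exp]
  have h1 := (abs_le.1 (abs_half_mul_tilt_le β 𝔥 W y)).2
  have h2 := mul_le_mul_of_nonneg_left (G_le_sub_sq hβ 𝔥 y) hN'.le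
  linarith

lemma integrable_exp_G {β : ℝ} (hβ : 0 ≤ β) (𝔥 : ℝ) :
    Integrable fun y => Real.exp (G β 𝔥 y) := by
  have h := integrable_hsWeight hβ 𝔥 one_pos 0
  refine h.congr (Eventually.of_forall fun y => ?_)
  simp [hsWeight]

lemma integral_hsWeight_pos {β : ℝ} (hβ : 0 ≤ β) (𝔥 : ℝ) {N : ℕ} (hN : 0 < N) (W : ℝ) :
    0 < ∫ y, hsWeight β 𝔥 N W y :=
  integral_pos_of_integrable_nonneg_nonzero (x := 0) (continuous_hsWeight β 𝔥 N W)
    (integrable_hsWeight hβ 𝔥 hN W) (fun y => (hsWeight_pos β 𝔥 N W y).le)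
    (hsWeight_pos β 𝔥 N W 0).ne'

lemma setIntegral_le_add_of_subset_union {f : ℝ → ℝ} (hf : Integrable f) (h0 : ∀ y, 0 ≤ f y)
    {s t u : Set ℝ} (hs : MeasurableSet s) (ht : MeasurableSet t) (hu : MeasurableSet u)
    (h : s ⊆ t ∪ u) : ∫ y in s, f y ≤ (∫ y in t, f y) + ∫ y in u, f y := by
  rw [← integral_indicator hs, ← integral_indicator ht, ← integral_indicator hu,
    ← integral_add (hf.indicator ht) (hf.indicator hu)]
  refine integral_mono (hf.indicator hs) ((hf.indicator ht).add (hf.indicator hu)) fun y => ?_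
  have h1 := indicator_nonneg (fun y (_ : y ∈ t) => h0 y) y
  have h2 := indicator_nonneg (fun y (_ : y ∈ u) => h0 y) y
  by_cases hy : y ∈ s
  · rw [indicator_of_mem hy]
    rcases h hy with h3 | h3
    · rw [indicator_of_mem h3]; linarith
    · rw [indicator_of_mem h3]; linarith
  · rw [indicator_of_notMem hy]; exact add_nonneg h1 h2

/-- If the Hubbard-Stratonovich measure concentrates near `y₀`, then the marginals of the Gibbs
measure are close to the product measure with parameter `y₀`. -/
lemma gibbsMarginal_close {β : ℝ} (hβ : 0 < β) (𝔥 y₀ : ℝ) (k : ℕ) {ε : ℝ} (hε : 0 < ε) :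
    ∃ U, IsOpen U ∧ y₀ ∈ U ∧ ∃ δ, 0 < δ ∧ ∀ (N : ℕ) (x : ℕ → ℝ), 0 < N → k ≤ N →
      (∀ i, x i = 𝔥 ∨ x i = -𝔥) →
      ∫ y in Uᶜ, hsWeight β 𝔥 N ((∑ i ∈ Finset.range N, x i) / 𝔥) y ≤
        δ * ∫ y, hsWeight β 𝔥 N ((∑ i ∈ Finset.range N, x i) / 𝔥) y →
      (∀ σ, |(gibbsMarginal β x N k).real {σ} - (productMeasure β y₀ x k).real {σ}| ≤ ε) ∧
      InformationTheory.klDiv (gibbsMarginal β x N k) (productMeasure β y₀ x k) ≤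
        ENNReal.ofReal ε := by
  obtain ⟨b, hb, hb'⟩ := exists_le_prodWeight β y₀ 𝔥 k
  set ε' := min ε (b * min 1 ε) with hε'
  have hε'0 : 0 < ε' := by positivity
  obtain ⟨U, hU, hUo, hUy⟩ := eventually_nhds_iff.1
    (eventually_abs_prodWeight_sub_le β y₀ 𝔥 k (half_pos hε'0))
  refine ⟨U, hUo, hUy, ε' / 2, half_pos hε'0, fun N x hN hk hx hw => ?_⟩
  set w := hsWeight β 𝔥 N ((∑ i ∈ Finset.range N, x i) / 𝔥) with hw_def
  have hwi : Integrable w := integrable_hsWeight hβ.le 𝔥 hN _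
  have hw0 : ∀ y, 0 ≤ w y := fun y => (hsWeight_pos β 𝔥 N _ y).le
  have hI : 0 < ∫ y, w y := integral_hsWeight_pos hβ.le 𝔥 hN _
  have key : ∀ σ, |(gibbsMarginal β x N k).real {σ} - (productMeasure β y₀ x k).real {σ}| ≤ ε' := by
    intro σ
    rw [productMeasure_real_singleton]
    set z : Fin k → ℝ := fun i => x i with hz
    have hpi : Integrable fun y => prodWeight β y z σ * w y :=
      hwi.bdd_mul (c := 1) (continuous_prodWeight β z σ).aestronglyMeasurable
        (Eventually.of_forall fun y => by
          rw [Real.norm_of_nonneg (prodWeight_nonneg β y z σ)]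
          exact prodWeight_le_one β y z σ)
    have h1 : ((gibbsMarginal β x N k).real {σ} - prodWeight β y₀ z σ) * ∫ y, w y =
        ∫ y, (prodWeight β y z σ - prodWeight β y₀ z σ) * w y := by
      rw [sub_mul, gibbsMarginal_real_mul_integral hβ.le hx hN hk, ← integral_const_mul,
        ← integral_sub hpi (hwi.const_mul _)]
      simp_rw [sub_mul]
    have h2 : |∫ y, (prodWeight β y z σ - prodWeight β y₀ z σ) * w y| ≤
        ∫ y, (ε' / 2 * w y + Uᶜ.indicator w y) := by
      rw [← Real.norm_eq_abs]
      refine norm_integral_le_of_norm_le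
        ((hwi.const_mul _).add (hwi.indicator hUo.measurableSet.compl))
        (Eventually.of_forall fun y => ?_)
      rw [norm_mul, Real.norm_of_nonneg (hw0 y), Real.norm_eq_abs]
      by_cases hy : y ∈ U
      · rw [indicator_of_notMem (by simpa using hy), add_zero]
        exact mul_le_mul_of_nonneg_right (hU y hy z (fun i => hx i) σ) (hw0 y)
      · rw [indicator_of_mem (by simpa using hy)]
        have h3 : |prodWeight β y z σ - prodWeight β y₀ z σ| ≤ 1 := by
          rw [abs_le]
          constructor <;> linarith [prodWeight_nonneg β y z σ, prodWeight_nonneg β y₀ z σ,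
            prodWeight_le_one β y z σ, prodWeight_le_one β y₀ z σ]
        nlinarith [mul_le_mul_of_nonneg_right h3 (hw0 y), mul_nonneg hε'0.le (hw0 y)]
    rw [integral_add (hwi.const_mul _) (hwi.indicator hUo.measurableSet.compl),
      integral_const_mul, integral_indicator hUo.measurableSet.compl, ← h1, abs_mul,
      abs_of_pos hI] at h2
    refine le_of_mul_le_mul_right ?_ hI
    linarith
  refine ⟨fun σ => (key σ).trans (min_le_left _ _), ?_⟩
  refine (klDiv_le_of_forall_abs_sub_le hb (fun σ => ?_) key).trans ?_
  · rw [productMeasure_real_singleton]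
    exact hb' _ (fun i => hx i) σ
  · rw [productMeasure_univ, mul_one]
    refine ENNReal.ofReal_le_ofReal ?_
    have h1 : ε' / b ≤ min 1 ε := by
      rw [div_le_iff₀ hb, mul_comm]; exact min_le_right _ _
    have h2 : 0 ≤ ε' / b := by positivity
    have h3 : min 1 ε ≤ 1 := min_le_left _ _
    have h4 : min 1 ε ≤ ε := min_le_right _ _
    nlinarith

/-- Of the gap 3κ, one κ is spent on the lower bound near y₁ and one on the field fluctuation; the
last gives the decay e^(-κN). -/
lemma exists_gap {β : ℝ} (hβ : 0 ≤ β) {𝔥 y₁ : ℝ} (hy₁ : y₁ ∈ maximizers β 𝔥) {U : Set ℝ}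
    (hU : IsOpen U) (h : maximizers β 𝔥 ⊆ U) :
    ∃ κ, 0 < κ ∧ ∀ y ∈ Uᶜ, G β 𝔥 y ≤ G β 𝔥 y₁ - 3 * κ := by
  rcases (Uᶜ).eq_empty_or_nonempty with he | ⟨x₀, hx₀⟩
  · exact ⟨1, one_pos, by simp [he]⟩
  set C := Real.log (Real.cosh (β * 𝔥)) + β with hC
  obtain ⟨y₂, hy₂, hmax⟩ := (continuous_G β 𝔥).continuousOn.exists_isMaxOn' hU.isClosed_compl hx₀ (by
    refine Eventually.filter_mono inf_le_left ?_
    filter_upwards [(tendsto_norm_cocompact_atTop (E := ℝ)).eventually_ge_atTop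
      (|4 * (C - G β 𝔥 x₀)| + 1)] with y hy
    have h1 := G_le_sub_sq hβ 𝔥 y
    rw [Real.norm_eq_abs] at hy
    have h2 := le_abs_self (4 * (C - G β 𝔥 x₀))
    have h3 := abs_nonneg (4 * (C - G β 𝔥 x₀))
    nlinarith [sq_abs y])
  have h2 : G β 𝔥 y₂ < G β 𝔥 y₁ := by
    refine lt_of_le_of_ne (hy₁ y₂) fun he => hy₂ (h fun z => ?_)
    rw [he]; exact hy₁ z
  refine ⟨(G β 𝔥 y₁ - G β 𝔥 y₂) / 3, by linarith, fun y hy => ?_⟩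
  have : G β 𝔥 y ≤ G β 𝔥 y₂ := hmax hy
  linarith

lemma setIntegral_hsWeight_le_of_maximizers_subset {β : ℝ} (hβ : 0 < β) {𝔥 : ℝ} {U : Set ℝ}
    (hU : IsOpen U) (h : maximizers β 𝔥 ⊆ U) :
    ∃ η, 0 < η ∧ ∃ κ, 0 < κ ∧ ∃ C, ∀ (N : ℕ) (W : ℝ), 0 < N → |W| ≤ η * N →
      ∫ y in Uᶜ, hsWeight β 𝔥 N W y ≤ C * Real.exp (-(κ * N)) * ∫ y, hsWeight β 𝔥 N W y := by
  obtain ⟨y₁, hy₁⟩ := exists_mem_maximizers hβ 𝔥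
  obtain ⟨κ, hκ, hgap⟩ := exists_gap hβ.le hy₁ hU h
  set G₁ := G β 𝔥 y₁ with hG₁
  obtain ⟨r, hr, hball⟩ := Metric.eventually_nhds_iff_ball.1
    ((continuous_G β 𝔥).continuousAt.eventually_const_lt (show G₁ - κ < G β 𝔥 y₁ by linarith))
  set I := ∫ y, Real.exp (G β 𝔥 y) with hI
  set a := |β * 𝔥| with ha
  have ha0 : 0 ≤ a := abs_nonneg _
  -- With this η the fluctuation costs 2|W|a ≤ κN; the +1 covers a = 0.
  refine ⟨κ / (2 * (a + 1)), by positivity, κ, hκ,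
    I * Real.exp (-(G₁ - 3 * κ)) / (2 * r), fun N W hN hW => ?_⟩
  have hN' : (1 : ℝ) ≤ N := by exact_mod_cast hN
  have hWa : 2 * (|W| * a) ≤ κ * N := by
    have h1 : |W| * (2 * (a + 1)) ≤ κ * N := by
      rwa [div_mul_eq_mul_div, le_div_iff₀ (by positivity)] at hW
    nlinarith [abs_nonneg W]
  have hwi := integrable_hsWeight hβ.le 𝔥 hN W
  have hw0 : ∀ y, 0 ≤ hsWeight β 𝔥 N W y := fun y => (hsWeight_pos β 𝔥 N W y).le
  have hI0 : 0 ≤ I := integral_nonneg fun y => (Real.exp_pos _).le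
  have hupper : ∫ y in Uᶜ, hsWeight β 𝔥 N W y ≤
      Real.exp (|W| * a + (N - 1) * (G₁ - 3 * κ)) * I := by
    -- Only N - 1 factors e^G are bounded by the gap; the last one is kept for integrability.
    have h1 : ∫ y in Uᶜ, hsWeight β 𝔥 N W y ≤
        ∫ y in Uᶜ, Real.exp (|W| * a + (N - 1) * (G₁ - 3 * κ)) * Real.exp (G β 𝔥 y) := by
      refine setIntegral_mono_on hwi.integrableOn
        ((integrable_exp_G hβ.le 𝔥).const_mul _).integrableOn hU.measurableSet.compl fun y hy => ?_
      rw [hsWeight, ← Real.exp_add, Real.exp_le_exp]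
      have h2 := (abs_le.1 (abs_half_mul_tilt_le β 𝔥 W y)).2
      nlinarith [mul_le_mul_of_nonneg_left (hgap y hy) (sub_nonneg.2 hN')]
    refine h1.trans ?_
    rw [integral_const_mul]
    refine mul_le_mul_of_nonneg_left ?_ (Real.exp_pos _).le
    exact setIntegral_le_integral (integrable_exp_G hβ.le 𝔥)
      (Eventually.of_forall fun y => (Real.exp_pos _).le)
  have hlower : 2 * r * Real.exp (N * (G₁ - κ) - |W| * a) ≤ ∫ y, hsWeight β 𝔥 N W y := by
    have h1 : ∫ y in Metric.ball y₁ r, Real.exp (N * (G₁ - κ) - |W| * a) ≤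
        ∫ y in Metric.ball y₁ r, hsWeight β 𝔥 N W y := by
      refine setIntegral_mono_on (integrableOn_const measure_ball_lt_top.ne) hwi.integrableOn
        measurableSet_ball fun y hy => ?_
      rw [hsWeight, Real.exp_le_exp]
      have h2 := (abs_le.1 (abs_half_mul_tilt_le β 𝔥 W y)).1
      nlinarith [hball y hy]
    rw [setIntegral_const, Measure.real, Real.volume_ball, ENNReal.toReal_ofReal (by positivity),
      smul_eq_mul] at h1
    exact h1.trans (setIntegral_le_integral hwi (Eventually.of_forall hw0))
  refine hupper.trans ?_
  calc Real.exp (|W| * a + (N - 1) * (G₁ - 3 * κ)) * I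
      ≤ Real.exp (-(G₁ - 3 * κ) + -(κ * N) + (N * (G₁ - κ) - |W| * a)) * I := by
        refine mul_le_mul_of_nonneg_right (Real.exp_le_exp.2 ?_) hI0
        linarith
    _ = I * Real.exp (-(G₁ - 3 * κ)) / (2 * r) * Real.exp (-(κ * N)) *
        (2 * r * Real.exp (N * (G₁ - κ) - |W| * a)) := by
        rw [Real.exp_add, Real.exp_add]
        field_simp
    _ ≤ _ := mul_le_mul_of_nonneg_left hlower (by positivity)

/-- The Hubbard-Stratonovich measure concentrates near the maximum points of `G`. -/
lemma exists_forall_setIntegral_le {β : ℝ} (hβ : 0 < β) {𝔥 : ℝ} {U : Set ℝ}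
    (hU : IsOpen U) (h : maximizers β 𝔥 ⊆ U) {δ : ℝ} (hδ : 0 < δ) :
    ∃ η, 0 < η ∧ ∃ N₀ : ℕ, ∀ (N : ℕ) (W : ℝ), N₀ ≤ N → |W| ≤ η * N →
      ∫ y in Uᶜ, hsWeight β 𝔥 N W y ≤ δ * ∫ y, hsWeight β 𝔥 N W y := by
  obtain ⟨η, hη, κ, hκ, C, hC⟩ := setIntegral_hsWeight_le_of_maximizers_subset hβ hU h
  have h1 : Tendsto (fun N : ℕ => C * Real.exp (-(κ * N))) atTop (𝓝 (C * 0)) :=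
    (Real.tendsto_exp_neg_atTop_nhds_zero.comp
      (tendsto_natCast_atTop_atTop.const_mul_atTop hκ)).const_mul C
  rw [mul_zero] at h1
  obtain ⟨N₁, hN₁⟩ := eventually_atTop.1 (h1.eventually_lt_const hδ)
  refine ⟨η, hη, max N₁ 1, fun N W hN hW => ?_⟩
  have hN0 : 0 < N := (le_max_right _ _).trans hN
  refine (hC N W hN0 hW).trans ?_
  exact mul_le_mul_of_nonneg_right (hN₁ N ((le_max_left _ _).trans hN)).le
    (integral_hsWeight_pos hβ.le 𝔥 hN0 W).le

/-! ### Selection of a maximum point by the fluctuation of the field -/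

/-- Near a maximum point, `G` is bounded below by a parabola. -/
lemma sub_sq_le_G {β 𝔥 y₁ : ℝ} (hy₁ : y₁ ∈ maximizers β 𝔥) {y : ℝ} (hy : y₁ ≤ y) :
    G β 𝔥 y₁ - (y - y₁) ^ 2 / 2 ≤ G β 𝔥 y := by
  set A := Real.cosh (β * 𝔥) ^ 2 with hA
  have hA1 : 1 ≤ A := one_le_cosh_sq _
  have hA0 : 0 < A := by linarith
  -- The excess is convex because A ≥ 1, so G + y²/2 is convex.
  have hmono : Monotone (excess' A) := fun s t hst =>
    le_of_hasDerivAt_nonneg hst (fun t _ _ => hasDerivAt_excess' hA0 t) fun t _ _ => by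
      have : 0 ≤ 2 * A - 1 := by linarith
      unfold excess''
      positivity
  have h0 := excess'_eq_of_mem_maximizers hy₁
  have h := le_of_hasDerivAt_nonneg (f := fun y => G β 𝔥 y + (y - y₁) ^ 2 / 2)
    (f' := fun y => (√β * excess' A (√β * y) - 2 * y) / 2 + (y - y₁)) hy
    (fun y _ _ => by
      refine ((hasDerivAt_G β 𝔥 y).add
        ((((hasDerivAt_id y).sub_const y₁).pow 2).div_const 2)).congr_deriv ?_
      rw [hA]
      simp) fun z hz _ => by
      have h1 := hmono (mul_le_mul_of_nonneg_left hz.le (Real.sqrt_nonneg β))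
      have h2 := mul_le_mul_of_nonneg_left h1 (Real.sqrt_nonneg β)
      linarith
  simp only [sub_self] at h
  linarith

lemma setIntegral_neg_preimage (f : ℝ → ℝ) {s : Set ℝ} (hs : MeasurableSet s) :
    ∫ y in Neg.neg ⁻¹' s, f y = ∫ y in s, f (-y) := by
  rw [← integral_indicator hs, ← integral_indicator (measurable_neg hs), ← integral_neg_eq_self]
  refine integral_congr_ae (Eventually.of_forall fun y => ?_)
  beta_reduce
  have h : -y ∈ Neg.neg ⁻¹' s ↔ y ∈ s := by rw [mem_preimage, neg_neg]
  by_cases hy : y ∈ s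
  · rw [indicator_of_mem (h.2 hy), indicator_of_mem hy]
  · rw [indicator_of_notMem fun h' => hy (h.1 h'), indicator_of_notMem hy]

/-- Reflection y ↦ -y reverses the sign of W in the density, which costs a factor exp(-W `tilt(y)`).
-/
lemma setIntegral_hsWeight_neg_le {β : ℝ} (hβ : 0 < β) (𝔥 : ℝ) {N : ℕ} (hN : 0 < N) {W r₀ : ℝ}
    (hW : 0 ≤ W) {B : Set ℝ} (hB : MeasurableSet B) (hr : ∀ y ∈ B, r₀ ≤ tilt β 𝔥 y) :
    ∫ y in Neg.neg ⁻¹' B, hsWeight β 𝔥 N W y ≤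
      Real.exp (-(W * r₀)) * ∫ y, hsWeight β 𝔥 N W y := by
  have hwi := integrable_hsWeight hβ.le 𝔥 hN W
  rw [setIntegral_neg_preimage _ hB]
  simp_rw [hsWeight_neg]
  have h1 : ∫ y in B, hsWeight β 𝔥 N (-W) y ≤
      ∫ y in B, Real.exp (-(W * r₀)) * hsWeight β 𝔥 N W y := by
    refine setIntegral_mono_on (integrable_hsWeight hβ.le 𝔥 hN _).integrableOn
      (hwi.const_mul _).integrableOn hB fun y hy => ?_
    rw [hsWeight, hsWeight, ← Real.exp_add, Real.exp_le_exp]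
    nlinarith [mul_le_mul_of_nonneg_left (hr y hy) hW]
  refine h1.trans ?_
  rw [integral_const_mul]
  exact mul_le_mul_of_nonneg_left (setIntegral_le_integral hwi
    (Eventually.of_forall fun y => (hsWeight_pos β 𝔥 N W y).le)) (Real.exp_pos _).le

/-- Completing the square: the linear field term is absorbed by half of the quadratic loss c N y².
-/
lemma setIntegral_hsWeight_le_gaussian {β : ℝ} (hβ : 0 < β) {𝔥 G₁ c : ℝ} (hc : 0 < c) {N : ℕ}
    (hN : 0 < N) (W : ℝ) {B : Set ℝ} (hB : MeasurableSet B)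
    (hG : ∀ y ∈ B, G β 𝔥 y ≤ G₁ - c * y ^ 2) :
    ∫ y in B, hsWeight β 𝔥 N W y ≤
      Real.exp (N * G₁ + β * W ^ 2 / (2 * c * N)) * √(2 * Real.pi / (c * N)) := by
  have hN' : (0 : ℝ) < N := by exact_mod_cast hN
  have hgi := (integrable_exp_neg_mul_sq (show (0 : ℝ) < c * N / 2 by positivity)).const_mul
    (Real.exp (N * G₁ + β * W ^ 2 / (2 * c * N)))
  have h1 : ∫ y in B, hsWeight β 𝔥 N W y ≤
      ∫ y in B, Real.exp (N * G₁ + β * W ^ 2 / (2 * c * N)) *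
        Real.exp (-(c * N / 2) * y ^ 2) := by
    refine setIntegral_mono_on (integrable_hsWeight hβ.le 𝔥 hN W).integrableOn
      hgi.integrableOn hB fun y hy => ?_
    rw [hsWeight, ← Real.exp_add, Real.exp_le_exp]
    have h2 : W / 2 * tilt β 𝔥 y ≤ |W| * (√β * |y|) := by
      refine (le_abs_self _).trans ?_
      rw [abs_mul, abs_div, abs_two]
      nlinarith [abs_tilt_le' β 𝔥 y, abs_nonneg W]
    have h3 : |W| * (√β * |y|) ≤ β * W ^ 2 / (2 * c * N) + c * N / 2 * y ^ 2 := by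
      have h4 : β * W ^ 2 / (2 * c * N) + c * N / 2 * y ^ 2 - |W| * (√β * |y|) =
          (√β * |W| - c * N * |y|) ^ 2 / (2 * c * N) := by
        rw [sub_sq, mul_pow, mul_pow, Real.sq_sqrt hβ.le, sq_abs, sq_abs]
        field_simp
        ring
      have h5 : 0 ≤ (√β * |W| - c * N * |y|) ^ 2 / (2 * c * N) := by positivity
      linarith
    have h6 := mul_le_mul_of_nonneg_left (hG y hy) hN'.le
    linarith
  refine (h1.trans (setIntegral_le_integral hgi
    (Eventually.of_forall fun y => by positivity))).trans_eq ?_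
  rw [integral_const_mul, integral_gaussian]
  congr 2
  field_simp

/-- On an interval of length ρ / √N to the right of y₁ the parabola costs at most 1/2 in the
exponent. The resulting 1/√N matches the Gaussian prefactor near 0. -/
lemma le_integral_hsWeight {β : ℝ} (hβ : 0 < β) {𝔥 y₁ : ℝ} (hy₁ : y₁ ∈ maximizers β 𝔥) {N : ℕ}
    (hN : 0 < N) {W r₀ ρ : ℝ} (hW : 0 ≤ W) (hρ : 0 < ρ) (hρ1 : ρ ≤ 1)
    (hr : ∀ y ∈ Ioo (y₁ - ρ) (y₁ + ρ), r₀ ≤ tilt β 𝔥 y) :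
    ρ / √N * Real.exp (N * G β 𝔥 y₁ - 1 / 2 + W * r₀ / 2) ≤ ∫ y, hsWeight β 𝔥 N W y := by
  have hN' : (1 : ℝ) ≤ N := by exact_mod_cast hN
  have hs : 1 ≤ √(N : ℝ) := Real.one_le_sqrt.2 hN'
  have hs0 : 0 < √(N : ℝ) := by linarith
  have hsρ : ρ / √N ≤ ρ := div_le_self hρ.le hs
  have hwi := integrable_hsWeight hβ.le 𝔥 hN W
  have h1 : ∫ y in Ioo y₁ (y₁ + ρ / √N), Real.exp (N * G β 𝔥 y₁ - 1 / 2 + W * r₀ / 2) ≤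
      ∫ y in Ioo y₁ (y₁ + ρ / √N), hsWeight β 𝔥 N W y := by
    refine setIntegral_mono_on (integrableOn_const measure_Ioo_lt_top.ne) hwi.integrableOn
      measurableSet_Ioo fun y hy => ?_
    rw [hsWeight, Real.exp_le_exp]
    have h2 := sub_sq_le_G hy₁ hy.1.le
    have h3 := hr y ⟨by linarith [hy.1], by linarith [hy.2]⟩
    have h4 : N * (y - y₁) ^ 2 ≤ 1 := by
      have h5 : y - y₁ ≤ 1 / √N := by
        have : ρ / √N ≤ 1 / √N := by gcongr
        linarith [hy.2]
      have h6 : 0 ≤ y - y₁ := by linarith [hy.1]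
      calc N * (y - y₁) ^ 2 ≤ N * (1 / √N) ^ 2 := by gcongr
        _ = 1 := by
          rw [div_pow, Real.sq_sqrt (by linarith)]
          field_simp
    nlinarith [mul_le_mul_of_nonneg_left h2 (by linarith : (0 : ℝ) ≤ N)]
  rw [setIntegral_const, measureReal_def, Real.volume_Ioo, add_sub_cancel_left,
    ENNReal.toReal_ofReal (by positivity), smul_eq_mul] at h1
  exact h1.trans (setIntegral_le_integral hwi
    (Eventually.of_forall fun y => (hsWeight_pos β 𝔥 N W y).le))

lemma exists_exp_neg_mul_le {C a δ : ℝ} (ha : 0 < a) (hδ : 0 < δ) :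
    ∃ K, ∀ W, K ≤ W → C * Real.exp (-(a * W)) ≤ δ := by
  have h1 : Tendsto (fun W : ℝ => C * Real.exp (-(a * W))) atTop (𝓝 (C * 0)) :=
    (Real.tendsto_exp_neg_atTop_nhds_zero.comp (tendsto_id.const_mul_atTop ha)).const_mul C
  rw [mul_zero] at h1
  obtain ⟨K, hK⟩ := eventually_atTop.1 (h1.eventually_lt_const hδ)
  exact ⟨K, fun W hW => (hK W hW).le⟩

/-- If the fluctuation of the field is positive and not too small, then the
Hubbard-Stratonovich measure concentrates near the positive maximum point of `G`. -/
lemma exists_forall_setIntegral_le_of_pos {β 𝔥 y₁ c : ℝ} (hβ : 0 < β) (h𝔥 : 0 < 𝔥) (hy0 : 0 < y₁)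
    (hy₁ : y₁ ∈ maximizers β 𝔥) (hmax : maximizers β 𝔥 ⊆ {-y₁, 0, y₁}) (hc : 0 < c)
    (hquad : ∀ᶠ y in 𝓝 0, G β 𝔥 y ≤ G β 𝔥 y₁ - c * y ^ 2) {U : Set ℝ} (hUo : IsOpen U)
    (hU : y₁ ∈ U) {δ : ℝ} (hδ : 0 < δ) :
    ∃ K η : ℝ, 0 ≤ K ∧ 0 < η ∧ ∃ N₀ : ℕ, ∀ (N : ℕ) (W : ℝ), N₀ ≤ N → K ≤ W → W ≤ η * N →
      ∫ y in Uᶜ, hsWeight β 𝔥 N W y ≤ δ * ∫ y, hsWeight β 𝔥 N W y := by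
  set r₀ := tilt β 𝔥 y₁ / 2 with hr₀
  have ht := tilt_pos hβ h𝔥 hy0
  have hr0 : 0 < r₀ := half_pos ht
  obtain ⟨ρ', hρ'0, hρ'⟩ := Metric.eventually_nhds_iff_ball.1
    (((continuous_tilt β 𝔥).continuousAt.eventually_const_lt (show r₀ < tilt β 𝔥 y₁ by linarith)).and
      (hUo.mem_nhds hU))
  obtain ⟨s, hs0, hs⟩ := Metric.eventually_nhds_iff_ball.1 hquad
  set ρ := min ρ' 1 with hρ
  have hρ0 : 0 < ρ := by positivity
  set B := Metric.ball y₁ ρ with hB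
  have hBo : IsOpen B := Metric.isOpen_ball
  have hB' : ∀ y ∈ B, r₀ ≤ tilt β 𝔥 y ∧ y ∈ U := fun y hy =>
    (hρ' y (Metric.ball_subset_ball (min_le_left _ _) hy)).imp_left le_of_lt
  set B₀ := Metric.ball (0 : ℝ) s with hB₀
  have hB₀o : IsOpen B₀ := Metric.isOpen_ball
  set D := Neg.neg ⁻¹' B with hD
  have hDo : IsOpen D := hBo.preimage continuous_neg
  have hVo : IsOpen (B ∪ (D ∪ B₀)) := hBo.union (hDo.union hB₀o)
  have hV : maximizers β 𝔥 ⊆ B ∪ (D ∪ B₀) := by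
    intro y hy
    rcases hmax hy with rfl | rfl | rfl
    · refine Or.inr (Or.inl ?_)
      simp [hD, hB, hρ0]
    · exact Or.inr (Or.inr (Metric.mem_ball_self hs0))
    · exact Or.inl (Metric.mem_ball_self hρ0)
  obtain ⟨η₁, hη₁, N₁, h₁⟩ := exists_forall_setIntegral_le hβ hVo hV (show 0 < δ / 3 by positivity)
  obtain ⟨K₂, hK₂⟩ := exists_exp_neg_mul_le (C := 1) hr0 (show 0 < δ / 3 by positivity)
  set C := √(2 * Real.pi / c) * Real.exp (1 / 2) / ρ with hC
  have hC0 : 0 < C := by positivity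
  obtain ⟨K₃, hK₃⟩ := exists_exp_neg_mul_le (C := C) (show 0 < r₀ / 4 by positivity)
    (show 0 < δ / 3 by positivity)
  -- The second bound on η gives βW² / (2cN) ≤ W r₀ / 4, half of the gain W r₀ / 2 near y₁.
  refine ⟨max 0 (max K₂ K₃), min η₁ (c * r₀ / (2 * β)), le_max_left _ _, by positivity, max N₁ 1,
    fun N W hN hKW hW => ?_⟩
  have hN0 : 0 < N := (le_max_right _ _).trans hN
  have hN' : (0 : ℝ) < N := by exact_mod_cast hN0
  have hW0 : 0 ≤ W := (le_max_left _ _).trans hKW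
  have hWK₂ : K₂ ≤ W := (le_max_left _ _).trans ((le_max_right _ _).trans hKW)
  have hWK₃ : K₃ ≤ W := (le_max_right _ _).trans ((le_max_right _ _).trans hKW)
  have hW1 : W ≤ η₁ * N := hW.trans (by gcongr; exact min_le_left _ _)
  have hW2 : W ≤ c * r₀ / (2 * β) * N := hW.trans (by gcongr; exact min_le_right _ _)
  have hwi := integrable_hsWeight hβ.le 𝔥 hN0 W
  have hw0 : ∀ y, 0 ≤ hsWeight β 𝔥 N W y := fun y => (hsWeight_pos β 𝔥 N W y).le
  set I := ∫ y, hsWeight β 𝔥 N W y with hI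
  have hI0 : 0 < I := integral_hsWeight_pos hβ.le 𝔥 hN0 W
  have e1 := h₁ N W ((le_max_left _ _).trans hN) (by rwa [abs_of_nonneg hW0])
  have e2 : ∫ y in D, hsWeight β 𝔥 N W y ≤ δ / 3 * I := by
    refine (setIntegral_hsWeight_neg_le hβ 𝔥 hN0 hW0 hBo.measurableSet fun y hy =>
      (hB' y hy).1).trans ?_
    have := hK₂ W hWK₂
    rw [one_mul, mul_comm r₀] at this
    gcongr
  have e3 : ∫ y in B₀, hsWeight β 𝔥 N W y ≤ δ / 3 * I := by
    have f1 := setIntegral_hsWeight_le_gaussian hβ hc hN0 W hB₀o.measurableSet hs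
    have f2 := le_integral_hsWeight hβ hy₁ hN0 hW0 hρ0 (min_le_right _ _) (fun y hy =>
      (hB' y (by rwa [hB, Real.ball_eq_Ioo])).1)
    have f3 : β * W ^ 2 / (2 * c * N) ≤ W * r₀ / 4 := by
      rw [div_le_iff₀ (by positivity)]
      have : W * (2 * β) ≤ c * r₀ * N := by
        rwa [div_mul_eq_mul_div, le_div_iff₀ (by positivity)] at hW2
      nlinarith
    have f4 : √(2 * Real.pi / (c * N)) = √(2 * Real.pi / c) / √N := by
      rw [← div_div, Real.sqrt_div' _ hN'.le]
    have hs0 : 0 < √(N : ℝ) := Real.sqrt_pos.2 hN'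
    calc ∫ y in B₀, hsWeight β 𝔥 N W y
        ≤ Real.exp (N * G β 𝔥 y₁ + β * W ^ 2 / (2 * c * N)) * √(2 * Real.pi / (c * N)) := f1
      _ ≤ Real.exp (1 / 2 + -(r₀ / 4 * W) + (N * G β 𝔥 y₁ - 1 / 2 + W * r₀ / 2)) *
          √(2 * Real.pi / (c * N)) := by
        refine mul_le_mul_of_nonneg_right (Real.exp_le_exp.2 ?_) (Real.sqrt_nonneg _)
        linarith
      _ = C * Real.exp (-(r₀ / 4 * W)) *
          (ρ / √N * Real.exp (N * G β 𝔥 y₁ - 1 / 2 + W * r₀ / 2)) := by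
        rw [f4, Real.exp_add, Real.exp_add, hC]
        field_simp
      _ ≤ δ / 3 * I := by
        have := hK₃ W hWK₃
        gcongr
  have hsub : Uᶜ ⊆ (D ∪ B₀) ∪ (B ∪ (D ∪ B₀))ᶜ := by
    intro y hy
    by_cases h1 : y ∈ D ∪ B₀
    · exact Or.inl h1
    · refine Or.inr fun h2 => ?_
      rcases h2 with h2 | h2
      · exact hy (hB' y h2).2
      · exact h1 h2
  have g1 := setIntegral_le_add_of_subset_union hwi hw0 hUo.measurableSet.compl
    (hDo.union hB₀o).measurableSet hVo.measurableSet.compl hsub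
  have g2 := setIntegral_le_add_of_subset_union hwi hw0 (hDo.union hB₀o).measurableSet
    hDo.measurableSet hB₀o.measurableSet Subset.rfl
  linarith

/-- When 0 is not a maximum point, continuity alone provides the bound, so one selection argument
serves both regimes. -/
lemma exists_quadratic_bound_of_lt {β 𝔥 G₁ : ℝ} (h : G β 𝔥 0 < G₁) :
    ∃ c, 0 < c ∧ ∀ᶠ y in 𝓝 0, G β 𝔥 y ≤ G₁ - c * y ^ 2 := by
  refine ⟨1, one_pos, ?_⟩
  have hc : Continuous fun y => G β 𝔥 y + 1 * y ^ 2 := (continuous_G β 𝔥).add (by fun_prop)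
  filter_upwards [(hc.tendsto 0).eventually_lt_const (by simpa using h)] with y hy
  linarith

/-- The assumption is G''(0) < 0; the bound follows from log(1 + s) ≤ s and sinh t ≤ t cosh t. -/
lemma exists_quadratic_bound_of_lt_cosh_sq {β 𝔥 : ℝ} (hβ : 0 < β)
    (h : β < Real.cosh (β * 𝔥) ^ 2) :
    ∃ c, 0 < c ∧ ∀ᶠ y in 𝓝 0, G β 𝔥 y ≤ G β 𝔥 0 - c * y ^ 2 := by
  set A := Real.cosh (β * 𝔥) ^ 2 with hA
  have hA0 : 0 < A := hβ.trans h
  have hc : Continuous fun y => β * Real.cosh (√β * y) ^ 2 / A := by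
    have := Real.continuous_cosh
    fun_prop
  have h1 : β / A < 1 := (div_lt_one hA0).2 h
  refine ⟨(1 - β / A) / 4, by linarith, ?_⟩
  filter_upwards [(hc.tendsto 0).eventually_lt_const
    (show β * Real.cosh (√β * 0) ^ 2 / A < (1 + β / A) / 2 by simp; linarith)] with y hy
  have h2 : Real.sinh (√β * y) ^ 2 ≤ β * y ^ 2 * Real.cosh (√β * y) ^ 2 := by
    have h3 := sinh_le_mul_cosh (abs_nonneg (√β * y))
    rw [← Real.abs_sinh, Real.cosh_abs] at h3
    have h4 := pow_le_pow_left₀ (abs_nonneg _) h3 2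
    rw [mul_pow, sq_abs, sq_abs, mul_pow, Real.sq_sqrt hβ.le] at h4
    exact h4
  have h5 := excess_le_sinh_sq_div hA0 (√β * y)
  have h6 : Real.sinh (√β * y) ^ 2 / A ≤ y ^ 2 * (β * Real.cosh (√β * y) ^ 2 / A) := by
    rw [← mul_div_assoc]
    gcongr
    linarith
  have h7 := mul_le_mul_of_nonneg_left hy.le (sq_nonneg y)
  rw [G_eq_excess, G_eq_excess β 𝔥 0, ← hA]
  simp only [mul_zero, excess_zero]
  nlinarith

/-! ### The random field -/

/-- The sign of the sum of the fields. -/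
def fieldSign (N : ℕ) (x : Fin N → ℝ) : ℤ := if 0 ≤ ∑ i, x i then 1 else -1

lemma measurable_fieldSign (N : ℕ) : Measurable (fieldSign N) :=
  Measurable.ite (measurableSet_le measurable_const (by fun_prop)) measurable_const measurable_const

lemma exists_forall_close {β 𝔥 y₁ c : ℝ} (hβ : 0 < β) (h𝔥 : 0 < 𝔥) (hy0 : 0 < y₁)
    (hy₁ : y₁ ∈ maximizers β 𝔥) (hmax : maximizers β 𝔥 ⊆ {-y₁, 0, y₁}) (hc : 0 < c)
    (hquad : ∀ᶠ y in 𝓝 0, G β 𝔥 y ≤ G β 𝔥 y₁ - c * y ^ 2) (k : ℕ) {ε : ℝ} (hε : 0 < ε) :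
    ∃ K η : ℝ, 0 < η ∧ ∃ N₀ : ℕ, ∀ (N : ℕ) (x : ℕ → ℝ), N₀ ≤ N →
      (∀ i, x i = 𝔥 ∨ x i = -𝔥) → K ≤ |(∑ i ∈ Finset.range N, x i) / 𝔥| →
      |(∑ i ∈ Finset.range N, x i) / 𝔥| ≤ η * N →
      (∀ σ, |(gibbsMarginal β x N k).real {σ} -
        (productMeasure β ((fieldSign N fun i => x i : ℤ) * y₁) x k).real {σ}| ≤ ε) ∧
      InformationTheory.klDiv (gibbsMarginal β x N k)
        (productMeasure β ((fieldSign N fun i => x i : ℤ) * y₁) x k) ≤ ENNReal.ofReal ε := by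
  obtain ⟨U, hU, hyU, δ, hδ, h⟩ := gibbsMarginal_close hβ 𝔥 y₁ k hε
  obtain ⟨U', hU', hyU', δ', hδ', h'⟩ := gibbsMarginal_close hβ 𝔥 (-y₁) k hε
  obtain ⟨K, η, hK, hη, N₁, hN₁⟩ :=
    exists_forall_setIntegral_le_of_pos hβ h𝔥 hy0 hy₁ hmax hc hquad hU hyU hδ
  obtain ⟨K', η', hK', hη', N₁', hN₁'⟩ :=
    exists_forall_setIntegral_le_of_pos hβ h𝔥 hy0 hy₁ hmax hc hquad (hU'.preimage continuous_neg)
      hyU' hδ'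
  refine ⟨max K K', min η η', lt_min hη hη', max (max N₁ N₁') (max k 1),
    fun N x hN hx hW1 hW2 => ?_⟩
  have hN1 : N₁ ≤ N := (le_max_left _ _).trans ((le_max_left _ _).trans hN)
  have hN2 : N₁' ≤ N := (le_max_right _ _).trans ((le_max_left _ _).trans hN)
  have hNk : k ≤ N := (le_max_left _ _).trans ((le_max_right _ _).trans hN)
  have hN0 : 0 < N := (le_max_right _ _).trans ((le_max_right _ _).trans hN)
  have hsum : ∑ i : Fin N, x i = ∑ i ∈ Finset.range N, x i :=
    Fin.sum_univ_eq_sum_range (fun i => x i) N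
  set W := (∑ i ∈ Finset.range N, x i) / 𝔥 with hW
  rcases le_or_gt 0 (∑ i ∈ Finset.range N, x i) with h0 | h0
  · have hs : fieldSign N (fun i => x i) = 1 := by rw [fieldSign, hsum, if_pos h0]
    rw [hs, Int.cast_one, one_mul]
    have hW0 : 0 ≤ W := div_nonneg h0 h𝔥.le
    rw [abs_of_nonneg hW0] at hW1 hW2
    refine h N x hN0 hNk hx (hN₁ N W hN1 ((le_max_left _ _).trans hW1) (hW2.trans ?_))
    gcongr
    exact min_le_left _ _
  · have hs : fieldSign N (fun i => x i) = -1 := by rw [fieldSign, hsum, if_neg h0.not_ge]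
    rw [hs, Int.cast_neg, Int.cast_one, neg_one_mul]
    have hW0 : W < 0 := div_neg_of_neg_of_pos h0 h𝔥
    rw [abs_of_neg hW0] at hW1 hW2
    refine h' N x hN0 hNk hx ?_
    -- A negative field sum is reduced to a positive one by the reflection y ↦ -y.
    have key := hN₁' N (-W) hN2 ((le_max_right _ _).trans hW1) (hW2.trans (by
      gcongr; exact min_le_right _ _))
    rw [← preimage_compl, setIntegral_neg_preimage _ hU'.measurableSet.compl,
      ← integral_neg_eq_self (hsWeight β 𝔥 N (-W))] at key
    simpa only [hsWeight_neg, neg_neg] using key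

section Field

variable {Ω : Type*} [MeasurableSpace Ω] {P : Measure Ω} {𝔥 : ℝ} {h : ℕ → Ω → ℝ}

lemma ae_forall_eq_or_eq_neg (hlaw : ∀ i, HasLaw (h i) (dichotomousLaw 𝔥) P) :
    ∀ᵐ ω ∂P, ∀ i, h i ω = 𝔥 ∨ h i ω = -𝔥 := by
  rw [ae_all_iff]
  intro i
  have hm : MeasurableSet {t : ℝ | t = 𝔥 ∨ t = -𝔥} :=
    (measurableSet_singleton 𝔥).union (measurableSet_singleton (-𝔥))
  have h1 : ∀ᵐ t ∂dichotomousLaw 𝔥, t = 𝔥 ∨ t = -𝔥 := by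
    rw [dichotomousLaw, ae_add_measure_iff]
    constructor <;> refine Measure.ae_smul_measure ?_ _ <;> rw [ae_dirac_iff hm] <;> simp
  exact ((hlaw i).ae_iff (p := fun t => t = 𝔥 ∨ t = -𝔥) (measurableSet_setOfPred.1 hm)).2 h1

variable [IsProbabilityMeasure P]

lemma ae_tendsto_sum_div (hindep : iIndepFun h P)
    (hlaw : ∀ i, HasLaw (h i) (dichotomousLaw 𝔥) P) :
    ∀ᵐ ω ∂P, Tendsto (fun N : ℕ => (∑ i ∈ Finset.range N, h i ω) / 𝔥 / N) atTop (𝓝 0) := by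
  have hint : Integrable (h 0) P := by
    refine Integrable.of_bound (hlaw 0).aemeasurable.aestronglyMeasurable |𝔥| ?_
    filter_upwards [ae_forall_eq_or_eq_neg hlaw] with ω hω
    rcases hω 0 with h1 | h1 <;> rw [h1] <;> simp
  have hmean : P[h 0] = 0 := by
    have := (hlaw 0).integral_comp (f := id) aestronglyMeasurable_id
    rw [integral_dichotomousLaw] at this
    simpa using this
  filter_upwards [strong_law_ae_real h hint (fun i j hij => hindep.indepFun hij)
    fun i => (hlaw i).identDistrib (hlaw 0)] with ω hω
  rw [hmean] at hω
  have := hω.div_const 𝔥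
  rw [zero_div] at this
  exact this.congr fun N => div_right_comm _ _ _

lemma tendsto_measure_lt_abs_sum (hindep : iIndepFun h P)
    (hlaw : ∀ i, HasLaw (h i) (dichotomousLaw 𝔥) P) {η : ℝ} (hη : 0 < η) :
    Tendsto (fun N : ℕ => P {ω | η * N < |(∑ i ∈ Finset.range N, h i ω) / 𝔥|}) atTop (𝓝 0) := by
  have h1 := tendstoInMeasure_iff_norm.1 (tendstoInMeasure_of_tendsto_ae (fun N =>
    (((Finset.aemeasurable_fun_sum _ fun i _ => (hlaw i).aemeasurable).div_const
      𝔥).div_const (N : ℝ)).aestronglyMeasurable) (ae_tendsto_sum_div hindep hlaw)) η hη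
  refine tendsto_of_tendsto_of_tendsto_of_le_of_le' tendsto_const_nhds h1
    (Eventually.of_forall fun _ => zero_le) ?_
  filter_upwards [eventually_gt_atTop 0] with N hN
  refine measure_mono fun ω hω => ?_
  have hN' : (0 : ℝ) < N := by exact_mod_cast hN
  simp only [mem_ofPred_eq, sub_zero, norm_div, Real.norm_eq_abs, Nat.abs_cast] at hω ⊢
  rw [le_div_iff₀ hN', ← abs_div]
  exact hω.le

/-- On the scale √N a fixed bound K shrinks to 0. The central limit theorem, applied on a closed
interval of small Gaussian mass around 0, gives the claim. -/
lemma tendsto_measure_abs_sum_lt (h𝔥 : 0 < 𝔥) (hindep : iIndepFun h P)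
    (hlaw : ∀ i, HasLaw (h i) (dichotomousLaw 𝔥) P) (K : ℝ) :
    Tendsto (fun N : ℕ => P {ω | |(∑ i ∈ Finset.range N, h i ω) / 𝔥| < K}) atTop (𝓝 0) := by
  set X : ℕ → Ω → ℝ := fun i ω => h i ω / 𝔥 with hX
  have hXi : iIndepFun X P := hindep.comp (fun _ t => t / 𝔥) fun _ => by fun_prop
  have hXd : ∀ i, IdentDistrib (X i) (X 0) P P := fun i =>
    ((hlaw i).identDistrib (hlaw 0)).comp (u := fun t => t / 𝔥) (by fun_prop)
  have h0 : P[X 0] = 0 := by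
    have := (hlaw 0).integral_comp (f := fun t => t / 𝔥) (by fun_prop)
    rw [integral_dichotomousLaw] at this
    simpa [Function.comp_def, neg_div] using this
  have h1 : P[X 0 ^ 2] = 1 := by
    have := (hlaw 0).integral_comp (f := fun t => (t / 𝔥) ^ 2) (by fun_prop)
    rw [integral_dichotomousLaw] at this
    simpa [Function.comp_def, neg_div, div_self h𝔥.ne'] using this
  have hclt := (tendstoInDistribution_inv_sqrt_mul_sum (P' := gaussianReal 0 1) (Y := id)
    HasLaw.id h0 h1 hXi hXd).tendsto
  refine ENNReal.tendsto_nhds_zero.2 fun δ hδ => ?_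
  have : NullSingletonClass (gaussianReal 0 1) := nullSingletonClass_gaussianReal one_ne_zero
  obtain ⟨e, he0, he⟩ := (((tendsto_measure_Icc (gaussianReal 0 1) 0).mono_left
    nhdsWithin_le_nhds).eventually_lt_const hδ |>.and
      (eventually_mem_nhdsWithin (a := (0 : ℝ)) (s := Ioi 0))).exists
  have hlim := (ProbabilityMeasure.limsup_measure_closed_le_of_tendsto hclt
    (isClosed_Icc (a := 0 - e) (b := 0 + e)))
  simp only [ProbabilityMeasure.coe_mk, Measure.map_id] at hlim
  have h2 := eventually_lt_of_limsup_lt (hlim.trans_lt he0)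
  have h3 : Tendsto (fun N : ℕ => √(N : ℝ) * e) atTop atTop :=
    (Real.tendsto_sqrt_atTop.comp tendsto_natCast_atTop_atTop).atTop_mul_const he
  filter_upwards [h2, h3.eventually_ge_atTop K, eventually_gt_atTop 0] with N hN hNK hN0
  refine le_trans ?_ hN.le
  rw [Measure.map_apply_of_aemeasurable (.const_mul (Finset.aemeasurable_fun_sum _ fun _ _ =>
    (hXd _).aemeasurable_fst) _) measurableSet_Icc]
  refine measure_mono fun ω hω => ?_
  have hs : 0 < √(N : ℝ) := Real.sqrt_pos.2 (by exact_mod_cast hN0)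
  have h4 : |(∑ i ∈ Finset.range N, h i ω) / 𝔥| < √N * e := lt_of_lt_of_le hω hNK
  rw [Finset.sum_div, abs_lt] at h4
  simp only [mem_preimage, mem_Icc, zero_sub, zero_add, hX, inv_mul_eq_div]
  rw [le_div_iff₀ hs, div_le_iff₀ hs]
  constructor <;> nlinarith

lemma tendsto_measure_not_of_forall (h𝔥 : 0 < 𝔥) (hindep : iIndepFun h P)
    (hlaw : ∀ i, HasLaw (h i) (dichotomousLaw 𝔥) P) {p : ℕ → (ℕ → ℝ) → Prop} {K η : ℝ}
    (hη : 0 < η) {N₀ : ℕ} (hp : ∀ (N : ℕ) (x : ℕ → ℝ), N₀ ≤ N →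
      (∀ i, x i = 𝔥 ∨ x i = -𝔥) → K ≤ |(∑ i ∈ Finset.range N, x i) / 𝔥| →
      |(∑ i ∈ Finset.range N, x i) / 𝔥| ≤ η * N → p N x) :
    Tendsto (fun N => P {ω | ¬ p N fun i => h i ω}) atTop (𝓝 0) := by
  have h1 := (tendsto_measure_abs_sum_lt h𝔥 hindep hlaw K).add
    (tendsto_measure_lt_abs_sum hindep hlaw hη)
  rw [add_zero] at h1
  refine tendsto_of_tendsto_of_tendsto_of_le_of_le' tendsto_const_nhds h1
    (Eventually.of_forall fun _ => zero_le) ?_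
  filter_upwards [eventually_ge_atTop N₀] with N hN
  refine le_trans (measure_mono_ae ?_) (measure_union_le _ _)
  filter_upwards [ae_forall_eq_or_eq_neg hlaw] with ω hω hpω
  by_contra hc
  have hc' : ¬ (|(∑ i ∈ Finset.range N, h i ω) / 𝔥| < K ∨
    η * N < |(∑ i ∈ Finset.range N, h i ω) / 𝔥|) := hc
  rw [not_or, not_lt, not_lt] at hc'
  exact hpω (hp N _ hN hω hc'.1 hc'.2)

/-- The index is the sign of the field sum; 0 is never selected, even where it is a maximum point.
-/
lemma convergesToSelectedProduct {β y₁ c : ℝ} (hβ : 0 < β) (h𝔥 : 0 < 𝔥) (hindep : iIndepFun h P)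
    (hlaw : ∀ i, HasLaw (h i) (dichotomousLaw 𝔥) P) (hy0 : 0 < y₁)
    (hy₁ : y₁ ∈ maximizers β 𝔥) (hmax : maximizers β 𝔥 ⊆ {-y₁, 0, y₁}) (hc : 0 < c)
    (hquad : ∀ᶠ y in 𝓝 0, G β 𝔥 y ≤ G β 𝔥 y₁ - c * y ^ 2) {S : Set ℤ} (hS : 1 ∈ S)
    (hS' : -1 ∈ S) (k : ℕ) : ConvergesToSelectedProduct P h β y₁ S k := by
  refine ⟨fieldSign, measurable_fieldSign, fun N x => ?_, fun σ => ?_, fun ε hε => ?_⟩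
  · unfold fieldSign
    split_ifs <;> assumption
  · rw [tendstoInMeasure_iff_norm]
    intro ε hε
    obtain ⟨K, η, hη, N₀, hN₀⟩ := exists_forall_close hβ h𝔥 hy0 hy₁ hmax hc hquad k (half_pos hε)
    have key := tendsto_measure_not_of_forall h𝔥 hindep hlaw (p := fun N x =>
      |(gibbsMarginal β x N k).real {σ} -
        (productMeasure β ((fieldSign N fun i => x i : ℤ) * y₁) x k).real {σ}| ≤ ε / 2) hη
      fun N x hN hx h1 h2 => (hN₀ N x hN hx h1 h2).1 σ
    refine tendsto_of_tendsto_of_tendsto_of_le_of_le tendsto_const_nhds key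
      (fun _ => zero_le) fun N => measure_mono fun ω hω => ?_
    simp only [mem_ofPred_eq, sub_zero, Real.norm_eq_abs, abs_abs] at hω
    rw [mem_ofPred_eq, not_le]
    linarith
  · obtain ⟨r, hr0, hr⟩ := ENNReal.lt_iff_exists_nnreal_btwn.1 hε
    have hr0' : (0 : ℝ) < r := by exact_mod_cast hr0
    obtain ⟨K, η, hη, N₀, hN₀⟩ := exists_forall_close hβ h𝔥 hy0 hy₁ hmax hc hquad k hr0'
    have key := tendsto_measure_not_of_forall h𝔥 hindep hlaw (p := fun N x =>
      InformationTheory.klDiv (gibbsMarginal β x N k)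
        (productMeasure β ((fieldSign N fun i => x i : ℤ) * y₁) x k) ≤ ENNReal.ofReal r) hη
      fun N x hN hx h1 h2 => (hN₀ N x hN hx h1 h2).2
    refine tendsto_of_tendsto_of_tendsto_of_le_of_le tendsto_const_nhds key
      (fun _ => zero_le) fun N => measure_mono fun ω hω => ?_
    rw [mem_ofPred_eq, not_le, ENNReal.ofReal_coe_nnreal]
    exact hr.trans_le hω

lemma ae_tendsto_klDiv {β : ℝ} (hβ : 0 < β) (hindep : iIndepFun h P)
    (hlaw : ∀ i, HasLaw (h i) (dichotomousLaw 𝔥) P) (hmax : maximizers β 𝔥 = {0}) (k : ℕ) :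
    ∀ᵐ ω ∂P, Tendsto (fun N => InformationTheory.klDiv (gibbsMarginal β (fun i => h i ω) N k)
      (productMeasure β 0 (fun i => h i ω) k)) atTop (𝓝 0) := by
  filter_upwards [ae_forall_eq_or_eq_neg hlaw, ae_tendsto_sum_div hindep hlaw] with ω hω hsum
  refine ENNReal.tendsto_nhds_zero.2 fun ε hε => ?_
  obtain ⟨r, hr0, hr⟩ := ENNReal.lt_iff_exists_nnreal_btwn.1 hε
  have hr0' : (0 : ℝ) < r := by exact_mod_cast hr0
  obtain ⟨U, hU, hyU, δ, hδ, hclose⟩ := gibbsMarginal_close hβ 𝔥 0 k hr0'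
  obtain ⟨η, hη, N₀, hN₀⟩ := exists_forall_setIntegral_le hβ hU
    (by rw [hmax]; exact singleton_subset_iff.2 hyU) hδ
  filter_upwards [eventually_ge_atTop N₀, eventually_ge_atTop k, eventually_gt_atTop 0,
    hsum.norm.eventually_lt_const (by simpa using hη)] with N h1 h2 h3 h4
  have hN' : (0 : ℝ) < N := by exact_mod_cast h3
  have h5 := (hclose N (fun i => h i ω) h3 h2 hω (hN₀ N _ h1 (by
    rw [Real.norm_eq_abs, abs_div, Nat.abs_cast, div_lt_iff₀ hN'] at h4
    exact h4.le))).2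
  rw [ENNReal.ofReal_coe_nnreal] at h5
  exact h5.trans hr.le

end Field

end RandomFieldCurieWeiss

end

theorem mainTheorem4 {Ω : Type*} [MeasurableSpace Ω] (P : Measure Ω) [IsProbabilityMeasure P]
    (β 𝔥 : ℝ) (hβ : 0 < β) (h𝔥 : 0 ≤ 𝔥) (h : ℕ → Ω → ℝ) (hindep : iIndepFun h P)
    (hlaw : ∀ i, HasLaw (h i) (RandomFieldCurieWeiss.dichotomousLaw 𝔥) P) :
    -- the critical line `f`
    (StrictMonoOn RandomFieldCurieWeiss.criticalBeta (Set.Ico 0 (1 / 2)) ∧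
      RandomFieldCurieWeiss.criticalBeta 0 = 1 ∧
      Tendsto RandomFieldCurieWeiss.criticalBeta (𝓝[<] (1 / 2)) atTop) ∧
    -- below the critical line the unique maximum is non-degenerate
    (𝔥 < 1 / 2 → β < RandomFieldCurieWeiss.criticalBeta 𝔥 →
      RandomFieldCurieWeiss.IsNondegenerateMax β 𝔥 0) ∧
    -- the regimes with a unique maximum of `G`
    ((1 / 2 ≤ 𝔥 ∨
      (𝔥 < 1 / 2 ∧ β < RandomFieldCurieWeiss.criticalBeta 𝔥) ∨
      (β = RandomFieldCurieWeiss.criticalBeta 𝔥 ∧ 𝔥 ≤ 2 / 3 * Real.arcosh √(3 / 2))) →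
      RandomFieldCurieWeiss.maximizers β 𝔥 = {0} ∧
      ∀ k : ℕ, ∀ᵐ ω ∂P,
        Tendsto
          (fun N => InformationTheory.klDiv
            (RandomFieldCurieWeiss.gibbsMarginal β (fun i => h i ω) N k)
            (RandomFieldCurieWeiss.productMeasure β 0 (fun i => h i ω) k))
          atTop (𝓝 0)) ∧
    -- the ferromagnetic regime
    (𝔥 < 1 / 2 → RandomFieldCurieWeiss.criticalBeta 𝔥 < β →
      ∃ y₁ : ℝ, 0 < y₁ ∧ RandomFieldCurieWeiss.maximizers β 𝔥 = {-y₁, y₁} ∧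
        RandomFieldCurieWeiss.IsNondegenerateMax β 𝔥 (-y₁) ∧
        RandomFieldCurieWeiss.IsNondegenerateMax β 𝔥 y₁ ∧
        (0 < 𝔥 → ∀ k : ℕ,
          RandomFieldCurieWeiss.ConvergesToSelectedProduct P h β y₁ {-1, 1} k)) ∧
    -- the first-order phase transition
    (𝔥 < 1 / 2 → β = RandomFieldCurieWeiss.criticalBeta 𝔥 →
      2 / 3 * Real.arcosh √(3 / 2) < 𝔥 →
      ∃ y₁ : ℝ, 0 < y₁ ∧ RandomFieldCurieWeiss.maximizers β 𝔥 = {-y₁, 0, y₁} ∧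
        RandomFieldCurieWeiss.IsNondegenerateMax β 𝔥 (-y₁) ∧
        RandomFieldCurieWeiss.IsNondegenerateMax β 𝔥 0 ∧
        RandomFieldCurieWeiss.IsNondegenerateMax β 𝔥 y₁ ∧
        ∀ k : ℕ, RandomFieldCurieWeiss.ConvergesToSelectedProduct P h β y₁ {-1, 0, 1} k) := by
  open RandomFieldCurieWeiss in
  refine ⟨⟨strictMonoOn_criticalBeta, criticalBeta_zero, tendsto_criticalBeta⟩, fun h1 h2 => ?_,
    fun hreg => ?_, fun h1 h2 => ?_, fun h1 h2 h3 => ?_⟩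
  · exact isNondegenerateMax_zero_of_mul_maxRatio_lt hβ
      ((criticalBeta_spec h𝔥 h1).2.2.1 β hβ h2)
  · have hmax : maximizers β 𝔥 = {0} := by
      rcases hreg with h1 | ⟨h1, h2⟩ | ⟨h1, h2⟩
      · exact maximizers_of_lt hβ (mul_maxRatio_lt_one_of_half_le hβ h1)
      · exact maximizers_of_lt hβ ((criticalBeta_spec h𝔥 h1).2.2.1 β hβ h2)
      · have e := (criticalBeta_spec h𝔥 (h2.trans_lt two_thirds_arcosh_lt_half)).2.1
        rw [← h1] at e
        exact maximizers_of_eq_of_le hβ e ((cosh_sq_le_iff hβ h𝔥 e).2 h2)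
    exact ⟨hmax, fun k => ae_tendsto_klDiv hβ hindep hlaw hmax k⟩
  · obtain ⟨y₁, hy0, hmax⟩ := maximizers_of_gt hβ ((criticalBeta_spec h𝔥 h1).2.2.2 β h2)
    have hy₁ : y₁ ∈ maximizers β 𝔥 := by simp [hmax]
    have hnd := isNondegenerateMax_of_pos hβ hy0 hy₁
    refine ⟨y₁, hy0, hmax, hnd.neg hβ, hnd, fun hpos k => ?_⟩
    have h0 : (0 : ℝ) ∉ maximizers β 𝔥 := by
      rw [hmax]
      simp [hy0.ne, hy0.ne']
    have hlt : G β 𝔥 0 < G β 𝔥 y₁ := by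
      refine lt_of_le_of_ne (hy₁ 0) fun he => h0 fun z => ?_
      rw [he]
      exact hy₁ z
    obtain ⟨c, hc, hquad⟩ := exists_quadratic_bound_of_lt hlt
    refine convergesToSelectedProduct hβ hpos hindep hlaw hy0 hy₁ ?_ hc hquad (by simp) (by simp) k
    rw [hmax]
    exact insert_subset_insert (subset_insert _ _)
  · have e := (criticalBeta_spec h𝔥 h1).2.1
    rw [← h2] at e
    have hA : 3 / 2 < Real.cosh (β * 𝔥) ^ 2 := by
      rw [← not_le, cosh_sq_le_iff hβ h𝔥 e]
      exact not_le.2 h3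
    have hpos : 0 < 𝔥 := lt_of_le_of_lt
      (mul_nonneg (by norm_num) (Real.arcosh_nonneg (Real.one_le_sqrt.2 (by norm_num)))) h3
    have hlt : β < Real.cosh (β * 𝔥) ^ 2 := lt_cosh_sq_of_mul_maxRatio_eq hβ e hA
    obtain ⟨y₁, hy0, hmax⟩ := maximizers_of_eq_of_gt hβ e hA
    have hy₁ : y₁ ∈ maximizers β 𝔥 := by simp [hmax]
    have h0 : (0 : ℝ) ∈ maximizers β 𝔥 := by simp [hmax]
    have hnd := isNondegenerateMax_of_pos hβ hy0 hy₁
    refine ⟨y₁, hy0, hmax, hnd.neg hβ, isNondegenerateMax_zero hβ h0 hlt, hnd, fun k => ?_⟩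
    obtain ⟨c, hc, hquad⟩ := exists_quadratic_bound_of_lt_cosh_sq hβ hlt
    -- On the critical line G(0) = G(y₁), so the parabola below G(0) is the one the selection
    -- argument needs.
    rw [le_antisymm (hy₁ 0) (h0 y₁)] at hquad
    exact convergesToSelectedProduct hβ hpos hindep hlaw hy0 hy₁ hmax.subset hc hquad (by simp)
      (by simp) k
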